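/- Let $n,m,K,T\ge1$ be integers with $m\le n$, let $d_u,d_v\ge 0$, let $\mathcal D_1,\dots,\mathcal D_n$ be probability distributions, and consider $$\min_{u\in\mathbb R^{d_u},\ \mathbf v=(v_1,\dots,v_n)\in(\mathbb R^{d_v})^n} f(u,\mathbf v)=\frac1n\sum_{i=1}^n f_i(u,v_i),\qquad f_i(u,v)=\mathbb E_{\xi\sim\mathcal D_i}F(u,v;\xi).$$ Assume: (1) each $f_i$ is differentiable in $u$ and in $v$; $\nabla_uf_i$ is $L_u$-Lipschitz in $u$ and $L_{uv}$-Lipschitz in $v$; $\nabla_vf_i$ is $L_v$-Lipschitz in $v$ and $L_{vu}$-Lipschitz in $u$; put $L=\max\{L_u,L_v,L_{uv},L_{vu}\}$; (2) for all $i,u,v$ and $\xi\sim\mathcal D_i$, the gradients $\nabla_uF(u,v;\xi)$ and $\nabla_vF(u,v;\xi)$ exist almost surely, are unbiased estimators of $\nabla_uf_i(u,v)$ and $\nabla_vf_i(u,v)$, and satisfy $\mathbb E\|\nabla_uF(u,v;\xi)-\nabla_uf_i(u,v)\|^2\le\sigma_u^2$ and $\mathbb E\|\nabla_vF(u,v;\xi)-\nabla_vf_i(u,v)\|^2\le\sigma_v^2$;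 (3) $f$ is bounded below, and $F_0=f(u^0,\mathbf v^0)-\inf f>0$. No bound on the dissimilarity of the gradients of different clients is assumed. Scaffold-P with step sizes $\gamma_u,\gamma_v,\eta_u,\eta_v$ is the following algorithm. It starts from deterministic $u^0,\mathbf v^0$, with $c_i^0=\frac1K\sum_{k=0}^{K-1}\nabla_uF(u^0,v_i^0;\xi_{i,k}^{-1})$ and $c^0=\frac1n\sum_ic_i^0$. In round $t=0,\dots,T-1$ a set $\mathcal S^t$ is drawn uniformly among the $m$-element subsets of $\{1,\dots,n\}$. Each client $i\in\mathcal S^t$ sets $u_{i,0}^t=u^t$, $v_{i,0}^t=v_i^t$ and, for $k=0,\dots,K-1$, $$u_{i,k+1}^t=u_{i,k}^t-\gamma_u\big(\nabla_uF(u_{i,k}^t,v_{i,k}^t;\xi_{i,k}^t)-c_i^t+c^t\big),\qquad v_{i,k+1}^t=v_{i,k}^t-\gamma_v\nabla_vF(u_{i,k}^t,v_{i,k}^t;\xi_{i,k}^t),$$ and then $v_i^{t+1}=(1-\eta_v)v_i^t+\eta_vv_{i,K}^t$ and $c_i^{t+1}=c_i^t-c^t+\frac1{K\gamma_u}(u^t-u_{i,K}^t)$;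 for $i\notin\mathcal S^t$, $v_i$ and $c_i$ are unchanged. Finally $$u^{t+1}=(1-\eta_u)u^t+\frac{\eta_u}m\sum_{i\in\mathcal S^t}u_{i,K}^t,\qquad c^{t+1}=c^t+\frac1n\sum_{i\in\mathcal S^t}(c_i^{t+1}-c_i^t).$$ Here $\xi_{i,k}^t\sim\mathcal D_i$ for $-1\le t\le T-1$, and all the $\xi_{i,k}^t$ and $\mathcal S^t$ are mutually independent. Write $$\mathcal G_u^t=\mathbb E\|\nabla_uf(u^t,\mathbf v^t)\|^2,\qquad \hat{\mathcal G}_{\mathbf v}^t=\frac m{n^2}\sum_{i=1}^n\mathbb E\|\nabla_{v}f_i(u^t,v_i^t)\|^2 .$$ Suppose $\eta_u\ge\sqrt m$, $\eta_v\ge\sqrt{n/m}$, and $\gamma_u\eta_u=\gamma_v\eta_v=\gamma$, where $$\gamma=\Big(72LK\max\big(\tfrac{n^{2/3}}m,1\big)+\sqrt{\tfrac{37LKT}{F_0}\big(\tfrac{\sigma_u^2}m+\tfrac{m\sigma_v^2}n\big)}\Big)^{-1}.$$ Then the expectations above are finite for $0\le t<T$, and $$\frac1T\sum_{t=0}^{T-1}\big(\mathcal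 G_u^t+\hat{\mathcal G}_{\mathbf v}^t\big)\le 8\sqrt{\frac{37LF_0}{KT}\Big(\frac{\sigma_u^2}m+\frac{m\sigma_v^2}n\Big)}+\frac{288LF_0}T\max\Big(1,\frac{n^{2/3}}m\Big).$$ In particular, if there are no personal variables ($d_v=0$, $\sigma_v=0$), so that Scaffold-P is Scaffold, then $$\frac1T\sum_{t=0}^{T-1}\mathcal G_u^t\le 8\sqrt{\frac{37LF_0\sigma_u^2}{mKT}}+\frac{288LF_0}T\max\Big(1,\frac{n^{2/3}}m\Big).$$ This improves the previously known Scaffold rate $O\big(\sqrt{\sigma_u^2/(mKT)}+\frac1T(n/m)^{2/3}\big)$ in the following sense: $\max(1,n^{2/3}/m)\le(n/m)^{2/3}$, with strict inequality if $1<m<n$. -/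

import Mathlib

open MeasureTheory ProbabilityTheory
open scoped NNReal

namespace ScaffoldP

/-- The Euclidean space `ℝ^d`. -/
abbrev Vec (d : ℕ) := EuclideanSpace ℝ (Fin d)

/-- The partial gradient `∇_u h (u, v)`. -/
noncomputable def gradU {du dv : ℕ} (h : Vec du → Vec dv → ℝ) (u : Vec du) (v : Vec dv) : Vec du :=
  gradient (fun x => h x v) u

/-- The partial gradient `∇_v h (u, v)`. -/
noncomputable def gradV {du dv : ℕ} (h : Vec du → Vec dv → ℝ) (u : Vec du) (v : Vec dv) : Vec dv :=
  gradient (fun y => h u y) v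

/-- The stochastic gradient `∇_u F (u, v; z)`. -/
noncomputable def stochGradU {du dv : ℕ} {Ξ : Type*} (F : Vec du → Vec dv → Ξ → ℝ)
    (u : Vec du) (v : Vec dv) (z : Ξ) : Vec du :=
  gradU (fun x y => F x y z) u v

/-- The stochastic gradient `∇_v F (u, v; z)`. -/
noncomputable def stochGradV {du dv : ℕ} {Ξ : Type*} (F : Vec du → Vec dv → Ξ → ℝ)
    (u : Vec du) (v : Vec dv) (z : Ξ) : Vec dv :=
  gradV (fun x y => F x y z) u v

/-- The objective of client `i`: `f_i (u, v_i) = E_{z ∼ D_i} F (u, v_i; z)`. -/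
noncomputable def clientLoss {n du dv : ℕ} {Ξ : Type*} [MeasurableSpace Ξ]
    (F : Vec du → Vec dv → Ξ → ℝ) (D : Fin n → Measure Ξ) (i : Fin n)
    (u : Vec du) (v : Vec dv) : ℝ :=
  ∫ z, F u v z ∂(D i)

/-- The global objective `f (u, v) = (1/n) ∑ i, f_i (u, v_i)`. -/
noncomputable def loss {n du dv : ℕ} {Ξ : Type*} [MeasurableSpace Ξ]
    (F : Vec du → Vec dv → Ξ → ℝ) (D : Fin n → Measure Ξ)
    (u : Vec du) (v : Fin n → Vec dv) : ℝ :=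
  (1 / (n : ℝ)) * ∑ i, clientLoss F D i u (v i)

/-- The initial gap `F_0 = f (u⁰, v⁰) - inf f`. -/
noncomputable def initialGap {n du dv : ℕ} {Ξ : Type*} [MeasurableSpace Ξ]
    (F : Vec du → Vec dv → Ξ → ℝ) (D : Fin n → Measure Ξ)
    (u₀ : Vec du) (v₀ : Fin n → Vec dv) : ℝ :=
  loss F D u₀ v₀ - ⨅ p : Vec du × (Fin n → Vec dv), loss F D p.1 p.2

/-- Smoothness: every `f_i` is differentiable in each of its two arguments, and each partial
gradient is Lipschitz in each argument, the other one being held fixed. -/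
structure Smooth {n du dv : ℕ} (f : Fin n → Vec du → Vec dv → ℝ) (Lu Luv Lv Lvu : ℝ≥0) :
    Prop where
  diffU : ∀ i v, Differentiable ℝ (fun u => f i u v)
  diffV : ∀ i u, Differentiable ℝ (fun v => f i u v)
  lipUU : ∀ i v, LipschitzWith Lu (fun u => gradU (f i) u v)
  lipUV : ∀ i u, LipschitzWith Luv (fun v => gradU (f i) u v)
  lipVV : ∀ i u, LipschitzWith Lv (fun v => gradV (f i) u v)
  lipVU : ∀ i v, LipschitzWith Lvu (fun u => gradV (f i) u v)

/-- The stochastic gradient model: the loss is integrable and differentiable at every point for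
almost every sample, its gradients are measurable, unbiased, and of variance at most
`σu ^ 2`, `σv ^ 2`. -/
structure StochasticGradient {n du dv : ℕ} {Ξ : Type*} [MeasurableSpace Ξ]
    (F : Vec du → Vec dv → Ξ → ℝ) (D : Fin n → Measure Ξ) (σu σv : ℝ) : Prop where
  integrable : ∀ i u v, Integrable (F u v) (D i)
  diffU : ∀ i u v, ∀ᵐ z ∂(D i), DifferentiableAt ℝ (fun x => F x v z) u
  diffV : ∀ i u v, ∀ᵐ z ∂(D i), DifferentiableAt ℝ (fun y => F u y z) v
  measurableU : Measurable (fun p : Vec du × Vec dv × Ξ => stochGradU F p.1 p.2.1 p.2.2)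
  measurableV : Measurable (fun p : Vec du × Vec dv × Ξ => stochGradV F p.1 p.2.1 p.2.2)
  memLpU : ∀ i u v, MemLp (stochGradU F u v) 2 (D i)
  memLpV : ∀ i u v, MemLp (stochGradV F u v) 2 (D i)
  unbiasedU : ∀ i u v, ∫ z, stochGradU F u v z ∂(D i) = gradU (clientLoss F D i) u v
  unbiasedV : ∀ i u v, ∫ z, stochGradV F u v z ∂(D i) = gradV (clientLoss F D i) u v
  varianceU : ∀ i u v,
    ∫ z, ‖stochGradU F u v z - gradU (clientLoss F D i) u v‖ ^ 2 ∂(D i) ≤ σu ^ 2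
  varianceV : ∀ i u v,
    ∫ z, ‖stochGradV F u v z - gradV (clientLoss F D i) u v‖ ^ 2 ∂(D i) ≤ σv ^ 2

/-- The randomness of `T` rounds with `K` local steps. The time index of the data samples is
shifted by one: `ξ 0 i k` is the sample `ξ_{i,k}^{-1}` used for initializing the control variables,
and `ξ (t + 1) i k` is the sample `ξ_{i,k}^t` used in round `t`. Every sample of client `i` has law
`D i`, each `S t` is uniform among the sets of `m` clients, and all samples and all client sets
together are mutually independent. -/
structure Sampling {n : ℕ} {Ξ Ω : Type*} [MeasurableSpace Ξ] [MeasurableSpace Ω] (P : Measure Ω)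
    (D : Fin n → Measure Ξ) (m K T : ℕ) (ξ : ℕ → Fin n → ℕ → Ω → Ξ)
    (S : ℕ → Ω → Finset (Fin n)) : Prop where
  measurable_sample : ∀ t ≤ T, ∀ i, ∀ k < K, Measurable (ξ t i k)
  law_sample : ∀ t ≤ T, ∀ i, ∀ k < K, P.map (ξ t i k) = D i
  measurable_clients : ∀ t < T, ∀ s : Finset (Fin n), MeasurableSet (S t ⁻¹' {s})
  law_clients : ∀ t < T, ∀ s : Finset (Fin n), s.card = m →
    P (S t ⁻¹' {s}) = ((n.choose m : ℕ) : ENNReal)⁻¹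
  independent : iIndep
    (Sum.elim
      (fun q : Fin (T + 1) × Fin n × Fin K =>
        MeasurableSpace.comap (ξ q.1 q.2.1 q.2.2) inferInstance)
      (fun t : Fin T => MeasurableSpace.comap (S t) (⊤ : MeasurableSpace (Finset (Fin n))))) P

/-- The variables kept between rounds: shared variable `u`, personal variables `v i`, client
control variables `c i`, server control variable `cbar`. -/
structure State (n du dv : ℕ) where
  u : Vec du
  v : Fin n → Vec dv
  c : Fin n → Vec du
  cbar : Vec du

/-- Initialization: `c_i⁰ = (1/K) ∑ k, ∇_u F (u⁰, v_i⁰; ξ_{i,k}^{-1})` and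
`c⁰ = (1/n) ∑ i, c_i⁰`. -/
noncomputable def initState {n du dv : ℕ} {Ξ : Type*} (F : Vec du → Vec dv → Ξ → ℝ) (K : ℕ)
    (u₀ : Vec du) (v₀ : Fin n → Vec dv) (z : Fin n → ℕ → Ξ) : State n du dv :=
  let c₀ : Fin n → Vec du := fun i =>
    (1 / (K : ℝ)) • ∑ k ∈ Finset.range K, stochGradU F u₀ (v₀ i) (z i k)
  { u := u₀
    v := v₀
    c := c₀
    cbar := (1 / (n : ℝ)) • ∑ i, c₀ i }

/-- The local iterates `(u_{i,k}, v_{i,k})` of client `i` in a round started in state `x`, where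
`z k` is the data sample of local step `k`. -/
noncomputable def localIter {n du dv : ℕ} {Ξ : Type*} (F : Vec du → Vec dv → Ξ → ℝ)
    (γu γv : ℝ) (x : State n du dv) (i : Fin n) (z : ℕ → Ξ) : ℕ → Vec du × Vec dv
  | 0 => (x.u, x.v i)
  | k + 1 =>
    let p := localIter F γu γv x i z k
    (p.1 - γu • (stochGradU F p.1 p.2 (z k) - x.c i + x.cbar),
      p.2 - γv • stochGradV F p.1 p.2 (z k))

/-- One round with set of participating clients `s`; the variables of all other clients are kept. -/
noncomputable def round {n du dv : ℕ} {Ξ : Type*} (F : Vec du → Vec dv → Ξ → ℝ)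
    (m K : ℕ) (γu γv ηu ηv : ℝ) (s : Finset (Fin n)) (z : Fin n → ℕ → Ξ)
    (x : State n du dv) : State n du dv :=
  let w : Fin n → Vec du × Vec dv := fun i => localIter F γu γv x i (z i) K
  let cnew : Fin n → Vec du := fun i =>
    if i ∈ s then x.c i - x.cbar + (1 / ((K : ℝ) * γu)) • (x.u - (w i).1) else x.c i
  { u := (1 - ηu) • x.u + (ηu / (m : ℝ)) • ∑ i ∈ s, (w i).1
    v := fun i => if i ∈ s then (1 - ηv) • x.v i + ηv • (w i).2 else x.v i
    c := cnew
    cbar := x.cbar + (1 / (n : ℝ)) • ∑ i ∈ s, (cnew i - x.c i) }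

/-- The state of Scaffold-P at the beginning of round `t` (with the time index of `ξ` shifted by
one as above). -/
noncomputable def run {n du dv : ℕ} {Ξ Ω : Type*} (F : Vec du → Vec dv → Ξ → ℝ)
    (m K : ℕ) (γu γv ηu ηv : ℝ) (u₀ : Vec du) (v₀ : Fin n → Vec dv)
    (ξ : ℕ → Fin n → ℕ → Ω → Ξ) (S : ℕ → Ω → Finset (Fin n)) (ω : Ω) : ℕ → State n du dv
  | 0 => initState F K u₀ v₀ (fun i k => ξ 0 i k ω)
  | t + 1 => round F m K γu γv ηu ηv (S t ω) (fun i k => ξ (t + 1) i k ω)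
      (run F m K γu γv ηu ηv u₀ v₀ ξ S ω t)

/-- `‖∇_u f (u, v)‖²` at a state. -/
noncomputable def sqGradU {n du dv : ℕ} {Ξ : Type*} [MeasurableSpace Ξ]
    (F : Vec du → Vec dv → Ξ → ℝ) (D : Fin n → Measure Ξ) (x : State n du dv) : ℝ :=
  ‖gradient (fun u => loss F D u x.v) x.u‖ ^ 2

/-- `‖∇_v f_i (u, v_i)‖²` at a state. -/
noncomputable def sqGradV {n du dv : ℕ} {Ξ : Type*} [MeasurableSpace Ξ]
    (F : Vec du → Vec dv → Ξ → ℝ) (D : Fin n → Measure Ξ) (i : Fin n) (x : State n du dv) : ℝ :=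
  ‖gradV (clientLoss F D i) x.u (x.v i)‖ ^ 2

/-- `G_u = E ‖∇_u f (u, v)‖²` for a random state `X`. -/
noncomputable def expGradU {n du dv : ℕ} {Ξ Ω : Type*} [MeasurableSpace Ξ] [MeasurableSpace Ω]
    (F : Vec du → Vec dv → Ξ → ℝ) (D : Fin n → Measure Ξ) (P : Measure Ω)
    (X : Ω → State n du dv) : ℝ :=
  ∫ ω, sqGradU F D (X ω) ∂P

/-- `Ĝ_v = (m / n²) ∑ i, E ‖∇_v f_i (u, v_i)‖²` for a random state `X`. -/
noncomputable def expGradV {n du dv : ℕ} {Ξ Ω : Type*} [MeasurableSpace Ξ] [MeasurableSpace Ω]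
    (F : Vec du → Vec dv → Ξ → ℝ) (D : Fin n → Measure Ξ) (P : Measure Ω) (m : ℕ)
    (X : Ω → State n du dv) : ℝ :=
  ((m : ℝ) / (n : ℝ) ^ 2) * ∑ i, ∫ ω, sqGradV F D i (X ω) ∂P

end ScaffoldP

/-! Write `g = γK`, `θ = gL`, and let `G_i` be the mean of the stochastic `u`-gradients that client
`i` uses in a round. The server variable `c` is always the average of the `c_i`, and a participating
client replaces `c_i` by `G_i`. Hence a round moves `u` by `-g((1/m)∑_{i∈S}(G_i - c_i) + c)`: a SAGA
step whose gradients are spoiled by local drift. Let all clients, participating or not, run their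
local steps. Since `S` is independent of the samples, one can average over `S` with the samples
fixed (`subsetAvg`). The mean step is the average of all `G_i`, and the sampling of clients adds
only the variance `(1/m)·avg‖G_i - c_i‖²`. Gradients of different clients are never compared, so no
dissimilarity bound is needed.

The variable `c_i` is outdated. It is compared with `∇_u f_i(y_i, v_i)`, where the anchor `y_i` is
the value of `u` at the start of the last round in which client `i` took part; `v_i` has not moved
since that round. The control error is therefore at most `2(A + B)`, with `A = L²·avg E‖u - y_i‖²`
and `B = avg E‖∇_u f_i(y_i, v_i) - c_i‖²`. Both contract, at rates `m/(4n)` and `m/n`, up to forcing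
terms.

The gain over the known rate lies in the recursion for `A`. Its cross term pairs the vectors `u -
y_i`, which are determined by the past, with the update. Once this term has been given the same form
for all clients, averaging over `S` and over the noise leaves only the mean local gradient. Young's
inequality then costs `(n/m)θ²M`, where `M` is the mean square of that average, and the descent
inequality supplies `-M/2`. In the Lyapunov function `E f/g + 30θ(n/m²)A + 8θ(n/m²)b`, where `b` is
`B` without its stationary noise, this asks for small `θ³n²/m³`, that is `θ ≲ m/n^(2/3)`; every
other term is milder.

The estimates of one round need only second moments: Lipschitz bounds, variance bounds, and
orthogonality of each noise to the past and to the other noises. They are proved in abstract inner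
product spaces (`LocalModel`) and applied to square-integrable random vectors
(`RoundSetting.localModel`). `RoundSetting.exists_recursion` collects them, `sum_le_of_recursions`
sums them up, and `rate_of_descent` inserts the step size. -/

namespace ScaffoldP

/-! ### Second-order expansion of the client objectives. -/

section Smoothness

open scoped RealInnerProductSpace

/-- The descent lemma, in its two-sided form. -/
theorem abs_sub_sub_inner_gradient_le {E : Type*} [NormedAddCommGroup E] [InnerProductSpace ℝ E]
    [CompleteSpace E] {f : E → ℝ} (hd : Differentiable ℝ f) {L : ℝ≥0}
    (hL : LipschitzWith L (gradient f)) (x d : E) :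
    |f (x + d) - f x - ⟪gradient f x, d⟫| ≤ L / 2 * ‖d‖ ^ 2 := by
  have hφ : ∀ s : ℝ, HasDerivAt (fun s : ℝ => f (x + s • d) - f x - s * ⟪gradient f x, d⟫)
      (⟪gradient f (x + s • d), d⟫ - ⟪gradient f x, d⟫) s := by
    intro s
    have h1 : HasDerivAt (fun s : ℝ => x + s • d) d s := by
      simpa using ((hasDerivAt_id s).smul_const d).const_add x
    have h2 := ((hd (x + s • d)).hasGradientAt.hasFDerivAt).comp_hasDerivAt s h1
    have h3 := (h2.sub_const (f x)).sub ((hasDerivAt_id s).mul_const ⟪gradient f x, d⟫)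
    refine h3.congr_deriv ?_
    simp
  have hB : ∀ s : ℝ, HasDerivAt (fun s : ℝ => L / 2 * ‖d‖ ^ 2 * s ^ 2) (L * ‖d‖ ^ 2 * s) s := by
    intro s
    have h := ((hasDerivAt_id s).pow 2).const_mul (L / 2 * ‖d‖ ^ 2)
    refine h.congr_deriv ?_
    simp
    ring
  -- Both functions of `s` vanish at `0`; by Cauchy–Schwarz and the Lipschitz bound the derivative
  -- of the remainder is at most `L s ‖d‖²`, the derivative of the quadratic.
  have key := image_norm_le_of_norm_deriv_right_le_deriv_boundary (a := 0) (b := 1)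
    (f := fun s : ℝ => f (x + s • d) - f x - s * ⟪gradient f x, d⟫)
    (fun s _ => (hφ s).continuousAt.continuousWithinAt)
    (fun s _ => (hφ s).hasDerivWithinAt) (B := fun s : ℝ => L / 2 * ‖d‖ ^ 2 * s ^ 2)
    (by simp) hB (by
      intro s hs
      rw [← inner_sub_left, Real.norm_eq_abs]
      refine (abs_real_inner_le_norm _ _).trans ?_
      have h := hL.dist_le_mul (x + s • d) x
      rw [dist_eq_norm, dist_eq_norm, add_sub_cancel_left, norm_smul, Real.norm_eq_abs,
        abs_of_nonneg hs.1] at h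
      calc _ ≤ (L * (s * ‖d‖)) * ‖d‖ := by gcongr
        _ = _ := by ring)
  have h1 := key (show (1 : ℝ) ∈ Set.Icc 0 1 by simp)
  simpa using h1

variable {n du dv : ℕ} {f : Fin n → Vec du → Vec dv → ℝ} {Lu Luv Lv Lvu : ℝ≥0} {L : ℝ}

theorem norm_gradU_sub_le (hf : Smooth f Lu Luv Lv Lvu)
    (hL : L = (max (max Lu Lv) (max Luv Lvu) : ℝ≥0)) (i : Fin n) (u u' : Vec du) (v v' : Vec dv) :
    ‖gradU (f i) u v - gradU (f i) u' v'‖ ≤ L * (‖u - u'‖ + ‖v - v'‖) := by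
  have h1 := (hf.lipUU i v).dist_le_mul u u'
  have h2 := (hf.lipUV i u').dist_le_mul v v'
  simp only [dist_eq_norm] at h1 h2
  have hLu : (Lu : ℝ) ≤ L := by rw [hL]; exact_mod_cast (le_max_left _ _).trans (le_max_left _ _)
  have hLuv : (Luv : ℝ) ≤ L := by
    rw [hL]; exact_mod_cast (le_max_left _ _).trans (le_max_right _ _)
  calc _ = ‖(gradU (f i) u v - gradU (f i) u' v) + (gradU (f i) u' v - gradU (f i) u' v')‖ := by
        congr 1; abel
    _ ≤ Lu * ‖u - u'‖ + Luv * ‖v - v'‖ := (norm_add_le _ _).trans (add_le_add h1 h2)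
    _ ≤ L * ‖u - u'‖ + L * ‖v - v'‖ := by gcongr
    _ = _ := by ring

theorem norm_gradV_sub_le (hf : Smooth f Lu Luv Lv Lvu)
    (hL : L = (max (max Lu Lv) (max Luv Lvu) : ℝ≥0)) (i : Fin n) (u u' : Vec du) (v v' : Vec dv) :
    ‖gradV (f i) u v - gradV (f i) u' v'‖ ≤ L * (‖u - u'‖ + ‖v - v'‖) := by
  have h1 := (hf.lipVV i u').dist_le_mul v v'
  have h2 := (hf.lipVU i v).dist_le_mul u u'
  simp only [dist_eq_norm] at h1 h2
  have hLv : (Lv : ℝ) ≤ L := by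
    rw [hL]; exact_mod_cast (le_max_right _ _).trans (le_max_left _ _)
  have hLvu : (Lvu : ℝ) ≤ L := by
    rw [hL]; exact_mod_cast (le_max_right _ _).trans (le_max_right _ _)
  calc _ = ‖(gradV (f i) u v - gradV (f i) u' v) + (gradV (f i) u' v - gradV (f i) u' v')‖ := by
        congr 1; abel
    _ ≤ Lvu * ‖u - u'‖ + Lv * ‖v - v'‖ := (norm_add_le _ _).trans (add_le_add h2 h1)
    _ ≤ L * ‖u - u'‖ + L * ‖v - v'‖ := by gcongr
    _ = _ := by ring

/-- Joint continuity is what makes the gradients measurable when evaluated at random points. -/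
theorem continuous_of_norm_sub_le {E₁ E₂ E₃ : Type*} [SeminormedAddCommGroup E₁]
    [SeminormedAddCommGroup E₂] [SeminormedAddCommGroup E₃] {g : E₁ → E₂ → E₃} {L : ℝ}
    (hg : ∀ u u' v v', ‖g u v - g u' v'‖ ≤ L * (‖u - u'‖ + ‖v - v'‖)) :
    Continuous (fun p : E₁ × E₂ => g p.1 p.2) := by
  refine (LipschitzWith.of_dist_le_mul (K := (2 * |L|).toNNReal) fun p q => ?_).continuous
  rw [dist_eq_norm, Real.coe_toNNReal _ (by positivity), dist_eq_norm]
  calc _ ≤ L * (‖p.1 - q.1‖ + ‖p.2 - q.2‖) := hg _ _ _ _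
    _ ≤ |L| * (‖p - q‖ + ‖p - q‖) := by
        gcongr
        · exact le_abs_self L
        · exact norm_fst_le (p - q)
        · exact norm_snd_le (p - q)
    _ = _ := by ring

/-- Second-order expansion in both variables. -/
theorem abs_sub_inner_gradU_gradV_le (hf : Smooth f Lu Luv Lv Lvu)
    (hL : L = (max (max Lu Lv) (max Luv Lvu) : ℝ≥0)) (i : Fin n) (u a : Vec du) (v b : Vec dv) :
    |f i (u + a) (v + b) - f i u v - ⟪gradU (f i) u v, a⟫ - ⟪gradV (f i) u v, b⟫| ≤
      L * ‖a‖ ^ 2 + L * ‖b‖ ^ 2 := by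
  have h1 := abs_sub_sub_inner_gradient_le (hf.diffU i (v + b)) (hf.lipUU i (v + b)) u a
  have h2 := abs_sub_sub_inner_gradient_le (hf.diffV i u) (hf.lipVV i u) v b
  have h3 : |⟪gradU (f i) u (v + b) - gradU (f i) u v, a⟫| ≤ L * ‖b‖ * ‖a‖ := by
    refine (abs_real_inner_le_norm _ _).trans ?_
    have := norm_gradU_sub_le hf hL i u u (v + b) v
    simp only [sub_self, norm_zero, zero_add, add_sub_cancel_left] at this
    gcongr
  have hLu : (Lu : ℝ) ≤ L := by rw [hL]; exact_mod_cast (le_max_left _ _).trans (le_max_left _ _)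
  have hLv : (Lv : ℝ) ≤ L := by
    rw [hL]; exact_mod_cast (le_max_right _ _).trans (le_max_left _ _)
  have hL0 : 0 ≤ L := by rw [hL]; exact NNReal.coe_nonneg _
  have h4 : (Lu : ℝ) / 2 * ‖a‖ ^ 2 ≤ L / 2 * ‖a‖ ^ 2 := by gcongr
  have h5 : (Lv : ℝ) / 2 * ‖b‖ ^ 2 ≤ L / 2 * ‖b‖ ^ 2 := by gcongr
  rw [inner_sub_left] at h3
  have e : f i (u + a) (v + b) - f i u v - ⟪gradU (f i) u v, a⟫ - ⟪gradV (f i) u v, b⟫ =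
      (f i (u + a) (v + b) - f i u (v + b) - ⟪gradU (f i) u (v + b), a⟫) +
      (⟪gradU (f i) u (v + b), a⟫ - ⟪gradU (f i) u v, a⟫) +
      (f i u (v + b) - f i u v - ⟪gradV (f i) u v, b⟫) := by ring
  have h6 := abs_add_three (f i (u + a) (v + b) - f i u (v + b) - ⟪gradU (f i) u (v + b), a⟫)
    (⟪gradU (f i) u (v + b), a⟫ - ⟪gradU (f i) u v, a⟫)
    (f i u (v + b) - f i u v - ⟪gradV (f i) u v, b⟫)
  rw [e]
  change |f i (u + a) (v + b) - f i u (v + b) - ⟪gradU (f i) u (v + b), a⟫| ≤ _ at h1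
  change |f i u (v + b) - f i u v - ⟪gradV (f i) u v, b⟫| ≤ _ at h2
  -- The mixed term `L‖a‖‖b‖` is split evenly; with the halves from the two descent lemmas this
  -- gives the coefficient `L` on both squares.
  nlinarith [mul_nonneg hL0 (sq_nonneg (‖a‖ - ‖b‖))]

theorem hasGradientAt_gradU (hf : Smooth f Lu Luv Lv Lvu) (i : Fin n) (u : Vec du) (v : Vec dv) :
    HasGradientAt (fun x => f i x v) (gradU (f i) u v) u :=
  (hf.diffU i v u).hasGradientAt

theorem gradient_average {E : Type*} [NormedAddCommGroup E] [InnerProductSpace ℝ E]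
    [CompleteSpace E] {ι : Type*} (s : Finset ι) (c : ℝ) {h : ι → E → ℝ} {h' : ι → E} {x : E}
    (hh : ∀ i ∈ s, HasGradientAt (h i) (h' i) x) :
    gradient (fun y => c * ∑ i ∈ s, h i y) x = c • ∑ i ∈ s, h' i := by
  refine HasGradientAt.gradient ?_
  rw [hasGradientAt_iff_hasFDerivAt]
  have := (HasFDerivAt.fun_sum fun i hi => (hh i hi).hasFDerivAt).const_mul c
  simpa [map_sum] using this

end Smoothness

/-! ### The global objective. -/

section Loss

open scoped RealInnerProductSpace

variable {n du dv : ℕ} {Ξ : Type*} [MeasurableSpace Ξ] {F : Vec du → Vec dv → Ξ → ℝ}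
  {D : Fin n → Measure Ξ} {Lu Luv Lv Lvu : ℝ≥0} {L : ℝ}

theorem gradient_loss (hf : Smooth (clientLoss F D) Lu Luv Lv Lvu) (u : Vec du)
    (v : Fin n → Vec dv) :
    gradient (fun x => loss F D x v) u =
      (1 / (n : ℝ)) • ∑ i, gradU (clientLoss F D i) u (v i) :=
  gradient_average _ _ fun i _ => hasGradientAt_gradU hf i u (v i)

/-- Second-order upper bound for the global objective. -/
theorem loss_add_le (hn : 1 ≤ n) (hf : Smooth (clientLoss F D) Lu Luv Lv Lvu)
    (hL : L = (max (max Lu Lv) (max Luv Lvu) : ℝ≥0)) (u a : Vec du) (v b : Fin n → Vec dv) :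
    loss F D (u + a) (fun i => v i + b i) ≤ loss F D u v +
      ⟪gradient (fun x => loss F D x v) u, a⟫ +
      (1 / (n : ℝ)) * ∑ i, ⟪gradV (clientLoss F D i) u (v i), b i⟫ +
      L * ‖a‖ ^ 2 + L * ((1 / (n : ℝ)) * ∑ i, ‖b i‖ ^ 2) := by
  have hn' : (0 : ℝ) < n := by exact_mod_cast hn
  have h1 : ∀ i, clientLoss F D i (u + a) (v i + b i) ≤ clientLoss F D i u (v i) +
      ⟪gradU (clientLoss F D i) u (v i), a⟫ + ⟪gradV (clientLoss F D i) u (v i), b i⟫ +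
      L * ‖a‖ ^ 2 + L * ‖b i‖ ^ 2 := fun i => by
    have := (abs_le.1 (abs_sub_inner_gradU_gradV_le hf hL i u a (v i) (b i))).2
    linarith
  have h2 := Finset.sum_le_sum fun i (_ : i ∈ Finset.univ) => h1 i
  rw [gradient_loss hf, loss, loss, inner_smul_left, sum_inner]
  simp only [Finset.sum_add_distrib, Finset.sum_const, Finset.card_univ, Fintype.card_fin,
    nsmul_eq_mul, ← Finset.mul_sum] at h2
  have h3 := mul_le_mul_of_nonneg_left h2 (show (0 : ℝ) ≤ 1 / n by positivity)
  refine h3.trans (le_of_eq ?_)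
  simp only [conj_trivial]
  field_simp

/-- Without curvature, a smooth objective that is bounded below has vanishing gradients. -/
theorem gradients_eq_zero_of_lipschitz_zero (hn : 1 ≤ n)
    (hf : Smooth (clientLoss F D) Lu Luv Lv Lvu)
    (hL : (0 : ℝ) = (max (max Lu Lv) (max Luv Lvu) : ℝ≥0))
    (hbdd : BddBelow (Set.range fun p : Vec du × (Fin n → Vec dv) => loss F D p.1 p.2))
    (u : Vec du) (v : Fin n → Vec dv) :
    gradient (fun x => loss F D x v) u = 0 ∧ ∀ i, gradV (clientLoss F D i) u (v i) = 0 := by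
  obtain ⟨c, hc⟩ := hbdd
  have hc' : ∀ u v, c ≤ loss F D u v := fun u v => hc ⟨(u, v), rfl⟩
  have hn' : (0 : ℝ) < n := by exact_mod_cast hn
  -- Without a quadratic term, a step of any length `s` against a gradient lowers the loss by at
  -- least `s` times a multiple `g` of its squared norm. Boundedness below forces `g = 0`.
  have key : ∀ g : ℝ, 0 ≤ g → (∀ s : ℝ, 0 ≤ s → c ≤ loss F D u v - s * g) → g = 0 := by
    intro g hg h
    by_contra hne
    have hg' : 0 < g := lt_of_le_of_ne hg (Ne.symm hne)
    have h0 := h 0 le_rfl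
    have h1 := h ((loss F D u v - c + 1) / g) (by apply div_nonneg _ hg; linarith)
    rw [div_mul_cancel₀ _ hne] at h1
    linarith
  constructor
  · have := key (‖gradient (fun x => loss F D x v) u‖ ^ 2) (by positivity) fun s _ => by
      have h := loss_add_le hn hf hL u (-(s • gradient (fun x => loss F D x v) u)) v (fun _ => 0)
      simp only [inner_neg_right, inner_smul_right, real_inner_self_eq_norm_sq, inner_zero_right,
        Finset.sum_const_zero, mul_zero, zero_mul, add_zero] at h
      have := (hc' _ _).trans h
      linarith
    simpa using this
  · intro i
    have := key ((1 / (n : ℝ)) * ‖gradV (clientLoss F D i) u (v i)‖ ^ 2) (by positivity)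
      fun s _ => by
      have h := loss_add_le hn hf hL u 0 v
        (fun j => if j = i then -(s • gradV (clientLoss F D i) u (v i)) else 0)
      have e : ∑ j, ⟪gradV (clientLoss F D j) u (v j),
          if j = i then -(s • gradV (clientLoss F D i) u (v i)) else 0⟫ =
          - (s * ‖gradV (clientLoss F D i) u (v i)‖ ^ 2) := by
        rw [Finset.sum_eq_single i]
        · simp [inner_neg_right, inner_smul_right]
        · intro j _ hj; simp [hj]
        · simp
      rw [e] at h
      simp only [inner_zero_right, zero_mul, add_zero] at h
      have := (hc' _ _).trans h
      linarith
    have h0 : (1 / (n : ℝ)) ≠ 0 := by positivity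
    simpa [h0, hn'.ne'] using this

theorem ciInf_loss_le
    (hbdd : BddBelow (Set.range fun p : Vec du × (Fin n → Vec dv) => loss F D p.1 p.2))
    (u : Vec du) (v : Fin n → Vec dv) :
    ⨅ p : Vec du × (Fin n → Vec dv), loss F D p.1 p.2 ≤ loss F D u v :=
  ciInf_le hbdd (u, v)

end Loss

/-! ### Scalar recursions, Lyapunov function and step size. -/

/-- One step of the Lyapunov argument, in units in which the objective is divided by the effective
step size `g` and where `θ = g L`. -/
theorem lyapunov_step {m n θ φ φ' G M Q A A' b b' w z Δ e s : ℝ} (hm : 1 ≤ m) (hmn : m ≤ n)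
    (hθ : 0 ≤ θ) (hθ1 : θ ≤ 1 / 72) (hθ2 : θ ^ 2 * (n / m ^ 2) ≤ 1 / 5184)
    (hθ3 : θ ^ 3 * (n ^ 2 / m ^ 3) ≤ 1 / 373248)
    (hG : 0 ≤ G) (hM : 0 ≤ M) (hQ : 0 ≤ Q) (hA : 0 ≤ A) (hb : 0 ≤ b) (hs : 0 ≤ s)
    (hw : 0 ≤ w) (hz : 0 ≤ z) (hΔ : 0 ≤ Δ)
    (h1 : φ' ≤ φ - 1 / 2 * (G + M + Q) + 2 * Δ + θ * w + θ * z)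
    (h2 : z ≤ 2 * Q + 2 * s) (h3 : w ≤ 2 * M + 5 * s + 6 * Δ + 3 * e)
    (h4 : Δ ≤ θ ^ 2 * (3 * s + 5 * G + 5 * e)) (h5 : e ≤ 2 * ((A + b) / m) + 6 * s)
    (h6 : A' ≤ (1 - m / n / 4) * A + 3 * θ ^ 2 * w + 4 * (n / m) * θ ^ 2 * M)
    (h7 : b' = (1 - m / n) * b + 3 * θ ^ 2 * z + 6 * (m / n) * Δ) :
    φ' + 30 * (θ * (n / m ^ 2)) * A' + 8 * (θ * (n / m ^ 2)) * b' ≤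
      φ + 30 * (θ * (n / m ^ 2)) * A + 8 * (θ * (n / m ^ 2)) * b - G / 4 + 37 * (θ * s) := by
  have hm0 : 0 < m := by linarith
  have hn0 : 0 < n := by linarith
  set p := (A + b) / m with hp
  have hp0 : 0 ≤ p := by positivity
  -- These are the products of the Lyapunov weight `θ n/m²` with the coefficients `θ²` of `w`, `z`
  -- and `(n/m)θ²` of `M` in the recursions, up to the factor `θ` kept with `w` and `z`.
  set κ := θ ^ 2 * (n / m ^ 2) with hκ
  set τ := θ ^ 3 * (n ^ 2 / m ^ 3) with hτ
  have hκ0 : 0 ≤ κ := by positivity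
  have hτ0 : 0 ≤ τ := by positivity
  have hθs : 0 ≤ θ * s := by positivity
  have hθp : 0 ≤ θ * p := by positivity
  -- Inserting `e ≤ 2p + 6s`: `3s + 5e` becomes `33s + 10p` here, and `5s + 3e` becomes `23s + 6p`
  -- in `hw1`.
  have hΔ1 : Δ ≤ θ / 72 * (33 * s + 10 * p) + 5 / 5184 * G := by
    have e1 : θ ^ 2 * (3 * s + 5 * G + 5 * e) ≤ θ ^ 2 * (33 * s + 5 * G + 10 * p) := by
      gcongr ?_ * ?_
      linarith
    have e2 : θ ^ 2 ≤ θ / 72 := by nlinarith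
    have e3 : θ ^ 2 * (33 * s + 10 * p) ≤ θ / 72 * (33 * s + 10 * p) := by gcongr
    have e4 : θ ^ 2 * (5 * G) ≤ 1 / 5184 * (5 * G) := by
      gcongr
      nlinarith
    nlinarith
  have hw1 : θ * w ≤ θ * (2 * M + 23 * s + 6 * Δ + 6 * p) := by
    gcongr
    linarith
  have hθΔ : θ * Δ ≤ 1 / 72 * Δ := by gcongr
  have hθM : θ * M ≤ 1 / 72 * M := by gcongr
  have hθQ : θ * Q ≤ 1 / 72 * Q := by gcongr
  have hz1 : θ * z ≤ θ * (2 * Q + 2 * s) := by gcongr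
  have hκw : κ * (θ * w) ≤ 1 / 5184 * (θ * w) := by gcongr
  have hκz : κ * (θ * z) ≤ 1 / 5184 * (θ * z) := by gcongr
  have hτM : τ * M ≤ 1 / 373248 * M := by gcongr
  have hmΔ : θ * Δ / m ≤ θ * Δ := div_le_self (by positivity) hm
  -- The weight `θ n/m²` turns the contraction `m/(4n)` into a gain `θA/(4m)`, the form in which the
  -- control error enters `θ w`.
  have hA' : θ * (n / m ^ 2) * A' ≤
      θ * (n / m ^ 2) * A - θ * (A / m) / 4 + 3 * (κ * (θ * w)) + 4 * (τ * M) := by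
    have := mul_le_mul_of_nonneg_left h6 (show 0 ≤ θ * (n / m ^ 2) by positivity)
    refine this.trans (le_of_eq ?_)
    rw [hκ, hτ]
    field_simp
  have hb' : θ * (n / m ^ 2) * b' =
      θ * (n / m ^ 2) * b - θ * (b / m) + 3 * (κ * (θ * z)) + 6 * (θ * Δ / m) := by
    rw [h7, hκ]
    field_simp
  have hsplit : θ * p = θ * (A / m) + θ * (b / m) := by rw [hp]; ring
  have hAm : 0 ≤ θ * (A / m) := by positivity
  have hbm : 0 ≤ θ * (b / m) := by positivity
  have hκz' : 0 ≤ κ * (θ * z) := by positivity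
  -- The quantity `θ p` is produced about `6.1` times through `θ w` and less than half a time
  -- through `Δ`. The gains `30/4` on `θ(A/m)` and `8` on `θ(b/m)` exceed the sum.
  linarith

/-- The Lyapunov argument over `T` rounds. -/
theorem sum_le_of_recursions {m n θ s c : ℝ} {T : ℕ} {φ G M Q A B w z Δ e : ℕ → ℝ}
    (hm : 1 ≤ m) (hmn : m ≤ n)
    (hθ : 0 ≤ θ) (hθ1 : θ ≤ 1 / 72) (hθ2 : θ ^ 2 * (n / m ^ 2) ≤ 1 / 5184)
    (hθ3 : θ ^ 3 * (n ^ 2 / m ^ 3) ≤ 1 / 373248)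
    (hG : ∀ t, 0 ≤ G t) (hM : ∀ t < T, 0 ≤ M t) (hQ : ∀ t < T, 0 ≤ Q t) (hA : ∀ t, 0 ≤ A t)
    (hs : 0 ≤ s) (hw : ∀ t < T, 0 ≤ w t) (hz : ∀ t < T, 0 ≤ z t) (hΔ : ∀ t < T, 0 ≤ Δ t)
    (h1 : ∀ t < T, φ (t + 1) ≤
      φ t - 1 / 2 * (G t + M t + Q t) + 2 * Δ t + θ * w t + θ * z t)
    (h2 : ∀ t < T, z t ≤ 2 * Q t + 2 * s)
    (h3 : ∀ t < T, w t ≤ 2 * M t + 5 * s + 6 * Δ t + 3 * e t)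
    (h4 : ∀ t < T, Δ t ≤ θ ^ 2 * (3 * s + 5 * G t + 5 * e t))
    (h5 : ∀ t < T, e t ≤ 2 * ((A t + B t) / m))
    (h6 : ∀ t < T, A (t + 1) ≤
      (1 - m / n / 4) * A t + 3 * θ ^ 2 * w t + 4 * (n / m) * θ ^ 2 * M t)
    (h7 : ∀ t < T, B (t + 1) ≤ (1 - m / n) * B t + m / n * (3 * (m * s)) + 3 * θ ^ 2 * z t +
      6 * (m / n) * Δ t)
    (hA0 : A 0 = 0) (hB0 : B 0 ≤ 3 * (m * s)) (hc : c ≤ φ T) :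
    (∑ t ∈ Finset.range T, G t) / 4 ≤ φ 0 - c + 37 * (θ * s) * T := by
  have hm0 : 0 < m := by linarith
  have hn0 : 0 < n := by linarith
  have hρ : m / n ≤ 1 := (div_le_one hn0).2 hmn
  -- `b` is the part of `B` above its stationary noise level `3ms`, and it starts at `0`. With `B`
  -- itself in the Lyapunov function, the initial control error would leave a term of size
  -- `24θ(n/m)s`.
  let b : ℕ → ℝ := fun t => Nat.rec 0
    (fun t x => (1 - m / n) * x + 3 * θ ^ 2 * z t + 6 * (m / n) * Δ t) t
  have hb1 : ∀ t, b (t + 1) = (1 - m / n) * b t + 3 * θ ^ 2 * z t + 6 * (m / n) * Δ t :=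
    fun t => rfl
  have hb0 : ∀ t ≤ T, 0 ≤ b t := by
    intro t
    induction t with
    | zero => exact fun _ => le_rfl
    | succ t ih =>
      intro ht
      rw [hb1]
      have := hz t ht
      have := hΔ t ht
      have := mul_nonneg (sub_nonneg.2 hρ) (ih (by omega))
      positivity
  have hBb : ∀ t ≤ T, B t ≤ 3 * (m * s) + b t := by
    intro t
    induction t with
    | zero => intro _; simpa [b] using hB0
    | succ t ih =>
      intro ht
      have h := h7 t ht
      have := mul_le_mul_of_nonneg_left (ih (by omega)) (sub_nonneg.2 hρ)
      rw [hb1]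
      linarith
  have key : ∀ t ≤ T, φ t + 30 * (θ * (n / m ^ 2)) * A t + 8 * (θ * (n / m ^ 2)) * b t +
      (∑ j ∈ Finset.range t, G j) / 4 ≤ φ 0 + 37 * (θ * s) * t := by
    intro t
    induction t with
    | zero => intro _; simp [hA0, b]
    | succ t ih =>
      intro ht
      have h5' : e t ≤ 2 * ((A t + b t) / m) + 6 * s := by
        refine (h5 t ht).trans ?_
        have : (A t + B t) / m ≤ (A t + b t) / m + 3 * s := by
          rw [div_add' _ _ _ hm0.ne', div_le_div_iff_of_pos_right hm0]
          linarith [hBb t (by omega)]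
        linarith
      have hstep := lyapunov_step hm hmn hθ hθ1 hθ2 hθ3 (hG t) (hM t ht) (hQ t ht) (hA t)
        (hb0 t (by omega)) hs (hw t ht) (hz t ht) (hΔ t ht) (h1 t ht) (h2 t ht) (h3 t ht) (h4 t ht)
        h5' (h6 t ht) (hb1 t)
      have := ih (by omega)
      rw [Finset.sum_range_succ]
      push_cast
      linarith
  have hT := key T le_rfl
  have h8 : 0 ≤ 30 * (θ * (n / m ^ 2)) * A T := by have := hA T; positivity
  have h9 : 0 ≤ 8 * (θ * (n / m ^ 2)) * b T := by have := hb0 T le_rfl; positivity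
  linarith

/-- The second entry of the maximum compares by `m^(2/3) ≤ m`. -/
theorem max_one_rpow_div_le {m n : ℕ} (hm : 1 ≤ m) (hmn : m ≤ n) :
    max 1 ((n : ℝ) ^ (2 / 3 : ℝ) / m) ≤ ((n : ℝ) / m) ^ (2 / 3 : ℝ) := by
  have hm' : (1 : ℝ) ≤ m := by exact_mod_cast hm
  have hmn' : (m : ℝ) ≤ n := by exact_mod_cast hmn
  have hm0 : (0 : ℝ) < m := by linarith
  refine max_le (Real.one_le_rpow ((one_le_div hm0).2 hmn') (by norm_num)) ?_
  rw [Real.div_rpow (by positivity) hm0.le]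
  gcongr
  simpa using Real.rpow_le_rpow_of_exponent_le hm' (show (2 / 3 : ℝ) ≤ 1 by norm_num)

theorem max_one_rpow_div_lt {m n : ℕ} (hm : 1 < m) (hmn : m < n) :
    max 1 ((n : ℝ) ^ (2 / 3 : ℝ) / m) < ((n : ℝ) / m) ^ (2 / 3 : ℝ) := by
  have hm' : (1 : ℝ) < m := by exact_mod_cast hm
  have hmn' : (m : ℝ) < n := by exact_mod_cast hmn
  have hm0 : (0 : ℝ) < m := by linarith
  refine max_lt (Real.one_lt_rpow ((one_lt_div hm0).2 hmn') (by norm_num)) ?_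
  rw [Real.div_rpow (by positivity) hm0.le]
  have hn0 : (0 : ℝ) < n := by linarith
  gcongr
  simpa using Real.rpow_lt_rpow_of_exponent_lt hm' (show (2 / 3 : ℝ) < 1 by norm_num)

/-- The consequences of `θ ≤ 1 / (72 max (n ^ (2/3) / m, 1))` used in the Lyapunov argument. -/
theorem step_size_bounds {m n θ : ℝ} (hm : 1 ≤ m) (hmn : m ≤ n) (hθ : 0 ≤ θ)
    (h : 72 * max (n ^ (2 / 3 : ℝ) / m) 1 * θ ≤ 1) :
    θ ≤ 1 / 72 ∧ θ ^ 2 * (n / m ^ 2) ≤ 1 / 5184 ∧ θ ^ 3 * (n ^ 2 / m ^ 3) ≤ 1 / 373248 := by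
  have hm0 : 0 < m := by linarith
  have hn0 : 0 < n := by linarith
  set N := max (n ^ (2 / 3 : ℝ) / m) 1
  have h1 : 1 ≤ N := le_max_right _ _
  have h2 : n ^ (2 / 3 : ℝ) / m ≤ N := le_max_left _ _
  have hx : 0 ≤ n ^ (2 / 3 : ℝ) / m := by positivity
  have e1 : θ * N ≤ 1 / 72 := by linarith
  -- The cubic condition is exactly the one that the maximum encodes; the quadratic one is weaker
  -- because `n ≤ n^(4/3)`.
  have e3 : (n ^ (2 / 3 : ℝ) / m) ^ 3 = n ^ 2 / m ^ 3 := by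
    rw [div_pow, ← Real.rpow_natCast (n ^ (2 / 3 : ℝ)), ← Real.rpow_mul hn0.le]
    norm_num
  have e2 : n / m ^ 2 ≤ (n ^ (2 / 3 : ℝ) / m) ^ 2 := by
    rw [div_pow, ← Real.rpow_natCast (n ^ (2 / 3 : ℝ)), ← Real.rpow_mul hn0.le]
    gcongr
    simpa using Real.rpow_le_rpow_of_exponent_le (hm.trans hmn)
      (show (1 : ℝ) ≤ 2 / 3 * (2 : ℕ) by norm_num)
  refine ⟨by nlinarith, ?_, ?_⟩
  · calc θ ^ 2 * (n / m ^ 2) ≤ θ ^ 2 * N ^ 2 := by gcongr; exact e2.trans (by gcongr)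
      _ = (θ * N) ^ 2 := by ring
      _ ≤ (1 / 72) ^ 2 := by gcongr
      _ = _ := by norm_num
  · calc θ ^ 3 * (n ^ 2 / m ^ 3) ≤ θ ^ 3 * N ^ 3 := by rw [← e3]; gcongr
      _ = (θ * N) ^ 3 := by ring
      _ ≤ (1 / 72) ^ 3 := by gcongr
      _ = _ := by norm_num

/-- From the summed descent to the rate, with the step size of the theorem. -/
theorem rate_of_descent {L K T F₀ N W Γ γ : ℝ} (hL : 0 < L) (hK : 0 < K) (hT : 0 < T)
    (hF : 0 < F₀) (hN : 0 < N) (hW : 0 ≤ W)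
    (hγ : γ = (72 * L * K * N + √(37 * L * K * T / F₀ * W))⁻¹)
    (h : γ * K * Γ / 4 ≤ F₀ + 37 * (L * (γ * K) ^ 2 * (W / K)) * T) :
    1 / T * Γ ≤ 8 * √(37 * L * F₀ / (K * T) * W) + 288 * L * F₀ / T * N := by
  set R := √(37 * L * K * T / F₀ * W) with hR
  have hR0 : 0 ≤ R := Real.sqrt_nonneg _
  have hden : 0 < 72 * L * K * N + R := by positivity
  have hγ0 : 0 < γ := by rw [hγ]; positivity
  have hγ1 : γ * (72 * L * K * N + R) = 1 := by rw [hγ]; exact inv_mul_cancel₀ hden.ne'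
  have hR2 : R ^ 2 = 37 * L * K * T / F₀ * W := Real.sq_sqrt (by positivity)
  have hroot : √(37 * L * F₀ / (K * T) * W) = F₀ / (K * T) * R := by
    rw [hR, ← Real.sqrt_sq (show 0 ≤ F₀ / (K * T) by positivity), ← Real.sqrt_mul (by positivity)]
    congr 1
    field_simp
  rw [hroot]
  have hγR : γ * R ≤ 1 := by
    have : 0 ≤ γ * (72 * L * K * N) := by positivity
    linarith
  -- The root `R` in `γ` is chosen so that the accumulated noise is `F₀(γR)²`, which `γR ≤ 1`
  -- reduces to `F₀γR`. Division by `γ` then leaves `4F₀(72LKN + 2R)`, whence the constants `288`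
  -- and `8`.
  have hnoise : 37 * (L * (γ * K) ^ 2 * (W / K)) * T = F₀ * (γ * R) ^ 2 := by
    rw [mul_pow γ R, hR2]
    field_simp
  rw [hnoise] at h
  have h2 : F₀ * (γ * R) ^ 2 ≤ F₀ * (γ * R) := by
    have : 0 ≤ γ * R := by positivity
    gcongr
    nlinarith
  have h3 : γ * (K * Γ) ≤ γ * (4 * F₀ * (72 * L * K * N + R + R)) := by
    have : γ * (4 * F₀ * (72 * L * K * N + R + R)) =
      4 * F₀ * (γ * (72 * L * K * N + R)) + 4 * F₀ * (γ * R) := by ring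
    rw [this, hγ1]
    linarith
  have h4 := le_of_mul_le_mul_left h3 hγ0
  have h5 : 1 / T * Γ = K * Γ / (K * T) := by field_simp
  have h6 : 8 * (F₀ / (K * T) * R) + 288 * L * F₀ / T * N =
      4 * F₀ * (72 * L * K * N + R + R) / (K * T) := by
    field_simp
    ring
  rw [h5, h6]
  gcongr

/-! ### Averages over uniformly drawn sets of clients. -/

section SubsetAverage

open Finset

variable {n m : ℕ}

/-- The average of `ψ` over the sets of `m` clients. -/
noncomputable def subsetAvg (n m : ℕ) (ψ : Finset (Fin n) → ℝ) : ℝ :=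
  ((n.choose m : ℕ) : ℝ)⁻¹ * ∑ s ∈ powersetCard m univ, ψ s

theorem subsetAvg_add (ψ χ : Finset (Fin n) → ℝ) :
    subsetAvg n m (fun s => ψ s + χ s) = subsetAvg n m ψ + subsetAvg n m χ := by
  simp only [subsetAvg, sum_add_distrib, mul_add]

theorem subsetAvg_const_mul (c : ℝ) (ψ : Finset (Fin n) → ℝ) :
    subsetAvg n m (fun s => c * ψ s) = c * subsetAvg n m ψ := by
  simp only [subsetAvg, ← mul_sum]
  ring

theorem subsetAvg_sum {ι : Type*} (J : Finset ι) (ψ : ι → Finset (Fin n) → ℝ) :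
    subsetAvg n m (fun s => ∑ i ∈ J, ψ i s) = ∑ i ∈ J, subsetAvg n m (ψ i) := by
  simp only [subsetAvg, ← mul_sum]
  rw [sum_comm]

theorem subsetAvg_const (hmn : m ≤ n) (c : ℝ) : subsetAvg n m (fun _ => c) = c := by
  have : ((n.choose m : ℕ) : ℝ) ≠ 0 := by exact_mod_cast (Nat.choose_pos hmn).ne'
  simp [subsetAvg, this]

theorem subsetAvg_mono {ψ χ : Finset (Fin n) → ℝ} (h : ∀ s, s.card = m → ψ s ≤ χ s) :
    subsetAvg n m ψ ≤ subsetAvg n m χ := by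
  unfold subsetAvg
  gcongr with s hs
  exact h s (mem_powersetCard.1 hs).2

theorem subsetAvg_congr {ψ χ : Finset (Fin n) → ℝ} (h : ∀ s, s.card = m → ψ s = χ s) :
    subsetAvg n m ψ = subsetAvg n m χ :=
  le_antisymm (subsetAvg_mono fun s hs => (h s hs).le) (subsetAvg_mono fun s hs => (h s hs).ge)

theorem subsetAvg_subset (s₀ : Finset (Fin n)) (h : s₀.card ≤ m) :
    subsetAvg n m (fun s => if s₀ ⊆ s then 1 else 0) =
      ((n - s₀.card).choose (m - s₀.card) : ℕ) / (n.choose m : ℕ) := by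
  rw [subsetAvg, sum_boole, card_filter_powersetCard_subset _ _ _ (subset_univ _) h]
  simp
  ring

theorem subsetAvg_mem (hm : 1 ≤ m) (hmn : m ≤ n) (i : Fin n) :
    subsetAvg n m (fun s => if i ∈ s then 1 else 0) = (m : ℝ) / n := by
  have h := subsetAvg_subset (n := n) (m := m) {i} (by simpa using hm)
  simp only [singleton_subset_iff, card_singleton] at h
  rw [h]
  obtain ⟨m, rfl⟩ : ∃ k, m = k + 1 := ⟨m - 1, by omega⟩
  obtain ⟨n, rfl⟩ : ∃ k, n = k + 1 := ⟨n - 1, by omega⟩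
  have hc : 0 < (n + 1).choose (m + 1) := Nat.choose_pos hmn
  rw [div_eq_div_iff (by exact_mod_cast hc.ne') (by positivity)]
  have := Nat.add_one_mul_choose_eq n m
  simp only [Nat.add_sub_cancel]
  exact_mod_cast (by linarith : n.choose m * (n + 1) = (m + 1) * (n + 1).choose (m + 1))

theorem subsetAvg_mem_mem (hm : 1 ≤ m) (hmn : m ≤ n) {i j : Fin n} (hij : i ≠ j) :
    subsetAvg n m (fun s => if i ∈ s ∧ j ∈ s then 1 else 0) =
      (m : ℝ) * (m - 1) / (n * (n - 1)) := by
  -- A single drawn client never forms a pair; the binomial identities below need `2 ≤ m`.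
  rcases hm.eq_or_lt with rfl | hm2
  · have : subsetAvg n 1 (fun s => if i ∈ s ∧ j ∈ s then 1 else 0) = subsetAvg n 1 fun _ => 0 := by
      refine subsetAvg_congr fun s hs => if_neg ?_
      obtain ⟨a, rfl⟩ := card_eq_one.1 hs
      simp only [mem_singleton]
      rintro ⟨rfl, rfl⟩
      exact hij rfl
    rw [this, subsetAvg_const hmn]
    simp
  have h := subsetAvg_subset (n := n) (m := m) {i, j} (by rw [card_pair hij]; omega)
  simp only [card_pair hij, insert_subset_iff, singleton_subset_iff] at h
  rw [h]
  obtain ⟨m, rfl⟩ : ∃ k, m = k + 2 := ⟨m - 2, by omega⟩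
  obtain ⟨n, rfl⟩ : ∃ k, n = k + 2 := ⟨n - 2, by omega⟩
  have hc : 0 < (n + 2).choose (m + 2) := Nat.choose_pos hmn
  have e1 := Nat.add_one_mul_choose_eq (n + 1) (m + 1)
  have e2 := Nat.add_one_mul_choose_eq n m
  have e1' : ((n : ℝ) + 2) * (n + 1).choose (m + 1) = (n + 2).choose (m + 2) * (m + 2) := by
    exact_mod_cast e1
  have e2' : ((n : ℝ) + 1) * n.choose m = (n + 1).choose (m + 1) * (m + 1) := by exact_mod_cast e2
  have hn1 : (0 : ℝ) < (n : ℝ) + 1 := by positivity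
  simp only [Nat.add_sub_cancel]
  push_cast
  rw [div_eq_div_iff (by exact_mod_cast hc.ne')
    (by rw [show (n : ℝ) + 2 - 1 = n + 1 by ring]; positivity)]
  linear_combination (n + 2 : ℝ) * e2' + (m + 1 : ℝ) * e1'

theorem subsetAvg_sum_mem (hm : 1 ≤ m) (hmn : m ≤ n) (a : Fin n → ℝ) :
    subsetAvg n m (fun s => ∑ i ∈ s, a i) = (m : ℝ) / n * ∑ i, a i := by
  have h : ∀ s : Finset (Fin n), ∑ i ∈ s, a i = ∑ i, a i * (if i ∈ s then 1 else 0) := by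
    intro s; simp
  rw [funext h]
  simp only [subsetAvg_sum, subsetAvg_const_mul, subsetAvg_mem hm hmn, mul_sum]
  exact sum_congr rfl fun i _ => mul_comm _ _

theorem subsetAvg_sum_ite (hm : 1 ≤ m) (hmn : m ≤ n) (a b : Fin n → ℝ) :
    subsetAvg n m (fun s => ∑ i, if i ∈ s then a i else b i) =
      (m : ℝ) / n * ∑ i, a i + (1 - (m : ℝ) / n) * ∑ i, b i := by
  have h : ∀ s : Finset (Fin n), ∑ i, (if i ∈ s then a i else b i) =
      ∑ i ∈ s, (a i - b i) + ∑ i, b i := by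
    intro s
    rw [← Finset.sum_ite_mem_eq s (fun i => a i - b i), ← sum_add_distrib]
    refine sum_congr rfl fun i _ => ?_
    split_ifs <;> ring
  rw [funext h, subsetAvg_add, subsetAvg_sum_mem hm hmn, subsetAvg_const hmn, sum_sub_distrib]
  ring

open scoped RealInnerProductSpace

theorem subsetAvg_inner_sum {E : Type*} [SeminormedAddCommGroup E] [InnerProductSpace ℝ E]
    (hm : 1 ≤ m) (hmn : m ≤ n) (x : E) (r : Fin n → E) :
    subsetAvg n m (fun s => ⟪x, ∑ i ∈ s, r i⟫) = (m : ℝ) / n * ⟪x, ∑ i, r i⟫ := by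
  simp only [inner_sum]
  exact subsetAvg_sum_mem hm hmn _

/-- The square is expanded over pairs. Drawing without replacement makes distinct clients negatively
correlated: a pair is drawn with probability at most `(m/n)²`, so only the diagonal contributes
extra variance. -/
theorem subsetAvg_norm_sq_sum_le {E : Type*} [SeminormedAddCommGroup E] [InnerProductSpace ℝ E]
    (hm : 1 ≤ m) (hmn : m ≤ n) (r : Fin n → E) :
    subsetAvg n m (fun s => ‖∑ i ∈ s, r i‖ ^ 2) ≤
      ((m : ℝ) / n) ^ 2 * ‖∑ i, r i‖ ^ 2 + (m : ℝ) / n * ∑ i, ‖r i‖ ^ 2 := by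
  have hm' : (1 : ℝ) ≤ m := by exact_mod_cast hm
  have hmn' : (m : ℝ) ≤ n := by exact_mod_cast hmn
  have hn0 : (0 : ℝ) < n := by linarith
  have h : ∀ s : Finset (Fin n), ‖∑ i ∈ s, r i‖ ^ 2 =
      ∑ i, ∑ j, ⟪r i, r j⟫ * (if i ∈ s ∧ j ∈ s then 1 else 0) := by
    intro s
    rw [← real_inner_self_eq_norm_sq, sum_inner]
    simp only [inner_sum, mul_ite, mul_one, mul_zero]
    rw [← sum_ite_mem_eq s]
    refine sum_congr rfl fun i _ => ?_
    by_cases hi : i ∈ s <;> simp [hi]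
  have hpair : ∀ i j, subsetAvg n m (fun s => if i ∈ s ∧ j ∈ s then 1 else 0) =
      (m : ℝ) * (m - 1) / (n * (n - 1)) +
        ((m : ℝ) / n - (m : ℝ) * (m - 1) / (n * (n - 1))) * (if i = j then 1 else 0) := by
    intro i j
    by_cases hij : i = j
    · subst hij
      simp [subsetAvg_mem hm hmn]
    · simp [hij, subsetAvg_mem_mem hm hmn hij]
  have htot : ‖∑ i, r i‖ ^ 2 = ∑ i, ∑ j, ⟪r i, r j⟫ := by
    rw [← real_inner_self_eq_norm_sq, sum_inner]
    simp only [inner_sum]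
  have hval : subsetAvg n m (fun s => ‖∑ i ∈ s, r i‖ ^ 2) =
      (m : ℝ) * (m - 1) / (n * (n - 1)) * ‖∑ i, r i‖ ^ 2 +
        ((m : ℝ) / n - (m : ℝ) * (m - 1) / (n * (n - 1))) * ∑ i, ‖r i‖ ^ 2 := by
    rw [funext h, htot]
    simp only [subsetAvg_sum, subsetAvg_const_mul, hpair, mul_add, sum_add_distrib]
    congr 1
    · rw [mul_sum]
      refine sum_congr rfl fun i _ => ?_
      rw [mul_sum]
      exact sum_congr rfl fun j _ => mul_comm _ _
    · rw [mul_sum]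
      refine sum_congr rfl fun i _ => ?_
      rw [sum_eq_single i]
      · simp [mul_comm]
      · intro j _ hj; simp [hj.symm]
      · simp
  rw [hval]
  have hn1 : (0 : ℝ) ≤ n - 1 := by linarith
  -- This amounts to `m ≤ n`; for `n = 1` the quotient on the left is `0` by the convention for
  -- division.
  have h1 : (m : ℝ) * (m - 1) / (n * (n - 1)) ≤ ((m : ℝ) / n) ^ 2 := by
    rcases hn1.eq_or_lt with h0 | h0
    · rw [← h0, mul_zero, div_zero]; positivity
    · rw [div_pow, div_le_div_iff₀ (by positivity) (by positivity)]
      nlinarith [mul_nonneg (mul_nonneg (sub_nonneg.2 hmn') hn0.le) (by positivity : (0 : ℝ) ≤ m)]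
  have h2 : 0 ≤ (m : ℝ) * (m - 1) / (n * (n - 1)) :=
    div_nonneg (mul_nonneg (by linarith) (by linarith)) (mul_nonneg hn0.le hn1)
  have h3 : 0 ≤ ∑ i, ‖r i‖ ^ 2 := sum_nonneg fun i _ => by positivity
  nlinarith [mul_le_mul_of_nonneg_right h1 (sq_nonneg ‖∑ i, r i‖), mul_nonneg h2 h3]

/-- The second moment of the averaged update `(1/m) ∑_{i ∈ s} r_i + c` of the server. -/
theorem subsetAvg_norm_sq_update_le {E : Type*} [SeminormedAddCommGroup E]
    [InnerProductSpace ℝ E] (hm : 1 ≤ m) (hmn : m ≤ n) (r : Fin n → E) (c : E) :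
    subsetAvg n m (fun s => ‖(1 / (m : ℝ)) • ∑ i ∈ s, r i + c‖ ^ 2) ≤
      ‖(1 / (n : ℝ)) • ∑ i, r i + c‖ ^ 2 + 1 / (m * n : ℝ) * ∑ i, ‖r i‖ ^ 2 := by
  have hm0 : (0 : ℝ) < m := by exact_mod_cast hm
  have hn0 : (0 : ℝ) < n := by exact_mod_cast hm.trans hmn
  have h : ∀ s : Finset (Fin n), ‖(1 / (m : ℝ)) • ∑ i ∈ s, r i + c‖ ^ 2 =
      (1 / m : ℝ) ^ 2 * ‖∑ i ∈ s, r i‖ ^ 2 + (2 / m : ℝ) * ⟪c, ∑ i ∈ s, r i⟫ + ‖c‖ ^ 2 := by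
    intro s
    rw [norm_add_sq_real, norm_smul, Real.norm_eq_abs, mul_pow, sq_abs, real_inner_smul_left,
      real_inner_comm]
    ring
  have h' : ‖(1 / (n : ℝ)) • ∑ i, r i + c‖ ^ 2 =
      (1 / n : ℝ) ^ 2 * ‖∑ i, r i‖ ^ 2 + (2 / n : ℝ) * ⟪c, ∑ i, r i⟫ + ‖c‖ ^ 2 := by
    rw [norm_add_sq_real, norm_smul, Real.norm_eq_abs, mul_pow, sq_abs, real_inner_smul_left,
      real_inner_comm]
    ring
  simp only [h, h', subsetAvg_add, subsetAvg_const_mul, subsetAvg_const hmn,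
    subsetAvg_inner_sum hm hmn]
  have := mul_le_mul_of_nonneg_left (subsetAvg_norm_sq_sum_le hm hmn r)
    (show (0 : ℝ) ≤ (1 / m) ^ 2 by positivity)
  have e1 : (1 / m : ℝ) ^ 2 * (((m : ℝ) / n) ^ 2 * ‖∑ i, r i‖ ^ 2 + (m : ℝ) / n * ∑ i, ‖r i‖ ^ 2) =
      (1 / n : ℝ) ^ 2 * ‖∑ i, r i‖ ^ 2 + 1 / (m * n : ℝ) * ∑ i, ‖r i‖ ^ 2 := by
    field_simp
  have e2 : (2 / m : ℝ) * ((m : ℝ) / n * ⟪c, ∑ i, r i⟫) = (2 / n : ℝ) * ⟪c, ∑ i, r i⟫ := by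
    field_simp
  linarith

end SubsetAverage

/-! ### One round with fixed samples, averaged over the clients. -/

section Round

open scoped RealInnerProductSpace

variable {n du dv : ℕ} {Ξ : Type*} {F : Vec du → Vec dv → Ξ → ℝ} {m K : ℕ} {γu γv ηu ηv : ℝ}

/-- The average over the local steps of the stochastic gradients `∇_u F` used by client `i`. -/
noncomputable def stochMeanU (F : Vec du → Vec dv → Ξ → ℝ) (K : ℕ) (γu γv : ℝ) (x : State n du dv)
    (i : Fin n) (z : ℕ → Ξ) : Vec du :=
  (1 / (K : ℝ)) • ∑ k ∈ Finset.range K, stochGradU F (localIter F γu γv x i z k).1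
    (localIter F γu γv x i z k).2 (z k)

/-- The average over the local steps of the stochastic gradients `∇_v F` used by client `i`. -/
noncomputable def stochMeanV (F : Vec du → Vec dv → Ξ → ℝ) (K : ℕ) (γu γv : ℝ) (x : State n du dv)
    (i : Fin n) (z : ℕ → Ξ) : Vec dv :=
  (1 / (K : ℝ)) • ∑ k ∈ Finset.range K, stochGradV F (localIter F γu γv x i z k).1
    (localIter F γu γv x i z k).2 (z k)

theorem localIter_fst (x : State n du dv) (i : Fin n) (z : ℕ → Ξ) (k : ℕ) :
    (localIter F γu γv x i z k).1 = x.u - γu • ∑ j ∈ Finset.range k,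
      (stochGradU F (localIter F γu γv x i z j).1 (localIter F γu γv x i z j).2 (z j) -
        x.c i + x.cbar) := by
  induction k with
  | zero => simp [localIter]
  | succ k ih =>
    rw [Finset.sum_range_succ, smul_add, ← sub_sub, ← ih]
    rfl

theorem localIter_snd (x : State n du dv) (i : Fin n) (z : ℕ → Ξ) (k : ℕ) :
    (localIter F γu γv x i z k).2 = x.v i - γv • ∑ j ∈ Finset.range k,
      stochGradV F (localIter F γu γv x i z j).1 (localIter F γu γv x i z j).2 (z j) := by
  induction k with
  | zero => simp [localIter]
  | succ k ih =>
    rw [Finset.sum_range_succ, smul_add, ← sub_sub, ← ih]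
    rfl

theorem localIter_fst_last (hK : 1 ≤ K) (x : State n du dv) (i : Fin n) (z : ℕ → Ξ) :
    (localIter F γu γv x i z K).1 =
      x.u - (γu * K) • (stochMeanU F K γu γv x i z - x.c i + x.cbar) := by
  have hK0 : (K : ℝ) ≠ 0 := by positivity
  rw [localIter_fst, stochMeanU, mul_smul, Finset.sum_add_distrib, Finset.sum_sub_distrib]
  congr 2
  rw [smul_add, smul_sub, smul_smul, mul_one_div_cancel hK0, one_smul]
  simp [Nat.cast_smul_eq_nsmul]

theorem localIter_snd_last (hK : 1 ≤ K) (x : State n du dv) (i : Fin n) (z : ℕ → Ξ) :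
    (localIter F γu γv x i z K).2 = x.v i - (γv * K) • stochMeanV F K γu γv x i z := by
  have hK0 : (K : ℝ) ≠ 0 := by positivity
  rw [localIter_snd, stochMeanV, mul_smul, smul_smul (K : ℝ), mul_one_div_cancel hK0, one_smul]

/-- The SAGA form of the server step. Only the product `γu ηu` appears, so the local step size can
be small while the effective one stays `γK`. -/
theorem round_u (hK : 1 ≤ K) (hm : 1 ≤ m) {s : Finset (Fin n)} (hs : s.card = m)
    (z : Fin n → ℕ → Ξ) (x : State n du dv) :
    (round F m K γu γv ηu ηv s z x).u = x.u + (-(γu * ηu * K)) •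
      ((1 / (m : ℝ)) • ∑ i ∈ s, (stochMeanU F K γu γv x i (z i) - x.c i) + x.cbar) := by
  have hm0 : (m : ℝ) ≠ 0 := by positivity
  simp only [round, localIter_fst_last hK, Finset.sum_sub_distrib, Finset.sum_const, hs,
    ← Finset.smul_sum, Finset.sum_add_distrib, ← Nat.cast_smul_eq_nsmul ℝ]
  match_scalars <;> field_simp <;> ring

theorem round_v (hK : 1 ≤ K) (s : Finset (Fin n)) (z : Fin n → ℕ → Ξ) (x : State n du dv) :
    (round F m K γu γv ηu ηv s z x).v = fun i => x.v i +
      if i ∈ s then (-(γv * ηv * K)) • stochMeanV F K γu γv x i (z i) else 0 := by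
  funext i
  simp only [round, localIter_snd_last hK]
  split_ifs
  · module
  · simp

/-- The correction terms cancel in the update of `c_i`, leaving the mean of the gradients just used.
-/
theorem round_c (hK : 1 ≤ K) (hγu : γu ≠ 0) (s : Finset (Fin n)) (z : Fin n → ℕ → Ξ)
    (x : State n du dv) :
    (round F m K γu γv ηu ηv s z x).c = fun i =>
      if i ∈ s then stochMeanU F K γu γv x i (z i) else x.c i := by
  have hK0 : (K : ℝ) ≠ 0 := by positivity
  funext i
  simp only [round, localIter_fst_last hK]
  split_ifs
  · rw [sub_sub_cancel, smul_smul, mul_comm γu, one_div_mul_cancel (mul_ne_zero hK0 hγu)]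
    module
  · rfl

theorem round_cbar (s : Finset (Fin n)) (z : Fin n → ℕ → Ξ) (x : State n du dv)
    (hx : x.cbar = (1 / (n : ℝ)) • ∑ i, x.c i) :
    (round F m K γu γv ηu ηv s z x).cbar =
      (1 / (n : ℝ)) • ∑ i, (round F m K γu γv ηu ηv s z x).c i := by
  have h : ∑ i, ((round F m K γu γv ηu ηv s z x).c i - x.c i) =
      ∑ i ∈ s, ((round F m K γu γv ηu ηv s z x).c i - x.c i) := by
    refine (Finset.sum_subset (Finset.subset_univ s) fun i _ hi => ?_).symm
    simp [round, hi]
  have h2 : (round F m K γu γv ηu ηv s z x).cbar = x.cbar + (1 / (n : ℝ)) •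
    ∑ i ∈ s, ((round F m K γu γv ηu ηv s z x).c i - x.c i) := rfl
  rw [h2, hx, ← h, Finset.sum_sub_distrib, smul_sub]
  abel

theorem run_cbar {Ω : Type*} (u₀ : Vec du) (v₀ : Fin n → Vec dv)
    (ξ : ℕ → Fin n → ℕ → Ω → Ξ) (S : ℕ → Ω → Finset (Fin n)) (ω : Ω) (t : ℕ) :
    (run F m K γu γv ηu ηv u₀ v₀ ξ S ω t).cbar =
      (1 / (n : ℝ)) • ∑ i, (run F m K γu γv ηu ηv u₀ v₀ ξ S ω t).c i := by
  induction t with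
  | zero => rfl
  | succ t ih => exact round_cbar _ _ _ ih

/-- The bound for the mean square of the server update, up to the step size. -/
noncomputable def updateSq (F : Vec du → Vec dv → Ξ → ℝ) (m K : ℕ) (γu γv : ℝ)
    (x : State n du dv) (z : Fin n → ℕ → Ξ) : ℝ :=
  ‖(1 / (n : ℝ)) • ∑ i, stochMeanU F K γu γv x i (z i)‖ ^ 2 +
    1 / (m * n : ℝ) * ∑ i, ‖stochMeanU F K γu γv x i (z i) - x.c i‖ ^ 2

variable {γ : ℝ}

/-- This is why the control variables introduce no bias: on average over the clients they drop out
of the server step. -/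
theorem average_sub_add_cbar (x : State n du dv) (hx : x.cbar = (1 / (n : ℝ)) • ∑ i, x.c i)
    (r : Fin n → Vec du) :
    (1 / (n : ℝ)) • ∑ i, (r i - x.c i) + x.cbar = (1 / (n : ℝ)) • ∑ i, r i := by
  rw [hx, Finset.sum_sub_distrib, smul_sub, sub_add_cancel]

theorem subsetAvg_norm_sq_round_u_le (hm : 1 ≤ m) (hmn : m ≤ n) (x : State n du dv)
    (hx : x.cbar = (1 / (n : ℝ)) • ∑ i, x.c i) (z : Fin n → ℕ → Ξ) (g : ℝ) :
    subsetAvg n m (fun s => ‖(-g) • ((1 / (m : ℝ)) •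
        ∑ i ∈ s, (stochMeanU F K γu γv x i (z i) - x.c i) + x.cbar)‖ ^ 2) ≤
      g ^ 2 * updateSq F m K γu γv x z := by
  simp only [norm_smul, mul_pow, subsetAvg_const_mul, norm_neg, Real.norm_eq_abs, sq_abs]
  have := subsetAvg_norm_sq_update_le hm hmn
    (fun i => stochMeanU F K γu γv x i (z i) - x.c i) x.cbar
  rw [average_sub_add_cbar x hx] at this
  exact mul_le_mul_of_nonneg_left this (sq_nonneg g)

theorem subsetAvg_inner_round_u (hm : 1 ≤ m) (hmn : m ≤ n) (x : State n du dv)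
    (hx : x.cbar = (1 / (n : ℝ)) • ∑ i, x.c i) (z : Fin n → ℕ → Ξ) (g : ℝ) (y : Vec du) :
    subsetAvg n m (fun s => ⟪y, (-g) • ((1 / (m : ℝ)) •
        ∑ i ∈ s, (stochMeanU F K γu γv x i (z i) - x.c i) + x.cbar)⟫) =
      -(g * ⟪y, (1 / (n : ℝ)) • ∑ i, stochMeanU F K γu γv x i (z i)⟫) := by
  have hm0 : (m : ℝ) ≠ 0 := by positivity
  rw [← average_sub_add_cbar x hx]
  simp only [inner_smul_right, inner_add_right, subsetAvg_const_mul, subsetAvg_add,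
    subsetAvg_const hmn, subsetAvg_inner_sum hm hmn]
  field_simp

/-- The mean of the objective after one round, over the set of participating clients. -/
theorem subsetAvg_loss_round_le [MeasurableSpace Ξ] {D : Fin n → Measure Ξ}
    {Lu Luv Lv Lvu : ℝ≥0} {L : ℝ} (hm : 1 ≤ m) (hmn : m ≤ n) (hK : 1 ≤ K)
    (hf : Smooth (clientLoss F D) Lu Luv Lv Lvu)
    (hL : L = (max (max Lu Lv) (max Luv Lvu) : ℝ≥0))
    (hγu : γu * ηu = γ) (hγv : γv * ηv = γ) (x : State n du dv)
    (hx : x.cbar = (1 / (n : ℝ)) • ∑ i, x.c i) (z : Fin n → ℕ → Ξ) :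
    subsetAvg n m (fun s => loss F D (round F m K γu γv ηu ηv s z x).u
        (round F m K γu γv ηu ηv s z x).v) ≤
      loss F D x.u x.v -
        γ * K * ⟪gradient (fun u => loss F D u x.v) x.u,
          (1 / (n : ℝ)) • ∑ i, stochMeanU F K γu γv x i (z i)⟫ -
        γ * K * ((m : ℝ) / n * (1 / (n : ℝ) * ∑ i,
          ⟪gradV (clientLoss F D i) x.u (x.v i), stochMeanV F K γu γv x i (z i)⟫)) +
        L * ((γ * K) ^ 2 * updateSq F m K γu γv x z) +
        L * ((γ * K) ^ 2 * ((m : ℝ) / n * (1 / (n : ℝ) *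
          ∑ i, ‖stochMeanV F K γu γv x i (z i)‖ ^ 2))) := by
  have hL0 : 0 ≤ L := by rw [hL]; exact NNReal.coe_nonneg _
  have h : ∀ s : Finset (Fin n), s.card = m →
      loss F D (round F m K γu γv ηu ηv s z x).u (round F m K γu γv ηu ηv s z x).v ≤
      loss F D x.u x.v + ⟪gradient (fun u => loss F D u x.v) x.u, (-(γ * K)) • ((1 / (m : ℝ)) •
        ∑ i ∈ s, (stochMeanU F K γu γv x i (z i) - x.c i) + x.cbar)⟫ +
      (1 / (n : ℝ)) * ∑ i ∈ s, ⟪gradV (clientLoss F D i) x.u (x.v i),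
        (-(γ * K)) • stochMeanV F K γu γv x i (z i)⟫ +
      L * ‖(-(γ * K)) • ((1 / (m : ℝ)) •
        ∑ i ∈ s, (stochMeanU F K γu γv x i (z i) - x.c i) + x.cbar)‖ ^ 2 +
      L * ((1 / (n : ℝ)) * ∑ i ∈ s, ‖(-(γ * K)) • stochMeanV F K γu γv x i (z i)‖ ^ 2) := by
    intro s hs
    rw [round_u hK hm hs, round_v hK, hγu, hγv]
    refine (loss_add_le (hm.trans hmn) hf hL _ _ _ _).trans (le_of_eq ?_)
    congr 3
    · congr 1
      rw [← Finset.sum_ite_mem_eq s]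
      refine Finset.sum_congr rfl fun i _ => ?_
      split_ifs <;> simp
    · rw [← Finset.sum_ite_mem_eq s]
      refine Finset.sum_congr rfl fun i _ => ?_
      split_ifs <;> simp
  refine (subsetAvg_mono h).trans ?_
  simp only [subsetAvg_add, subsetAvg_const hmn, subsetAvg_const_mul,
    subsetAvg_inner_round_u hm hmn x hx, subsetAvg_sum_mem hm hmn]
  have h1 := mul_le_mul_of_nonneg_left
    (subsetAvg_norm_sq_round_u_le (F := F) (K := K) (γu := γu) (γv := γv) hm hmn x hx z (γ * K)) hL0
  simp only [inner_smul_right, norm_smul, mul_pow, ← Finset.mul_sum, norm_neg, Real.norm_eq_abs,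
    sq_abs] at h1 ⊢
  linarith

/-- The mean squared distance to the anchors after one round. -/
theorem subsetAvg_anchor_round_le (hm : 1 ≤ m) (hmn : m ≤ n) (hK : 1 ≤ K)
    (hγu : γu * ηu = γ) (x : State n du dv)
    (hx : x.cbar = (1 / (n : ℝ)) • ∑ i, x.c i) (z : Fin n → ℕ → Ξ) (y : Fin n → Vec du) :
    subsetAvg n m (fun s => 1 / (n : ℝ) * ∑ i, ‖(round F m K γu γv ηu ηv s z x).u -
        (if i ∈ s then x.u else y i)‖ ^ 2) ≤
      (1 - (m : ℝ) / n / 2) * (1 / (n : ℝ) * ∑ i, ‖x.u - y i‖ ^ 2) +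
        3 * ((γ * K) ^ 2 * updateSq F m K γu γv x z) -
        2 * (γ * K * ⟪(1 / (n : ℝ)) • ∑ i, (x.u - y i),
          (1 / (n : ℝ)) • ∑ i, stochMeanU F K γu γv x i (z i)⟫) := by
  have hn0 : (0 : ℝ) < n := by exact_mod_cast hm.trans hmn
  have h : ∀ s : Finset (Fin n), s.card = m →
      1 / (n : ℝ) * ∑ i, ‖(round F m K γu γv ηu ηv s z x).u -
        (if i ∈ s then x.u else y i)‖ ^ 2 ≤
      3 * ‖(-(γ * K)) • ((1 / (m : ℝ)) •
        ∑ i ∈ s, (stochMeanU F K γu γv x i (z i) - x.c i) + x.cbar)‖ ^ 2 +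
      2 * ⟪(1 / (n : ℝ)) • ∑ i, (x.u - y i), (-(γ * K)) • ((1 / (m : ℝ)) •
        ∑ i ∈ s, (stochMeanU F K γu γv x i (z i) - x.c i) + x.cbar)⟫ +
      1 / (n : ℝ) * ∑ i, (if i ∈ s then 1 / 2 * ‖x.u - y i‖ ^ 2 else ‖x.u - y i‖ ^ 2) := by
    intro s hs
    rw [round_u hK hm hs, hγu]
    set d := (-(γ * K)) • ((1 / (m : ℝ)) •
        ∑ i ∈ s, (stochMeanU F K γu γv x i (z i) - x.c i) + x.cbar)
    have hi : ∀ i, ‖x.u + d - (if i ∈ s then x.u else y i)‖ ^ 2 ≤ 3 * ‖d‖ ^ 2 +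
        2 * ⟪x.u - y i, d⟫ +
        (if i ∈ s then 1 / 2 * ‖x.u - y i‖ ^ 2 else ‖x.u - y i‖ ^ 2) := by
      intro i
      split_ifs
      -- A participating client is at distance `‖d‖` from its new anchor. Expanding `0 ≤ ‖(u - y_i)
      -- + 2d‖²` adds the cross term `2⟪u - y_i, d⟫` at the price of `2‖d‖² + ‖u - y_i‖²/2`. Now
      -- every client has the same cross term, which depends on the set `s` only through `d`; half
      -- of the contraction is given up.
      · rw [add_sub_cancel_left]
        have := norm_add_sq_real (x.u - y i) ((2 : ℝ) • d)
        rw [inner_smul_right, norm_smul, mul_pow] at this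
        norm_num at this
        nlinarith [sq_nonneg ‖x.u - y i + (2 : ℝ) • d‖]
      · rw [add_sub_right_comm, norm_add_sq_real]
        nlinarith [sq_nonneg ‖d‖]
    have h2 := mul_le_mul_of_nonneg_left
      (Finset.sum_le_sum fun i (_ : i ∈ Finset.univ) => hi i) (show 0 ≤ 1 / (n : ℝ) by positivity)
    refine h2.trans (le_of_eq ?_)
    rw [Finset.sum_add_distrib, Finset.sum_add_distrib, real_inner_smul_left, sum_inner,
      ← Finset.mul_sum, ← Finset.mul_sum]
    simp only [Finset.sum_const, Finset.card_univ, Fintype.card_fin, nsmul_eq_mul]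
    field_simp
  refine (subsetAvg_mono h).trans ?_
  simp only [subsetAvg_add, subsetAvg_const_mul, subsetAvg_inner_round_u hm hmn x hx,
    subsetAvg_sum_ite hm hmn, ← Finset.mul_sum]
  have h1 := subsetAvg_norm_sq_round_u_le (F := F) (K := K) (γu := γu) (γv := γv) hm hmn x hx z
    (γ * K)
  linarith

/-- The mean squared error of the control variables at the anchors after one round. -/
theorem subsetAvg_control_round [MeasurableSpace Ξ] {D : Fin n → Measure Ξ}
    (hm : 1 ≤ m) (hmn : m ≤ n) (hK : 1 ≤ K) (hγu0 : γu ≠ 0)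
    (hγv : γv * ηv = γ) (x : State n du dv) (z : Fin n → ℕ → Ξ) (y : Fin n → Vec du) :
    subsetAvg n m (fun s => 1 / (n : ℝ) * ∑ i, ‖gradU (clientLoss F D i)
        (if i ∈ s then x.u else y i) ((round F m K γu γv ηu ηv s z x).v i) -
        (round F m K γu γv ηu ηv s z x).c i‖ ^ 2) =
      (m : ℝ) / n * (1 / (n : ℝ) * ∑ i, ‖gradU (clientLoss F D i) x.u
        (x.v i + (-(γ * K)) • stochMeanV F K γu γv x i (z i)) -
          stochMeanU F K γu γv x i (z i)‖ ^ 2) +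
      (1 - (m : ℝ) / n) * (1 / (n : ℝ) * ∑ i,
        ‖gradU (clientLoss F D i) (y i) (x.v i) - x.c i‖ ^ 2) := by
  have h : ∀ s : Finset (Fin n), 1 / (n : ℝ) * ∑ i, ‖gradU (clientLoss F D i)
        (if i ∈ s then x.u else y i) ((round F m K γu γv ηu ηv s z x).v i) -
        (round F m K γu γv ηu ηv s z x).c i‖ ^ 2 = 1 / (n : ℝ) * ∑ i,
      if i ∈ s then ‖gradU (clientLoss F D i) x.u
        (x.v i + (-(γ * K)) • stochMeanV F K γu γv x i (z i)) -
          stochMeanU F K γu γv x i (z i)‖ ^ 2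
      else ‖gradU (clientLoss F D i) (y i) (x.v i) - x.c i‖ ^ 2 := by
    intro s
    rw [round_v hK, round_c hK hγu0, hγv]
    congr 1
    refine Finset.sum_congr rfl fun i _ => ?_
    by_cases hi : i ∈ s <;> simp [hi]
  rw [funext h, subsetAvg_const_mul, subsetAvg_sum_ite hm hmn]
  ring

end Round

/-! ### Elementary inequalities in inner product spaces. -/

section Hilbert

open scoped RealInnerProductSpace
open Finset

variable {H : Type*} [SeminormedAddCommGroup H] [InnerProductSpace ℝ H]

theorem norm_add_sq_le_two (x y : H) : ‖x + y‖ ^ 2 ≤ 2 * ‖x‖ ^ 2 + 2 * ‖y‖ ^ 2 := by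
  have := parallelogram_law_with_norm ℝ x y
  nlinarith [mul_self_nonneg ‖x - y‖]

omit [InnerProductSpace ℝ H] in
theorem norm_add_sq_le_three (x y z : H) :
    ‖x + y + z‖ ^ 2 ≤ 3 * ‖x‖ ^ 2 + 3 * ‖y‖ ^ 2 + 3 * ‖z‖ ^ 2 := by
  have h := norm_add₃_le (a := x) (b := y) (c := z)
  have h2 := pow_le_pow_left₀ (norm_nonneg _) h 2
  nlinarith [sq_nonneg (‖x‖ - ‖y‖), sq_nonneg (‖y‖ - ‖z‖), sq_nonneg (‖x‖ - ‖z‖)]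

omit [InnerProductSpace ℝ H] in
theorem norm_sq_sum_le {ι : Type*} (s : Finset ι) (x : ι → H) :
    ‖∑ i ∈ s, x i‖ ^ 2 ≤ s.card * ∑ i ∈ s, ‖x i‖ ^ 2 :=
  (pow_le_pow_left₀ (norm_nonneg _) (norm_sum_le s x) 2).trans sq_sum_le_card_mul_sum_sq

theorem norm_sq_average_le {ι : Type*} (s : Finset ι) (x : ι → H) :
    ‖(1 / (s.card : ℝ)) • ∑ i ∈ s, x i‖ ^ 2 ≤ 1 / (s.card : ℝ) * ∑ i ∈ s, ‖x i‖ ^ 2 := by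
  rcases s.eq_empty_or_nonempty with rfl | hs
  · simp
  have h0 : (0 : ℝ) < s.card := by exact_mod_cast hs.card_pos
  rw [norm_smul, mul_pow, Real.norm_eq_abs, sq_abs]
  calc (1 / (s.card : ℝ)) ^ 2 * ‖∑ i ∈ s, x i‖ ^ 2
      ≤ (1 / (s.card : ℝ)) ^ 2 * (s.card * ∑ i ∈ s, ‖x i‖ ^ 2) := by
        gcongr; exact norm_sq_sum_le s x
    _ = _ := by field_simp

theorem norm_sq_sum_orthogonal_le {ι : Type*} [DecidableEq ι] (s : Finset ι) (x : ι → H) {c : ℝ}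
    (horth : ∀ i ∈ s, ∀ j ∈ s, i ≠ j → ⟪x i, x j⟫ = 0) (hc : ∀ i ∈ s, ‖x i‖ ^ 2 ≤ c) :
    ‖∑ i ∈ s, x i‖ ^ 2 ≤ s.card * c := by
  rw [← real_inner_self_eq_norm_sq, sum_inner]
  calc ∑ i ∈ s, ⟪x i, ∑ j ∈ s, x j⟫ ≤ ∑ i ∈ s, c := by
        refine sum_le_sum fun i hi => ?_
        rw [inner_sum, sum_eq_single i (fun j hj hji => horth i hi j hj hji.symm)
          (fun h => absurd hi h), real_inner_self_eq_norm_sq]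
        exact hc i hi
    _ = _ := by simp

/-- Displacement after `k ≤ K` noisy steps. -/
theorem norm_sq_displacement_le {K k : ℕ} (hk : k ≤ K) (γ : ℝ) {c : ℝ} (hc0 : 0 ≤ c) {x N : ℕ → H}
    (horth : ∀ i < K, ∀ j < K, i ≠ j → ⟪N i, N j⟫ = 0) (hc : ∀ i < K, ‖N i‖ ^ 2 ≤ c) :
    ‖γ • ∑ j ∈ range k, (x j + N j)‖ ^ 2 ≤
      γ ^ 2 * (2 * K * ∑ j ∈ range K, ‖x j‖ ^ 2 + 2 * (K * c)) := by
  rw [norm_smul, mul_pow, Real.norm_eq_abs, sq_abs, sum_add_distrib]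
  gcongr
  refine (norm_add_sq_le_two _ _).trans ?_
  have hk' : (k : ℝ) ≤ K := by exact_mod_cast hk
  have h1 : ‖∑ j ∈ range k, x j‖ ^ 2 ≤ K * ∑ j ∈ range K, ‖x j‖ ^ 2 := by
    refine (norm_sq_sum_le _ _).trans ?_
    rw [card_range]
    have : ∑ j ∈ range k, ‖x j‖ ^ 2 ≤ ∑ j ∈ range K, ‖x j‖ ^ 2 :=
      sum_le_sum_of_subset_of_nonneg (range_subset_range.2 hk) fun _ _ _ => by positivity
    gcongr
  -- Orthogonality makes the noise grow like `K`, whereas the gradients may add up to `K²`.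
  have h2 : ‖∑ j ∈ range k, N j‖ ^ 2 ≤ K * c := by
    refine (norm_sq_sum_orthogonal_le (range k) N (c := c)
      (fun i hi j hj => horth i (by grind) j (by grind)) (fun i hi => hc i (by grind))).trans ?_
    rw [card_range]
    gcongr
  linarith

/-- Polarization. The term `-‖y‖²` is kept on purpose: it later pays for the mean squares of the
local gradients. -/
theorem neg_inner_le_of_norm_sub {x y : H} {c g : ℝ} (hg : 0 ≤ g) (h : ‖y - x‖ ^ 2 ≤ c) :
    -(g * ⟪x, y⟫) ≤ -(g / 2) * (‖x‖ ^ 2 + ‖y‖ ^ 2) + g / 2 * c := by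
  rw [norm_sub_sq_real, real_inner_comm] at h
  nlinarith

end Hilbert

/-! ### Second-moment estimates for the local steps. -/

section LocalModel

open scoped RealInnerProductSpace
open Finset

/-- The second-order relations between the random vectors of one round, as elements of inner
product spaces: `a i`, `q i` are the partial gradients of client `i` at the beginning of the round,
`c i` its control variable, `ga i k`, `ha i k` the partial gradients at its local iterates,
`N i k`, `Nv i k` the noise of the stochastic gradients, and `w i k`, `wv i k` the displacements of
the local iterates. -/
structure LocalModel {H H' : Type*} [SeminormedAddCommGroup H] [InnerProductSpace ℝ H]
    [SeminormedAddCommGroup H'] [InnerProductSpace ℝ H'] {n : ℕ} (K : ℕ) (L σu σv γu γv : ℝ)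
    (a c : Fin n → H) (q : Fin n → H') (ga N w : Fin n → ℕ → H) (ha Nv wv : Fin n → ℕ → H') :
    Prop where
  w_eq : ∀ i, ∀ k < K, w i k =
    (-γu) • ∑ j ∈ range k, ((ga i j - c i + (1 / (n : ℝ)) • ∑ l, c l) + N i j)
  wv_eq : ∀ i, ∀ k < K, wv i k = (-γv) • ∑ j ∈ range k, (ha i j + Nv i j)
  lipU : ∀ i, ∀ k < K, ‖ga i k - a i‖ ^ 2 ≤ 2 * L ^ 2 * (‖w i k‖ ^ 2 + ‖wv i k‖ ^ 2)
  lipV : ∀ i, ∀ k < K, ‖ha i k - q i‖ ^ 2 ≤ 2 * L ^ 2 * (‖w i k‖ ^ 2 + ‖wv i k‖ ^ 2)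
  orthU : ∀ i j, ∀ k < K, ∀ l < K, (i, k) ≠ (j, l) → ⟪N i k, N j l⟫ = 0
  orthV : ∀ i, ∀ k < K, ∀ l < K, k ≠ l → ⟪Nv i k, Nv i l⟫ = 0
  varU : ∀ i, ∀ k < K, ‖N i k‖ ^ 2 ≤ σu ^ 2
  varV : ∀ i, ∀ k < K, ‖Nv i k‖ ^ 2 ≤ σv ^ 2
  orth_a : ∀ i j, ∀ k < K, ⟪a i, N j k⟫ = 0
  orth_q : ∀ i, ∀ k < K, ⟪q i, Nv i k⟫ = 0

variable {H H' : Type*} [SeminormedAddCommGroup H] [InnerProductSpace ℝ H]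
  [SeminormedAddCommGroup H'] [InnerProductSpace ℝ H']

/-- The average over the local steps `k < K`. -/
noncomputable def stepMean (K : ℕ) (x : ℕ → H) : H := (1 / (K : ℝ)) • ∑ k ∈ range K, x k

theorem stepMean_add (K : ℕ) (x y : ℕ → H) :
    stepMean K (fun k => x k + y k) = stepMean K x + stepMean K y := by
  simp [stepMean, sum_add_distrib]

/-- The average over the clients. -/
noncomputable def clientMean {n : ℕ} (x : Fin n → H) : H := (1 / (n : ℝ)) • ∑ i, x i

theorem clientMean_add {n : ℕ} (x y : Fin n → H) :
    clientMean (fun i => x i + y i) = clientMean x + clientMean y := by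
  simp [clientMean, sum_add_distrib]

theorem clientMean_sub {n : ℕ} (x y : Fin n → H) :
    clientMean (fun i => x i - y i) = clientMean x - clientMean y := by
  simp [clientMean, sum_sub_distrib, smul_sub]

theorem norm_sq_stepMean_le (K : ℕ) (x : ℕ → H) :
    ‖stepMean K x‖ ^ 2 ≤ stepMean K fun k => ‖x k‖ ^ 2 := by
  simpa [stepMean] using norm_sq_average_le (range K) x

theorem norm_sq_clientMean_le {n : ℕ} (x : Fin n → H) :
    ‖clientMean x‖ ^ 2 ≤ clientMean fun i => ‖x i‖ ^ 2 := by
  simpa [clientMean] using norm_sq_average_le univ x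

theorem clientMean_mono {n : ℕ} {x y : Fin n → ℝ} (h : ∀ i, x i ≤ y i) :
    clientMean x ≤ clientMean y := by
  simp only [clientMean, smul_eq_mul]
  gcongr with i _
  exact h i

theorem clientMean_mul {n : ℕ} (c : ℝ) (x : Fin n → ℝ) :
    clientMean (fun i => c * x i) = c * clientMean x := by
  simp only [clientMean, smul_eq_mul, ← mul_sum]
  ring

theorem clientMean_const {n : ℕ} (hn : 1 ≤ n) (c : ℝ) : clientMean (fun _ : Fin n => c) = c := by
  have : (n : ℝ) ≠ 0 := by positivity
  simp [clientMean, this]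

theorem clientMean_nonneg {n : ℕ} {x : Fin n → ℝ} (h : ∀ i, 0 ≤ x i) : 0 ≤ clientMean x := by
  simp only [clientMean, smul_eq_mul]
  exact mul_nonneg (by positivity) (sum_nonneg fun i _ => h i)

theorem stepMean_mono {K : ℕ} {x y : ℕ → ℝ} (h : ∀ k < K, x k ≤ y k) :
    stepMean K x ≤ stepMean K y := by
  simp only [stepMean, smul_eq_mul]
  gcongr with k hk
  exact h k (mem_range.1 hk)

theorem stepMean_mul (K : ℕ) (c : ℝ) (x : ℕ → ℝ) :
    stepMean K (fun k => c * x k) = c * stepMean K x := by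
  simp only [stepMean, smul_eq_mul, ← mul_sum]
  ring

theorem stepMean_const {K : ℕ} (hK : 1 ≤ K) (c : ℝ) : stepMean K (fun _ => c) = c := by
  have : (K : ℝ) ≠ 0 := by positivity
  simp [stepMean, this]

theorem stepMean_nonneg {K : ℕ} {x : ℕ → ℝ} (h : ∀ k, 0 ≤ x k) : 0 ≤ stepMean K x := by
  simp only [stepMean, smul_eq_mul]
  exact mul_nonneg (by positivity) (sum_nonneg fun k _ => h k)

theorem norm_sq_stepMean_noise_le {K : ℕ} (hK : 1 ≤ K) {N : ℕ → H} {c : ℝ}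
    (horth : ∀ k < K, ∀ l < K, k ≠ l → ⟪N k, N l⟫ = 0) (hc : ∀ k < K, ‖N k‖ ^ 2 ≤ c) :
    ‖stepMean K N‖ ^ 2 ≤ c / K := by
  have hK0 : (0 : ℝ) < K := by positivity
  rw [stepMean, norm_smul, mul_pow, Real.norm_eq_abs, sq_abs]
  have := norm_sq_sum_orthogonal_le (range K) N (c := c)
    (fun i hi j hj => horth i (mem_range.1 hi) j (mem_range.1 hj))
    (fun i hi => hc i (mem_range.1 hi))
  rw [card_range] at this
  calc (1 / (K : ℝ)) ^ 2 * ‖∑ k ∈ range K, N k‖ ^ 2 ≤ (1 / (K : ℝ)) ^ 2 * (K * c) := by gcongr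
    _ = c / K := by field_simp

/-- The noises are orthogonal across clients as well as across steps, so averaging divides the
variance by `nK`. -/
theorem norm_sq_mean_noise_le {n K : ℕ} (hn : 1 ≤ n) (hK : 1 ≤ K) {N : Fin n → ℕ → H} {c : ℝ}
    (horth : ∀ i j, ∀ k < K, ∀ l < K, (i, k) ≠ (j, l) → ⟪N i k, N j l⟫ = 0)
    (hc : ∀ i, ∀ k < K, ‖N i k‖ ^ 2 ≤ c) :
    ‖clientMean fun i => stepMean K (N i)‖ ^ 2 ≤ c / K / n := by
  have hK0 : (0 : ℝ) < K := by positivity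
  have hn0 : (0 : ℝ) < n := by positivity
  have h := norm_sq_sum_orthogonal_le (univ ×ˢ range K) (fun p : Fin n × ℕ => N p.1 p.2) (c := c)
    (fun p hp p' hp' hne => horth p.1 p'.1 p.2 (by grind) p'.2 (by grind) (by simpa using hne))
    (fun p hp => hc p.1 p.2 (by grind))
  rw [sum_product, card_product, card_range, card_univ, Fintype.card_fin] at h
  simp only [clientMean, stepMean, ← smul_sum, smul_smul]
  rw [norm_smul, mul_pow, Real.norm_eq_abs, sq_abs]
  calc (1 / (n : ℝ) * (1 / K)) ^ 2 * ‖∑ i, ∑ k ∈ range K, N i k‖ ^ 2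
      ≤ (1 / (n : ℝ) * (1 / K)) ^ 2 * ((n * K : ℕ) * c) := by gcongr
    _ = c / K / n := by push_cast; field_simp

theorem inner_stepMean_eq_zero {K : ℕ} {x : H} {N : ℕ → H} (h : ∀ k < K, ⟪x, N k⟫ = 0) :
    ⟪x, stepMean K N⟫ = 0 := by
  rw [stepMean, inner_smul_right, inner_sum, sum_eq_zero fun k hk => h k (mem_range.1 hk), mul_zero]

theorem inner_clientMean_eq_zero {n : ℕ} {x : H} {N : Fin n → H} (h : ∀ i, ⟪x, N i⟫ = 0) :
    ⟪x, clientMean N⟫ = 0 := by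
  rw [clientMean, inner_smul_right, inner_sum, sum_eq_zero fun k _ => h k, mul_zero]

theorem clientMean_inner_eq_zero {n : ℕ} {x : Fin n → H} {y : H} (h : ∀ i, ⟪x i, y⟫ = 0) :
    ⟪clientMean x, y⟫ = 0 := by
  rw [clientMean, inner_smul_left, sum_inner, sum_eq_zero fun k _ => h k, mul_zero]

/-- Here `e` is the offset from the anchors. It is orthogonal to the noise, so only the mean of the
true local gradients survives, and Young's inequality with weights `m/(4n)` and `4n/m` gives up
another quarter of the contraction rate `m/n`. Having the square of the mean on the right, rather
than the full second moment of the update, is what produces the exponent `2/3`. -/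
theorem neg_inner_anchor_le {n K m : ℕ} {g : ℝ} {ga N : Fin n → ℕ → H} (hm : 1 ≤ m)
    (hn : 1 ≤ n) {e : Fin n → H}
    (he : ∀ i j, ∀ k < K, ⟪e i, N j k⟫ = 0) :
    -(2 * (g * ⟪clientMean e, clientMean fun i => stepMean K fun k => ga i k + N i k⟫)) ≤
      (m : ℝ) / n / 4 * (clientMean fun i => ‖e i‖ ^ 2) +
        4 * ((n : ℝ) / m) * g ^ 2 * ‖clientMean fun i => stepMean K (ga i)‖ ^ 2 := by
  have hm0 : (0 : ℝ) < m := by positivity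
  have hn0 : (0 : ℝ) < n := by positivity
  simp only [stepMean_add, clientMean_add, inner_add_right]
  have h0 : ⟪clientMean e, clientMean fun i => stepMean K (N i)⟫ = 0 :=
    clientMean_inner_eq_zero fun i => inner_clientMean_eq_zero fun j =>
      inner_stepMean_eq_zero fun k hk => he i j k hk
  rw [h0, add_zero]
  set y := clientMean fun i => stepMean K (ga i)
  have h1 := norm_sq_clientMean_le e
  have h2 : (m : ℝ) / n / 4 * ‖clientMean e‖ ^ 2 ≤
      (m : ℝ) / n / 4 * clientMean fun i => ‖e i‖ ^ 2 := by gcongr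
  have h3 := norm_add_sq_real (clientMean e) ((4 * ((n : ℝ) / m) * g) • y)
  rw [inner_smul_right, norm_smul, mul_pow, Real.norm_eq_abs, sq_abs] at h3
  have h4 : 0 ≤ (m : ℝ) / n / 4 * ‖clientMean e + (4 * ((n : ℝ) / m) * g) • y‖ ^ 2 := by positivity
  rw [h3] at h4
  have e1 : (m : ℝ) / n / 4 * (‖clientMean e‖ ^ 2 + 2 * (4 * ((n : ℝ) / m) * g *
      ⟪clientMean e, y⟫) + (4 * ((n : ℝ) / m) * g) ^ 2 * ‖y‖ ^ 2) =
      (m : ℝ) / n / 4 * ‖clientMean e‖ ^ 2 + 2 * (g * ⟪clientMean e, y⟫) +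
        4 * ((n : ℝ) / m) * g ^ 2 * ‖y‖ ^ 2 := by
    field_simp
  linarith

namespace LocalModel

variable {n K m : ℕ} {L σu σv γu γv g : ℝ} {a c : Fin n → H} {q : Fin n → H'}
  {ga N w : Fin n → ℕ → H} {ha Nv wv : Fin n → ℕ → H'}

/-- The mean drift of the local iterates. -/
noncomputable def drift (K : ℕ) (w : Fin n → ℕ → H) (wv : Fin n → ℕ → H') : ℝ :=
  clientMean fun i => stepMean K fun k => ‖w i k‖ ^ 2 + ‖wv i k‖ ^ 2

omit [InnerProductSpace ℝ H] [InnerProductSpace ℝ H'] in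
theorem drift_nonneg : 0 ≤ drift K w wv :=
  clientMean_nonneg fun _ => stepMean_nonneg fun _ => by positivity

variable (h : LocalModel K L σu σv γu γv a c q ga N w ha Nv wv)

include h

theorem norm_sq_stepMean_ga_sub_le (hK : 1 ≤ K) (i : Fin n) : ‖stepMean K (ga i) - a i‖ ^ 2 ≤
    2 * L ^ 2 * stepMean K fun k => ‖w i k‖ ^ 2 + ‖wv i k‖ ^ 2 := by
  have hK0 : (K : ℝ) ≠ 0 := by positivity
  have e : stepMean K (ga i) - a i = stepMean K fun k => ga i k - a i := by
    simp only [stepMean, sum_sub_distrib, sum_const, card_range, smul_sub,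
      ← Nat.cast_smul_eq_nsmul ℝ, smul_smul]
    rw [one_div_mul_cancel hK0, one_smul]
  rw [e, ← stepMean_mul]
  exact (norm_sq_stepMean_le _ _).trans (stepMean_mono fun k hk => h.lipU i k hk)

theorem norm_sq_stepMean_ha_sub_le (hK : 1 ≤ K) (i : Fin n) : ‖stepMean K (ha i) - q i‖ ^ 2 ≤
    2 * L ^ 2 * stepMean K fun k => ‖w i k‖ ^ 2 + ‖wv i k‖ ^ 2 := by
  have hK0 : (K : ℝ) ≠ 0 := by positivity
  have e : stepMean K (ha i) - q i = stepMean K fun k => ha i k - q i := by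
    simp only [stepMean, sum_sub_distrib, sum_const, card_range, smul_sub,
      ← Nat.cast_smul_eq_nsmul ℝ, smul_smul]
    rw [one_div_mul_cancel hK0, one_smul]
  rw [e, ← stepMean_mul]
  exact (norm_sq_stepMean_le _ _).trans (stepMean_mono fun k hk => h.lipV i k hk)

theorem norm_sq_noiseU_le (hK : 1 ≤ K) (i : Fin n) : ‖stepMean K (N i)‖ ^ 2 ≤ σu ^ 2 / K :=
  norm_sq_stepMean_noise_le hK
    (fun k hk l hl hkl => h.orthU i i k hk l hl fun e => hkl (congrArg Prod.snd e)) (h.varU i)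

theorem norm_sq_noiseV_le (hK : 1 ≤ K) (i : Fin n) : ‖stepMean K (Nv i)‖ ^ 2 ≤ σv ^ 2 / K :=
  norm_sq_stepMean_noise_le hK (h.orthV i) (h.varV i)

/-- The noise is orthogonal to the gradients at the start of the round; what remains is
polarization, with the drift as the error. -/
theorem descentU (hK : 1 ≤ K) (hg : 0 ≤ g) :
    -(g * ⟪clientMean a, clientMean fun i => stepMean K fun k => ga i k + N i k⟫) ≤
      -(g / 2) * (‖clientMean a‖ ^ 2 + ‖clientMean fun i => stepMean K (ga i)‖ ^ 2) +
        g * (L ^ 2 * drift K w wv) := by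
  simp only [stepMean_add, clientMean_add, inner_add_right]
  have h0 : ⟪clientMean a, clientMean fun i => stepMean K (N i)⟫ = 0 :=
    clientMean_inner_eq_zero fun i => inner_clientMean_eq_zero fun j =>
      inner_stepMean_eq_zero fun k hk => h.orth_a i j k hk
  rw [h0, add_zero]
  have h1 : ‖(clientMean fun i => stepMean K (ga i)) - clientMean a‖ ^ 2 ≤
      2 * L ^ 2 * drift K w wv := by
    rw [← clientMean_sub, drift, ← clientMean_mul]
    exact (norm_sq_clientMean_le _).trans
      (clientMean_mono fun i => h.norm_sq_stepMean_ga_sub_le hK i)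
  have := neg_inner_le_of_norm_sub hg h1
  linarith

theorem descentV (hK : 1 ≤ K) (hg : 0 ≤ g) (hmn : m ≤ n) (hn : 1 ≤ n) :
    -(g * ((m : ℝ) / n * clientMean fun i => ⟪q i, stepMean K fun k => ha i k + Nv i k⟫)) ≤
      -(g / 2) * ((m : ℝ) / n * (clientMean fun i => ‖q i‖ ^ 2) +
        (m : ℝ) / n * clientMean fun i => ‖stepMean K (ha i)‖ ^ 2) +
        g * (L ^ 2 * drift K w wv) := by
  have hn0 : (0 : ℝ) < n := by positivity
  have hρ : (m : ℝ) / n ≤ 1 := (div_le_one hn0).2 (by exact_mod_cast hmn)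
  have h1 : ∀ i, -g * ⟪q i, stepMean K fun k => ha i k + Nv i k⟫ ≤
      -(g / 2) * ‖q i‖ ^ 2 + -(g / 2) * ‖stepMean K (ha i)‖ ^ 2 +
      (g * L ^ 2) * (stepMean K fun k => ‖w i k‖ ^ 2 + ‖wv i k‖ ^ 2) := by
    intro i
    rw [stepMean_add, inner_add_right, inner_stepMean_eq_zero (h.orth_q i), add_zero]
    have := neg_inner_le_of_norm_sub hg (h.norm_sq_stepMean_ha_sub_le hK i)
    linarith
  have h2 := clientMean_mono h1
  simp only [clientMean_add, clientMean_mul] at h2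
  have h3 := mul_le_mul_of_nonneg_left h2 (show 0 ≤ (m : ℝ) / n by positivity)
  have hD : 0 ≤ drift K w wv := drift_nonneg
  have h4 : (m : ℝ) / n * (g * L ^ 2 * drift K w wv) ≤ g * L ^ 2 * drift K w wv :=
    mul_le_of_le_one_left (by positivity) hρ
  unfold drift at h4 ⊢
  linarith

theorem updateV_le (hK : 1 ≤ K) (hn : 1 ≤ n) :
    (m : ℝ) / n * (clientMean fun i => ‖stepMean K fun k => ha i k + Nv i k‖ ^ 2) ≤
      2 * ((m : ℝ) / n * clientMean fun i => ‖stepMean K (ha i)‖ ^ 2) +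
        2 * ((m : ℝ) / n * (σv ^ 2 / K)) := by
  have h1 : ∀ i, ‖stepMean K fun k => ha i k + Nv i k‖ ^ 2 ≤
      2 * ‖stepMean K (ha i)‖ ^ 2 + 2 * (σv ^ 2 / K) := by
    intro i
    rw [stepMean_add]
    refine (norm_add_sq_le_two _ _).trans ?_
    have := h.norm_sq_noiseV_le hK i
    linarith
  have h2 := clientMean_mono h1
  rw [clientMean_add, clientMean_mul, clientMean_const hn] at h2
  have h3 := mul_le_mul_of_nonneg_left h2 (show 0 ≤ (m : ℝ) / n by positivity)
  linarith

/-- The noise of the mean step is averaged over all clients, and `1/n ≤ 1/m`; the sampling variance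
splits into drift, noise and control error, each with a factor `3` and divided by `m`. So `5 = 2 +
3`, and `6 = 3·2` with the `2` from the Lipschitz bound. -/
theorem updateU_le (hK : 1 ≤ K) (hm : 1 ≤ m) (hmn : m ≤ n) :
    ‖clientMean fun i => stepMean K fun k => ga i k + N i k‖ ^ 2 +
      1 / (m : ℝ) * (clientMean fun i => ‖(stepMean K fun k => ga i k + N i k) - c i‖ ^ 2) ≤
    2 * ‖clientMean fun i => stepMean K (ga i)‖ ^ 2 + 5 * (σu ^ 2 / K / m) +
      6 * (L ^ 2 * drift K w wv) + 3 * ((clientMean fun i => ‖a i - c i‖ ^ 2) / m) := by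
  have hn : 1 ≤ n := hm.trans hmn
  have hm1 : (1 : ℝ) ≤ m := by exact_mod_cast hm
  have hm0 : (0 : ℝ) < m := by linarith
  have hmn' : (m : ℝ) ≤ n := by exact_mod_cast hmn
  have h1 : ‖clientMean fun i => stepMean K fun k => ga i k + N i k‖ ^ 2 ≤
      2 * ‖clientMean fun i => stepMean K (ga i)‖ ^ 2 + 2 * (σu ^ 2 / K / m) := by
    simp only [stepMean_add, clientMean_add]
    refine (norm_add_sq_le_two _ _).trans ?_
    have e1 := norm_sq_mean_noise_le hn hK h.orthU h.varU
    have e2 : σu ^ 2 / K / n ≤ σu ^ 2 / K / m := by gcongr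
    linarith
  have h2 : ∀ i, ‖(stepMean K fun k => ga i k + N i k) - c i‖ ^ 2 ≤ 3 * ‖a i - c i‖ ^ 2 +
      6 * L ^ 2 * (stepMean K fun k => ‖w i k‖ ^ 2 + ‖wv i k‖ ^ 2) + 3 * (σu ^ 2 / K) := by
    intro i
    have e : (stepMean K fun k => ga i k + N i k) - c i =
        (stepMean K (ga i) - a i) + stepMean K (N i) + (a i - c i) := by
      rw [stepMean_add]; abel
    rw [e]
    refine (norm_add_sq_le_three _ _ _).trans ?_
    have := h.norm_sq_noiseU_le hK i
    have := h.norm_sq_stepMean_ga_sub_le hK i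
    linarith
  have h3 := clientMean_mono h2
  simp only [clientMean_add, clientMean_mul, clientMean_const hn] at h3
  have h4 := mul_le_mul_of_nonneg_left h3 (show 0 ≤ 1 / (m : ℝ) by positivity)
  have hD : 0 ≤ L ^ 2 * drift K w wv := mul_nonneg (sq_nonneg L) drift_nonneg
  have h5 : 1 / (m : ℝ) * (L ^ 2 * drift K w wv) ≤ L ^ 2 * drift K w wv := by
    rw [one_div_mul_eq_div]
    exact div_le_self hD hm1
  change _ ≤ 1 / (m : ℝ) * (3 * (clientMean fun i => ‖a i - c i‖ ^ 2) + 6 * L ^ 2 * drift K w wv +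
    3 * (σu ^ 2 / K)) at h4
  have e3 : 1 / (m : ℝ) * (3 * (clientMean fun i => ‖a i - c i‖ ^ 2) + 6 * L ^ 2 * drift K w wv +
    3 * (σu ^ 2 / K)) = 3 * ((clientMean fun i => ‖a i - c i‖ ^ 2) / m) +
      6 * (1 / (m : ℝ) * (L ^ 2 * drift K w wv)) + 3 * (σu ^ 2 / K / m) := by ring
  linarith

/-- The corrected gradient at a local iterate is its value at the start of the round plus a
Lipschitz error. The bound refers to the drift itself, and `drift_le` closes the loop. -/
theorem norm_sq_w_le (i : Fin n) {k : ℕ} (hk : k < K) : ‖w i k‖ ^ 2 ≤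
    (γu * K) ^ 2 * (2 * (σu ^ 2 / K) +
      8 * L ^ 2 * (stepMean K fun k => ‖w i k‖ ^ 2 + ‖wv i k‖ ^ 2) +
      4 * ‖a i - c i + clientMean c‖ ^ 2) := by
  have hK0 : (0 : ℝ) < K := by exact_mod_cast (Nat.zero_le k).trans_lt hk
  rw [h.w_eq i k hk]
  refine (norm_sq_displacement_le hk.le (-γu) (sq_nonneg σu)
    (fun k hk l hl hkl => h.orthU i i k hk l hl fun e => hkl (congrArg Prod.snd e))
    (h.varU i)).trans ?_
  have h1 : ∀ j ∈ range K, ‖ga i j - c i + (1 / (n : ℝ)) • ∑ l, c l‖ ^ 2 ≤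
      4 * L ^ 2 * (‖w i j‖ ^ 2 + ‖wv i j‖ ^ 2) + 2 * ‖a i - c i + clientMean c‖ ^ 2 := by
    intro j hj
    have e : ga i j - c i + (1 / (n : ℝ)) • ∑ l, c l =
        (ga i j - a i) + (a i - c i + clientMean c) := by rw [clientMean]; abel
    rw [e]
    refine (norm_add_sq_le_two _ _).trans ?_
    have := h.lipU i j (mem_range.1 hj)
    linarith
  have h2 := sum_le_sum h1
  rw [sum_add_distrib, ← mul_sum, sum_const, card_range, nsmul_eq_mul] at h2
  calc _ ≤ (-γu) ^ 2 * (2 * K * (4 * L ^ 2 * ∑ j ∈ range K, (‖w i j‖ ^ 2 + ‖wv i j‖ ^ 2) +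
        K * (2 * ‖a i - c i + clientMean c‖ ^ 2)) + 2 * (K * σu ^ 2)) := by gcongr
    _ = _ := by
      simp only [stepMean, smul_eq_mul]
      field_simp
      ring

theorem norm_sq_wv_le (i : Fin n) {k : ℕ} (hk : k < K) : ‖wv i k‖ ^ 2 ≤
    (γv * K) ^ 2 * (2 * (σv ^ 2 / K) +
      8 * L ^ 2 * (stepMean K fun k => ‖w i k‖ ^ 2 + ‖wv i k‖ ^ 2) + 4 * ‖q i‖ ^ 2) := by
  have hK0 : (0 : ℝ) < K := by exact_mod_cast (Nat.zero_le k).trans_lt hk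
  rw [h.wv_eq i k hk]
  refine (norm_sq_displacement_le hk.le (-γv) (sq_nonneg σv) (h.orthV i) (h.varV i)).trans ?_
  have h1 : ∀ j ∈ range K, ‖ha i j‖ ^ 2 ≤
      4 * L ^ 2 * (‖w i j‖ ^ 2 + ‖wv i j‖ ^ 2) + 2 * ‖q i‖ ^ 2 := by
    intro j hj
    have e : ha i j = (ha i j - q i) + q i := by abel
    rw [e]
    refine (norm_add_sq_le_two _ _).trans ?_
    have := h.lipV i j (mem_range.1 hj)
    linarith
  have h2 := sum_le_sum h1
  rw [sum_add_distrib, ← mul_sum, sum_const, card_range, nsmul_eq_mul] at h2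
  calc _ ≤ (-γv) ^ 2 * (2 * K * (4 * L ^ 2 * ∑ j ∈ range K, (‖w i j‖ ^ 2 + ‖wv i j‖ ^ 2) +
        K * (2 * ‖q i‖ ^ 2)) + 2 * (K * σv ^ 2)) := by gcongr
    _ = _ := by
      simp only [stepMean, smul_eq_mul]
      field_simp
      ring

-- Averaging the expanded square gives the control error plus `‖ā‖² - ‖ā - c̄‖²`, where bars denote
-- averages over the clients. This replaces a bound on the dissimilarity of the clients: the
-- corrected local direction is governed by the global gradient and the control error alone.
omit h in
theorem clientMean_norm_sq_sub_add_le (hn : 1 ≤ n) (a c : Fin n → H) :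
    (clientMean fun i => ‖a i - c i + clientMean c‖ ^ 2) ≤
      ‖clientMean a‖ ^ 2 + clientMean fun i => ‖a i - c i‖ ^ 2 := by
  have hn0 : (n : ℝ) ≠ 0 := by positivity
  have h1 : ∀ i, ‖a i - c i + clientMean c‖ ^ 2 =
      ‖a i - c i‖ ^ 2 + (2 * ⟪clientMean c, a i - c i⟫ + ‖clientMean c‖ ^ 2) := by
    intro i
    rw [norm_add_sq_real, real_inner_comm]
    ring
  have h2 : (clientMean fun i => ⟪clientMean c, a i - c i⟫) =
      ⟪clientMean c, clientMean a - clientMean c⟫ := by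
    rw [← clientMean_sub]
    simp only [clientMean, smul_eq_mul, inner_smul_right, inner_sum]
  simp only [h1, clientMean_add, clientMean_mul, clientMean_const hn, h2]
  have h3 := norm_sub_sq_real (clientMean a) (clientMean c)
  rw [inner_sub_right, real_inner_self_eq_norm_sq, real_inner_comm]
  nlinarith [sq_nonneg ‖clientMean a - clientMean c‖]

/-- The hypotheses on `γu` and `γv` give the drift the weights `1/m` and `m/n` that the noise and
the personal gradients carry in the final bound. -/
theorem drift_le (hK : 1 ≤ K) (hm : 1 ≤ m) (hmn : m ≤ n) (hg : 0 ≤ g) (hL : 0 ≤ L)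
    (hgL : g * L ≤ 1 / 72)
    (hγu : (γu * K) ^ 2 ≤ g ^ 2 / m) (hγv : (γv * K) ^ 2 ≤ g ^ 2 * ((m : ℝ) / n)) :
    L ^ 2 * drift K w wv ≤ (g * L) ^ 2 * (3 * (σu ^ 2 / K / m + (m : ℝ) / n * (σv ^ 2 / K)) +
      5 * (‖clientMean a‖ ^ 2 + (m : ℝ) / n * clientMean fun i => ‖q i‖ ^ 2) +
      5 * ((clientMean fun i => ‖a i - c i‖ ^ 2) / m)) := by
  have hn : 1 ≤ n := hm.trans hmn
  have hm1 : (1 : ℝ) ≤ m := by exact_mod_cast hm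
  have hm0 : (0 : ℝ) < m := by linarith
  have hn0 : (0 : ℝ) < n := by positivity
  have hρ : (m : ℝ) / n ≤ 1 := (div_le_one hn0).2 (by exact_mod_cast hmn)
  have hD0 : 0 ≤ drift K w wv := drift_nonneg
  set Ec := clientMean fun i => ‖a i - c i‖ ^ 2 with hEc
  have hEc0 : 0 ≤ Ec := clientMean_nonneg fun i => by positivity
  set W := clientMean fun i => ‖q i‖ ^ 2 with hW
  have hW0 : 0 ≤ W := clientMean_nonneg fun i => by positivity
  have h1 : ∀ i, (stepMean K fun k => ‖w i k‖ ^ 2 + ‖wv i k‖ ^ 2) ≤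
      g ^ 2 / m * (2 * (σu ^ 2 / K) +
      8 * L ^ 2 * (stepMean K fun k => ‖w i k‖ ^ 2 + ‖wv i k‖ ^ 2) +
      4 * ‖a i - c i + clientMean c‖ ^ 2) +
      g ^ 2 * ((m : ℝ) / n) * (2 * (σv ^ 2 / K) +
      8 * L ^ 2 * (stepMean K fun k => ‖w i k‖ ^ 2 + ‖wv i k‖ ^ 2) + 4 * ‖q i‖ ^ 2) := by
    intro i
    have hd : 0 ≤ stepMean K fun k => ‖w i k‖ ^ 2 + ‖wv i k‖ ^ 2 :=
      stepMean_nonneg fun k => by positivity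
    rw [← stepMean_const hK (g ^ 2 / m * _ + _)]
    refine stepMean_mono fun k hk => add_le_add ((h.norm_sq_w_le i hk).trans ?_)
      ((h.norm_sq_wv_le i hk).trans ?_)
    · gcongr
    · gcongr
  have h2 := clientMean_mono h1
  simp only [clientMean_add, clientMean_mul, clientMean_const hn] at h2
  change drift K w wv ≤ g ^ 2 / m * (2 * (σu ^ 2 / K) + 8 * L ^ 2 * drift K w wv +
    4 * clientMean fun i => ‖a i - c i + clientMean c‖ ^ 2) + g ^ 2 * ((m : ℝ) / n) *
    (2 * (σv ^ 2 / K) + 8 * L ^ 2 * drift K w wv + 4 * W) at h2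
  have h3 := clientMean_norm_sq_sub_add_le hn a c
  have hm' : 0 ≤ g ^ 2 / m := by positivity
  have h4 := mul_le_mul_of_nonneg_left h3 hm'
  have hm2 : g ^ 2 / m ≤ g ^ 2 := div_le_self (by positivity) hm1
  have hm3 : g ^ 2 * ((m : ℝ) / n) ≤ g ^ 2 := mul_le_of_le_one_right (by positivity) hρ
  have hLD : 0 ≤ L ^ 2 * drift K w wv := by positivity
  have h5 := mul_le_mul_of_nonneg_right hm2 hLD
  have h6 := mul_le_mul_of_nonneg_right hm3 hLD
  have h7 := mul_le_mul_of_nonneg_right hm2 (sq_nonneg ‖clientMean a‖)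
  have hθ2 : (g * L) ^ 2 ≤ 1 / 5184 := by
    have : 0 ≤ g * L := by positivity
    nlinarith
  have h8 : g ^ 2 * (L ^ 2 * drift K w wv) ≤ 1 / 5184 * drift K w wv := by
    rw [← mul_assoc, ← mul_pow]
    gcongr
  set p := g ^ 2 * (σu ^ 2 / K / m) with hp
  set r := g ^ 2 * ((m : ℝ) / n * (σv ^ 2 / K)) with hr
  have hp0 : 0 ≤ p := by positivity
  have hr0 : 0 ≤ r := by positivity
  have e1 : g ^ 2 / m * (2 * (σu ^ 2 / K)) = 2 * p := by rw [hp]; field_simp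
  have e3 : g ^ 2 / m * Ec = g ^ 2 * (Ec / m) := by field_simp
  have h9 : 0 ≤ g ^ 2 * (Ec / m) := by positivity
  have h10 : 0 ≤ g ^ 2 * ‖clientMean a‖ ^ 2 := by positivity
  have h11 : 0 ≤ g ^ 2 * ((m : ℝ) / n * W) := by positivity
  -- On the right the drift itself occurs with a factor of at most `16θ² ≤ 16/5184`. Absorbing it
  -- raises the constants `2` and `4` to at most `3` and `5`.
  have key : drift K w wv ≤ 3 * (p + r) + 5 * (g ^ 2 * ‖clientMean a‖ ^ 2 +
      g ^ 2 * ((m : ℝ) / n * W)) + 5 * (g ^ 2 * (Ec / m)) := by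
    rw [hr] at *
    nlinarith
  calc L ^ 2 * drift K w wv ≤ L ^ 2 * (3 * (p + r) + 5 * (g ^ 2 * ‖clientMean a‖ ^ 2 +
      g ^ 2 * ((m : ℝ) / n * W)) + 5 * (g ^ 2 * (Ec / m))) := by gcongr
    _ = _ := by rw [hp, hr]; ring

/-- For a participating client the new control error consists of the effect of the move of `v_i` on
the gradient (`x - a`), the drift and the noise. -/
theorem control_le (hK : 1 ≤ K) (hn : 1 ≤ n) {x : Fin n → H}
    (hx : ∀ i, ‖x i - a i‖ ^ 2 ≤ (g * L) ^ 2 * ‖stepMean K fun k => ha i k + Nv i k‖ ^ 2) :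
    (m : ℝ) / n * (clientMean fun i => ‖x i - stepMean K fun k => ga i k + N i k‖ ^ 2) ≤
      (m : ℝ) / n * (3 * (σu ^ 2 / K)) + 3 * (g * L) ^ 2 *
        ((m : ℝ) / n * clientMean fun i => ‖stepMean K fun k => ha i k + Nv i k‖ ^ 2) +
        6 * ((m : ℝ) / n) * (L ^ 2 * drift K w wv) := by
  have h1 : ∀ i, ‖x i - stepMean K fun k => ga i k + N i k‖ ^ 2 ≤
      3 * (g * L) ^ 2 * ‖stepMean K fun k => ha i k + Nv i k‖ ^ 2 +
      6 * L ^ 2 * (stepMean K fun k => ‖w i k‖ ^ 2 + ‖wv i k‖ ^ 2) + 3 * (σu ^ 2 / K) := by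
    intro i
    have e : (x i - stepMean K fun k => ga i k + N i k) =
        (x i - a i) + -(stepMean K (ga i) - a i) + -stepMean K (N i) := by
      rw [stepMean_add]; abel
    rw [e]
    refine (norm_add_sq_le_three _ _ _).trans ?_
    rw [norm_neg, norm_neg]
    have := h.norm_sq_noiseU_le hK i
    have := h.norm_sq_stepMean_ga_sub_le hK i
    have := hx i
    linarith
  have h2 := clientMean_mono h1
  simp only [clientMean_add, clientMean_mul, clientMean_const hn] at h2
  have h3 := mul_le_mul_of_nonneg_left h2 (show 0 ≤ (m : ℝ) / n by positivity)
  unfold drift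
  linarith

end LocalModel

end LocalModel

/-! ### Square-integrable random vectors as a seminormed inner product space. -/

section SquareIntegrable

open scoped RealInnerProductSpace

variable {Ω : Type*} [MeasurableSpace Ω] {P : Measure Ω} {E : Type*} [NormedAddCommGroup E]
  [InnerProductSpace ℝ E]

theorem integrable_inner_of_memLp {X Y : Ω → E} (hX : MemLp X 2 P) (hY : MemLp Y 2 P) :
    Integrable (fun ω => ⟪X ω, Y ω⟫) P := by
  have h : Integrable (fun ω => ‖X ω‖ * ‖Y ω‖) P := hX.norm.integrable_mul hY.norm
  exact h.mono' (hX.1.inner hY.1) (.of_forall fun ω => abs_real_inner_le_norm _ _)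

omit [InnerProductSpace ℝ E] in
theorem integrable_norm_sq_of_memLp {X : Ω → E} (hX : MemLp X 2 P) :
    Integrable (fun ω => ‖X ω‖ ^ 2) P :=
  (memLp_two_iff_integrable_sq_norm hX.1).1 hX

/-- The square-integrable random vectors. -/
def squareIntegrable (P : Measure Ω) (E : Type*) [NormedAddCommGroup E] [InnerProductSpace ℝ E] :
    Submodule ℝ (Ω → E) where
  carrier := {X | MemLp X 2 P}
  add_mem' hX hY := MemLp.add hX hY
  zero_mem' := MemLp.zero
  smul_mem' c _ hX := MemLp.const_smul hX c

/-- The space of square-integrable random vectors, without identification of almost surely equal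
ones. -/
def SqInt (P : Measure Ω) (E : Type*) [NormedAddCommGroup E] [InnerProductSpace ℝ E] : Type _ :=
  squareIntegrable P E

namespace SqInt

noncomputable instance : AddCommGroup (SqInt P E) :=
  inferInstanceAs (AddCommGroup (squareIntegrable P E))

noncomputable instance : Module ℝ (SqInt P E) :=
  inferInstanceAs (Module ℝ (squareIntegrable P E))

/-- The inner product `E ⟪X, Y⟫`. -/
@[reducible]
noncomputable def core (P : Measure Ω) (E : Type*) [NormedAddCommGroup E] [InnerProductSpace ℝ E] :
    PreInnerProductSpace.Core ℝ (SqInt P E) where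
  inner X Y := ∫ ω, ⟪X.1 ω, Y.1 ω⟫ ∂P
  conj_inner_symm X Y := by
    simp only [conj_trivial]
    exact integral_congr_ae (.of_forall fun ω => real_inner_comm _ _)
  re_inner_nonneg X := by
    simp only [RCLike.re_to_real]
    exact integral_nonneg fun ω => real_inner_self_nonneg
  add_left X Y Z := by
    rw [← integral_add (integrable_inner_of_memLp X.2 Z.2) (integrable_inner_of_memLp Y.2 Z.2)]
    exact integral_congr_ae (.of_forall fun ω => inner_add_left _ _ _)
  smul_left X Y r := by
    simp only [conj_trivial]
    rw [← integral_const_mul]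
    exact integral_congr_ae (.of_forall fun ω => real_inner_smul_left _ _ _)

noncomputable instance : SeminormedAddCommGroup (SqInt P E) :=
  @InnerProductSpace.Core.toSeminormedAddCommGroup ℝ _ _ _ _ (core P E)

noncomputable instance : InnerProductSpace ℝ (SqInt P E) := InnerProductSpace.ofCore (core P E)

theorem inner_eq (X Y : SqInt P E) : ⟪X, Y⟫ = ∫ ω, ⟪X.1 ω, Y.1 ω⟫ ∂P := rfl

theorem norm_sq_eq (X : SqInt P E) : ‖X‖ ^ 2 = ∫ ω, ‖X.1 ω‖ ^ 2 ∂P := by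
  rw [← real_inner_self_eq_norm_sq, inner_eq]
  simp only [real_inner_self_eq_norm_sq]

theorem add_apply (X Y : SqInt P E) (ω : Ω) : (X + Y).1 ω = X.1 ω + Y.1 ω := rfl

theorem sub_apply (X Y : SqInt P E) (ω : Ω) : (X - Y).1 ω = X.1 ω - Y.1 ω := rfl

theorem smul_apply (c : ℝ) (X : SqInt P E) (ω : Ω) : (c • X).1 ω = c • X.1 ω := rfl

theorem sum_apply {ι : Type*} (s : Finset ι) (X : ι → SqInt P E) (ω : Ω) :
    (∑ i ∈ s, X i).1 ω = ∑ i ∈ s, (X i).1 ω := by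
  classical
  induction s using Finset.induction_on with
  | empty => rfl
  | insert i s hi ih => rw [Finset.sum_insert hi, Finset.sum_insert hi, add_apply, ih]

theorem stepMean_apply (K : ℕ) (X : ℕ → SqInt P E) (ω : Ω) :
    (stepMean K X).1 ω = stepMean K fun k => (X k).1 ω := by
  rw [stepMean, stepMean, smul_apply, sum_apply]

theorem clientMean_apply {n : ℕ} (X : Fin n → SqInt P E) (ω : Ω) :
    (clientMean X).1 ω = clientMean fun i => (X i).1 ω := by
  rw [clientMean, clientMean, smul_apply, sum_apply]

/-- A square-integrable random vector as an element of `SqInt`. -/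
def mk (X : Ω → E) (h : MemLp X 2 P) : SqInt P E := show squareIntegrable P E from ⟨X, h⟩

open Classical in
/-- A random vector as an element of `SqInt`; zero if it is not square-integrable. -/
noncomputable def of (P : Measure Ω) (X : Ω → E) : SqInt P E :=
  if h : MemLp X 2 P then mk X h else 0

theorem of_apply {X : Ω → E} (h : MemLp X 2 P) (ω : Ω) : (of P X).1 ω = X ω := by
  rw [of, dif_pos h]
  rfl

theorem norm_sq_of {X : Ω → E} (h : MemLp X 2 P) : ‖of P X‖ ^ 2 = ∫ ω, ‖X ω‖ ^ 2 ∂P := by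
  rw [norm_sq_eq]
  simp only [of_apply h]

theorem inner_of {X Y : Ω → E} (hX : MemLp X 2 P) (hY : MemLp Y 2 P) :
    ⟪of P X, of P Y⟫ = ∫ ω, ⟪X ω, Y ω⟫ ∂P := by
  rw [inner_eq]
  simp only [of_apply hX, of_apply hY]

theorem ext {X Y : SqInt P E} (h : ∀ ω, X.1 ω = Y.1 ω) : X = Y := Subtype.ext (funext h)

end SqInt

end SquareIntegrable

/-! ### Gradient noise at random points. -/

section Noise

open scoped RealInnerProductSpace

variable {Ω Ξ B E : Type*} {m : MeasurableSpace Ω} [mΩ : MeasurableSpace Ω]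
  [MeasurableSpace Ξ] [MeasurableSpace B]
  [NormedAddCommGroup E] [InnerProductSpace ℝ E] [MeasurableSpace E] [BorelSpace E]
  [SecondCountableTopology E] [CompleteSpace E] {P : Measure Ω} [IsProbabilityMeasure P]
  {ν : Measure Ξ} [IsProbabilityMeasure ν] {p : Ω → B} {ζ : Ω → Ξ} {G : B → Ξ → E} {g : B → E}
  {σ : ℝ}

/-- Independence makes the joint law of the point and the sample a product measure; the sample can
then be integrated out with the point frozen. -/
theorem lintegral_comp_of_indep (hm : m ≤ mΩ) (hp : Measurable[m] p)
    (hζ : Measurable ζ) (hind : Indep m (MeasurableSpace.comap ζ inferInstance) P)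
    (hν : P.map ζ = ν) {h : B × Ξ → ENNReal} (hh : Measurable h) :
    ∫⁻ ω, h (p ω, ζ ω) ∂P = ∫⁻ ω, ∫⁻ z, h (p ω, z) ∂ν ∂P := by
  have hp' : Measurable p := hp.mono hm le_rfl
  have hindf : IndepFun p ζ P := by
    rw [IndepFun_iff_Indep]
    exact indep_of_indep_of_le_left hind hp.comap_le
  have hmap := (indepFun_iff_map_prod_eq_prod_map_map hp'.aemeasurable hζ.aemeasurable).1 hindf
  rw [← lintegral_map (f := h) (g := fun ω => (p ω, ζ ω)) hh (hp'.prodMk hζ), hmap, hν,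
    lintegral_prod _ hh.aemeasurable, lintegral_map (hh.lintegral_prod_right') hp']

theorem integral_comp_of_indep (hm : m ≤ mΩ) (hp : Measurable[m] p)
    (hζ : Measurable ζ) (hind : Indep m (MeasurableSpace.comap ζ inferInstance) P)
    (hν : P.map ζ = ν) {h : B × Ξ → ℝ} (hh : Measurable h)
    (hint : Integrable (fun ω => h (p ω, ζ ω)) P) :
    ∫ ω, h (p ω, ζ ω) ∂P = ∫ ω, ∫ z, h (p ω, z) ∂ν ∂P := by
  have hp' : Measurable p := hp.mono hm le_rfl
  have hindf : IndepFun p ζ P := by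
    rw [IndepFun_iff_Indep]
    exact indep_of_indep_of_le_left hind hp.comap_le
  have hmap := (indepFun_iff_map_prod_eq_prod_map_map hp'.aemeasurable hζ.aemeasurable).1 hindf
  have hpz : Measurable fun ω => (p ω, ζ ω) := hp'.prodMk hζ
  have hint' : Integrable h ((P.map p).prod ν) := by
    rw [← hν, ← hmap]
    exact (integrable_map_measure hh.aestronglyMeasurable hpz.aemeasurable).2 hint
  rw [← integral_map (f := h) (φ := fun ω => (p ω, ζ ω)) hpz.aemeasurable
    hh.aestronglyMeasurable, hmap, hν, integral_prod _ hint', integral_map hp'.aemeasurable]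
  exact hh.stronglyMeasurable.integral_prod_right'.aestronglyMeasurable

omit [InnerProductSpace ℝ E] [CompleteSpace E] in
/-- The noise of a stochastic gradient at a random point that is independent of the sample has
the variance bound of the model. -/
theorem memLp_noise (hm : m ≤ mΩ) (hp : Measurable[m] p)
    (hζ : Measurable ζ) (hind : Indep m (MeasurableSpace.comap ζ inferInstance) P)
    (hν : P.map ζ = ν) (hG : Measurable fun q : B × Ξ => G q.1 q.2) (hg : Measurable g)
    (hL2 : ∀ b, MemLp (G b) 2 ν) (hvar : ∀ b, ∫ z, ‖G b z - g b‖ ^ 2 ∂ν ≤ σ ^ 2) :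
    MemLp (fun ω => G (p ω) (ζ ω) - g (p ω)) 2 P ∧
      ∫ ω, ‖G (p ω) (ζ ω) - g (p ω)‖ ^ 2 ∂P ≤ σ ^ 2 := by
  have hp' : Measurable p := hp.mono hm le_rfl
  have hmeas : Measurable fun q : B × Ξ => G q.1 q.2 - g q.1 := hG.sub (hg.comp measurable_fst)
  have hmeasΩ : Measurable fun ω => G (p ω) (ζ ω) - g (p ω) := hmeas.comp (hp'.prodMk hζ)
  have hb : ∀ b, ∫⁻ z, ENNReal.ofReal (‖G b z - g b‖ ^ 2) ∂ν ≤ ENNReal.ofReal (σ ^ 2) := by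
    intro b
    have hi : Integrable (fun z => ‖G b z - g b‖ ^ 2) ν :=
      integrable_norm_sq_of_memLp ((hL2 b).sub (memLp_const (g b)))
    rw [← ofReal_integral_eq_lintegral_ofReal hi (.of_forall fun _ => by positivity)]
    exact ENNReal.ofReal_le_ofReal (hvar b)
  have hle : ∫⁻ ω, ENNReal.ofReal (‖G (p ω) (ζ ω) - g (p ω)‖ ^ 2) ∂P ≤ ENNReal.ofReal (σ ^ 2) := by
    rw [lintegral_comp_of_indep hm hp hζ hind hν
      (h := fun q => ENNReal.ofReal (‖G q.1 q.2 - g q.1‖ ^ 2))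
      (hmeas.norm.pow_const 2).ennreal_ofReal]
    exact (lintegral_mono fun ω => hb (p ω)).trans (by simp)
  have hint : Integrable (fun ω => ‖G (p ω) (ζ ω) - g (p ω)‖ ^ 2) P := by
    refine ⟨(hmeasΩ.norm.pow_const 2).aestronglyMeasurable, ?_⟩
    rw [hasFiniteIntegral_iff_ofReal (.of_forall fun _ => by positivity)]
    exact hle.trans_lt ENNReal.ofReal_lt_top
  refine ⟨(memLp_two_iff_integrable_sq_norm hmeasΩ.aestronglyMeasurable).2 hint, ?_⟩
  rw [integral_eq_lintegral_of_nonneg_ae (.of_forall fun _ => by positivity) hint.1]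
  exact ENNReal.toReal_le_of_le_ofReal (sq_nonneg σ) hle

/-- The noise is orthogonal to everything independent of the sample. -/
theorem integral_inner_noise (hm : m ≤ mΩ) (hp : Measurable[m] p)
    (hζ : Measurable ζ) (hind : Indep m (MeasurableSpace.comap ζ inferInstance) P)
    (hν : P.map ζ = ν) (hG : Measurable fun q : B × Ξ => G q.1 q.2) (hg : Measurable g)
    (hL2 : ∀ b, MemLp (G b) 2 ν) (hvar : ∀ b, ∫ z, ‖G b z - g b‖ ^ 2 ∂ν ≤ σ ^ 2)
    (hmean : ∀ b, ∫ z, G b z ∂ν = g b) {W : Ω → E} (hW : Measurable[m] W) (hW2 : MemLp W 2 P) :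
    ∫ ω, ⟪W ω, G (p ω) (ζ ω) - g (p ω)⟫ ∂P = 0 := by
  have hint := integrable_inner_of_memLp hW2 (memLp_noise hm hp hζ hind hν hG hg hL2 hvar).1
  have hmeas : Measurable fun q : (E × B) × Ξ => ⟪q.1.1, G q.1.2 q.2 - g q.1.2⟫ := by
    refine Measurable.inner (by fun_prop) (Measurable.sub ?_ (by fun_prop))
    exact hG.comp (by fun_prop : Measurable fun q : (E × B) × Ξ => (q.1.2, q.2))
  -- The test vector `W` joins the random point, so both are frozen in the inner integral, which
  -- vanishes by unbiasedness.
  rw [integral_comp_of_indep hm (p := fun ω => (W ω, p ω)) (hW.prodMk hp) hζ hind hν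
    (h := fun q => ⟪q.1.1, G q.1.2 q.2 - g q.1.2⟫) hmeas hint]
  refine integral_eq_zero_of_ae (.of_forall fun ω => ?_)
  have h1 : Integrable (fun z => G (p ω) z - g (p ω)) ν :=
    ((hL2 (p ω)).integrable one_le_two).sub (integrable_const _)
  simp only [Pi.zero_apply]
  rw [integral_inner h1, integral_sub ((hL2 (p ω)).integrable one_le_two) (integrable_const _),
    hmean]
  simp

end Noise

/-! ### Expectation over the random set of clients. -/

section ClientSampling

variable {n m : ℕ} {Ω : Type*} {m' : MeasurableSpace Ω} [mΩ : MeasurableSpace Ω]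
  {P : Measure Ω} [IsProbabilityMeasure P] {s : Ω → Finset (Fin n)}

/-- The prescribed probabilities of the sets of size `m` already add up to `1`. -/
theorem ae_card_eq (hmn : m ≤ n) (hs : ∀ a : Finset (Fin n), MeasurableSet (s ⁻¹' {a}))
    (hlaw : ∀ a : Finset (Fin n), a.card = m → P (s ⁻¹' {a}) = ((n.choose m : ℕ) : ENNReal)⁻¹) :
    ∀ᵐ ω ∂P, (s ω).card = m := by
  have hc : ((n.choose m : ℕ) : ENNReal) ≠ 0 := by exact_mod_cast (Nat.choose_pos hmn).ne'
  have h1 : P (⋃ a ∈ Finset.powersetCard m (Finset.univ : Finset (Fin n)), s ⁻¹' {a}) = 1 := by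
    rw [measure_biUnion_finset (fun a _ b _ hab => Disjoint.preimage s (by simpa using hab))
      fun a _ => hs a, Finset.sum_congr rfl fun a ha => hlaw a (Finset.mem_powersetCard.1 ha).2]
    simp only [Finset.sum_const, Finset.card_powersetCard, Finset.card_univ, Fintype.card_fin,
      nsmul_eq_mul]
    exact ENNReal.mul_inv_cancel hc (by simp)
  have h2 := (prob_compl_eq_zero_iff (Finset.measurableSet_biUnion _ fun a _ => hs a)).2 h1
  refine measure_mono_null ?_ h2
  intro ω hω
  simp only [Set.mem_compl_iff, Set.mem_iUnion, not_exists]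
  rintro a ha rfl
  exact hω (Finset.mem_powersetCard.1 ha).2

/-- The expectation over an independent uniform set of `m` clients. -/
theorem integral_subsetAvg (hmn : m ≤ n)
    (hs : ∀ a : Finset (Fin n), MeasurableSet (s ⁻¹' {a}))
    (hlaw : ∀ a : Finset (Fin n), a.card = m → P (s ⁻¹' {a}) = ((n.choose m : ℕ) : ENNReal)⁻¹)
    (hind : Indep m' (MeasurableSpace.comap s ⊤) P) {ψ : Finset (Fin n) → Ω → ℝ}
    (hψ : ∀ a, Measurable[m'] (ψ a)) (hint : ∀ a, Integrable (ψ a) P) :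
    Integrable (fun ω => ψ (s ω) ω) P ∧
      ∫ ω, ψ (s ω) ω ∂P = ∫ ω, subsetAvg n m (fun a => ψ a ω) ∂P := by
  have hterm : ∀ a : Finset (Fin n), Integrable ((s ⁻¹' {a}).indicator (ψ a)) P :=
    fun a => (hint a).indicator (hs a)
  -- The probability space splits according to the finitely many values of `s`; by independence each
  -- piece contributes the probability of the value times the mean of `ψ a`.
  have hsum : (fun ω => ψ (s ω) ω) =
      fun ω => ∑ a : Finset (Fin n), (s ⁻¹' {a}).indicator (ψ a) ω := by
    funext ω
    rw [Finset.sum_eq_single (s ω)]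
    · simp
    · intro b _ hb
      exact Set.indicator_of_notMem (by simpa using hb.symm) _
    · simp
  have hinteg : Integrable (fun ω => ψ (s ω) ω) P := by
    rw [hsum]
    exact integrable_finsetSum _ fun a _ => hterm a
  refine ⟨hinteg, ?_⟩
  have hval : ∀ a : Finset (Fin n), ∫ ω, (s ⁻¹' {a}).indicator (ψ a) ω ∂P =
      P.real (s ⁻¹' {a}) * ∫ ω, ψ a ω ∂P := by
    intro a
    have hi : IndepFun (ψ a) ((s ⁻¹' {a}).indicator (fun _ => (1 : ℝ))) P := by
      rw [IndepFun_iff_Indep]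
      refine indep_of_indep_of_le_left (indep_of_indep_of_le_right hind ?_) (hψ a).comap_le
      refine Measurable.comap_le ?_
      refine (measurable_const (a := (1 : ℝ))).indicator ?_
      exact ⟨{a}, trivial, rfl⟩
    have h2 : (s ⁻¹' {a}).indicator (ψ a) =
        fun ω => ψ a ω * (s ⁻¹' {a}).indicator (fun _ => (1 : ℝ)) ω := by
      funext ω
      by_cases hω : ω ∈ s ⁻¹' {a} <;> simp [hω]
    rw [h2, hi.integral_fun_mul_eq_mul_integral (hint a).1
      ((aestronglyMeasurable_const.indicator (hs a)))]
    rw [integral_indicator_const _ (hs a)]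
    simp [mul_comm]
  have hzero : ∀ a : Finset (Fin n), a.card ≠ m → P.real (s ⁻¹' {a}) = 0 := by
    intro a ha
    have := ae_card_eq hmn hs hlaw
    rw [measureReal_eq_zero_iff]
    refine measure_mono_null ?_ this
    rintro ω rfl
    exact ha
  rw [hsum, integral_finsetSum _ fun a _ => hterm a]
  simp only [subsetAvg]
  rw [integral_const_mul, integral_finsetSum _ fun a _ => hint a, Finset.mul_sum]
  simp only [hval]
  rw [← Finset.sum_subset (Finset.subset_univ (Finset.powersetCard m Finset.univ))]
  · refine Finset.sum_congr rfl fun a ha => ?_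
    rw [measureReal_def, hlaw a (Finset.mem_powersetCard.1 ha).2]
    simp
  · intro a _ ha
    rw [hzero a (by simpa using ha), zero_mul]

omit [IsProbabilityMeasure P] in
theorem memLp_comp_clients {E : Type*} [NormedAddCommGroup E]
    (hs : ∀ a : Finset (Fin n), MeasurableSet (s ⁻¹' {a})) {ψ : Finset (Fin n) → Ω → E}
    (hψ : ∀ a, MemLp (ψ a) 2 P) : MemLp (fun ω => ψ (s ω) ω) 2 P := by
  have hsum : (fun ω => ψ (s ω) ω) =
      fun ω => ∑ a : Finset (Fin n), (s ⁻¹' {a}).indicator (ψ a) ω := by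
    funext ω
    rw [Finset.sum_eq_single (s ω)]
    · simp
    · intro b _ hb
      exact Set.indicator_of_notMem (by simpa using hb.symm) _
    · simp
  rw [hsum]
  exact memLp_finsetSum _ fun a _ => (hψ a).indicator (hs a)

omit mΩ in
theorem measurable_comp_clients {E : Type*} [MeasurableSpace E]
    (hs : ∀ a : Finset (Fin n), MeasurableSet[m'] (s ⁻¹' {a})) {ψ : Finset (Fin n) → Ω → E}
    (hψ : ∀ a, Measurable[m'] (ψ a)) : Measurable[m'] fun ω => ψ (s ω) ω := by
  intro A hA
  have : (fun ω => ψ (s ω) ω) ⁻¹' A = ⋃ a : Finset (Fin n), s ⁻¹' {a} ∩ ψ a ⁻¹' A := by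
    ext ω
    simp
  rw [this]
  exact MeasurableSet.iUnion fun a => (hs a).inter (hψ a hA)

end ClientSampling

/-! ### Measurability and integrability of the state. -/

section StateMeasurability

variable {n du dv : ℕ} {Ξ Ω : Type*} [MeasurableSpace Ξ] {F : Vec du → Vec dv → Ξ → ℝ}
  {K : ℕ} {γu γv ηu ηv : ℝ}

/-- All components of the random state `Y` are measurable. -/
structure MeasurableState (𝓕 : MeasurableSpace Ω) (Y : Ω → State n du dv) : Prop where
  u : Measurable[𝓕] fun ω => (Y ω).u
  v : ∀ i, Measurable[𝓕] fun ω => (Y ω).v i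
  c : ∀ i, Measurable[𝓕] fun ω => (Y ω).c i
  cbar : Measurable[𝓕] fun ω => (Y ω).cbar

theorem MeasurableState.mono {𝓕 𝓖 : MeasurableSpace Ω} {Y : Ω → State n du dv}
    (h : MeasurableState 𝓕 Y) (hle : 𝓕 ≤ 𝓖) : MeasurableState 𝓖 Y :=
  ⟨h.u.mono hle le_rfl, fun i => (h.v i).mono hle le_rfl, fun i => (h.c i).mono hle le_rfl,
    h.cbar.mono hle le_rfl⟩

/-- All components of the random state `Y` are square-integrable. -/
structure MemLpState [MeasurableSpace Ω] (P : Measure Ω) (Y : Ω → State n du dv) : Prop where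
  u : MemLp (fun ω => (Y ω).u) 2 P
  v : ∀ i, MemLp (fun ω => (Y ω).v i) 2 P
  c : ∀ i, MemLp (fun ω => (Y ω).c i) 2 P
  cbar : MemLp (fun ω => (Y ω).cbar) 2 P

theorem measurable_localIter {𝓕 : MeasurableSpace Ω} {Y : Ω → State n du dv} {i : Fin n}
    {z : ℕ → Ω → Ξ} {k : ℕ}
    (hU : Measurable fun p : Vec du × Vec dv × Ξ => stochGradU F p.1 p.2.1 p.2.2)
    (hV : Measurable fun p : Vec du × Vec dv × Ξ => stochGradV F p.1 p.2.1 p.2.2)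
    (hY : MeasurableState 𝓕 Y) (hz : ∀ l < k, Measurable[𝓕] (z l)) :
    Measurable[𝓕] fun ω => localIter F γu γv (Y ω) i (fun l => z l ω) k := by
  induction k with
  | zero => exact hY.u.prodMk (hY.v i)
  | succ k ih =>
    have h := ih fun l hl => hz l (by omega)
    have hp : Measurable[𝓕] fun ω => ((localIter F γu γv (Y ω) i (fun l => z l ω) k).1,
        (localIter F γu γv (Y ω) i (fun l => z l ω) k).2, z k ω) :=
      h.fst.prodMk (h.snd.prodMk (hz k (by omega)))
    exact (h.fst.sub ((((hU.comp hp).sub (hY.c i)).add hY.cbar).const_smul γu)).prodMk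
      (h.snd.sub ((hV.comp hp).const_smul γv))

theorem measurable_round {𝓕 : MeasurableSpace Ω} {Y : Ω → State n du dv}
    {z : Fin n → ℕ → Ω → Ξ} {m : ℕ}
    (hU : Measurable fun p : Vec du × Vec dv × Ξ => stochGradU F p.1 p.2.1 p.2.2)
    (hV : Measurable fun p : Vec du × Vec dv × Ξ => stochGradV F p.1 p.2.1 p.2.2)
    (hY : MeasurableState 𝓕 Y) (hz : ∀ i, ∀ l < K, Measurable[𝓕] (z i l))
    (s : Finset (Fin n)) :
    MeasurableState 𝓕 fun ω => round F m K γu γv ηu ηv s (fun i k => z i k ω) (Y ω) := by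
  have h : ∀ i, Measurable[𝓕] fun ω => localIter F γu γv (Y ω) i (fun l => z i l ω) K :=
    fun i => measurable_localIter hU hV hY (hz i)
  have hc : ∀ i, Measurable[𝓕] fun ω =>
      (round F m K γu γv ηu ηv s (fun i k => z i k ω) (Y ω)).c i := by
    intro i
    by_cases hi : i ∈ s
    · simp only [round, hi, if_true]
      have h1 : Measurable[𝓕] fun ω =>
          (Y ω).u - (localIter F γu γv (Y ω) i (fun l => z i l ω) K).1 :=
        hY.u.sub (h i).fst
      exact ((hY.c i).sub hY.cbar).add (h1.const_smul (1 / ((K : ℝ) * γu)))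
    · simpa only [round, hi, if_false] using hY.c i
  have hsum : Measurable[𝓕] fun ω =>
      ∑ i ∈ s, (localIter F γu γv (Y ω) i (fun l => z i l ω) K).1 :=
    Finset.measurable_fun_sum s fun i _ => (h i).fst
  have hcsum : Measurable[𝓕] fun ω => ∑ i ∈ s,
      ((round F m K γu γv ηu ηv s (fun i k => z i k ω) (Y ω)).c i - (Y ω).c i) :=
    Finset.measurable_fun_sum s fun i _ => (hc i).sub (hY.c i)
  refine ⟨(hY.u.const_smul (1 - ηu)).add (hsum.const_smul (ηu / (m : ℝ))), fun i => ?_, hc,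
    hY.cbar.add (hcsum.const_smul (1 / (n : ℝ)))⟩
  by_cases hi : i ∈ s
  · simp only [round, hi, if_true]
    exact ((hY.v i).const_smul (1 - ηv)).add ((h i).snd.const_smul ηv)
  · simpa only [round, hi, if_false] using hY.v i

omit [MeasurableSpace Ξ] in
theorem memLp_round [MeasurableSpace Ω] {P : Measure Ω} {Y : Ω → State n du dv}
    {z : Fin n → ℕ → Ω → Ξ} {m : ℕ} (hY : MemLpState P Y)
    (h : ∀ i, MemLp (fun ω => (localIter F γu γv (Y ω) i (fun l => z i l ω) K).1) 2 P)
    (h' : ∀ i, MemLp (fun ω => (localIter F γu γv (Y ω) i (fun l => z i l ω) K).2) 2 P)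
    (s : Finset (Fin n)) :
    MemLpState P fun ω => round F m K γu γv ηu ηv s (fun i k => z i k ω) (Y ω) := by
  have hc : ∀ i, MemLp (fun ω =>
      (round F m K γu γv ηu ηv s (fun i k => z i k ω) (Y ω)).c i) 2 P := by
    intro i
    by_cases hi : i ∈ s
    · simp only [round, hi, if_true]
      have h1 : MemLp (fun ω => (Y ω).u - (localIter F γu γv (Y ω) i (fun l => z i l ω) K).1) 2 P :=
        hY.u.sub (h i)
      exact ((hY.c i).sub hY.cbar).add (h1.const_smul (1 / ((K : ℝ) * γu)))
    · simpa only [round, hi, if_false] using hY.c i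
  have hsum : MemLp (fun ω => ∑ i ∈ s, (localIter F γu γv (Y ω) i (fun l => z i l ω) K).1) 2 P :=
    memLp_finsetSum s fun i _ => h i
  have hcsum : MemLp (fun ω => ∑ i ∈ s,
      ((round F m K γu γv ηu ηv s (fun i k => z i k ω) (Y ω)).c i - (Y ω).c i)) 2 P :=
    memLp_finsetSum s fun i _ => (hc i).sub (hY.c i)
  refine ⟨(hY.u.const_smul (1 - ηu)).add (hsum.const_smul (ηu / (m : ℝ))), fun i => ?_, hc,
    hY.cbar.add (hcsum.const_smul (1 / (n : ℝ)))⟩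
  by_cases hi : i ∈ s
  · simp only [round, hi, if_true]
    exact ((hY.v i).const_smul (1 - ηv)).add ((h' i).const_smul ηv)
  · simpa only [round, hi, if_false] using hY.v i

end StateMeasurability

/-! ### Filtrations within a round and orthogonality of the noise. -/

section RoundSetting

open scoped RealInnerProductSpace

variable {n du dv : ℕ} {Ξ Ω : Type*} {𝓟 : MeasurableSpace Ω}
  {𝓛 𝓔 : Fin n → ℕ → MeasurableSpace Ω} [MeasurableSpace Ξ] [mΩ : MeasurableSpace Ω]

/-- The random state `Y` at the beginning of a round, with its past `𝓟`, and the samples `z i k` of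
the round: `𝓛 i k` contains the information used by client `i` in its first `k` local steps, and
`𝓔 i k` everything that is independent of the sample `z i k`. -/
structure RoundSetting (𝓟 : MeasurableSpace Ω) (𝓛 𝓔 : Fin n → ℕ → MeasurableSpace Ω)
    [mΩ : MeasurableSpace Ω] (P : Measure Ω) (D : Fin n → Measure Ξ) (K : ℕ)
    (Y : Ω → State n du dv) (z : Fin n → ℕ → Ω → Ξ) : Prop where
  past_le : ∀ i k, 𝓟 ≤ 𝓛 i k
  mono : ∀ i, Monotone (𝓛 i)
  le_except : ∀ i j k l, i ≠ j ∨ k ≤ l → 𝓛 i k ≤ 𝓔 j l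
  except_le : ∀ i k, 𝓔 i k ≤ mΩ
  measurable_sample : ∀ i, ∀ k < K, Measurable[𝓛 i (k + 1)] (z i k)
  law : ∀ i, ∀ k < K, P.map (z i k) = D i
  indep : ∀ i, ∀ k < K, Indep (𝓔 i k) (MeasurableSpace.comap (z i k) inferInstance) P
  measurable_state : MeasurableState 𝓟 Y
  memLp_state : MemLpState P Y

/-- The `k`-th local iterate of client `i`. -/
noncomputable def localPoint (F : Vec du → Vec dv → Ξ → ℝ) (γu γv : ℝ) (Y : Ω → State n du dv)
    (z : Fin n → ℕ → Ω → Ξ) (i : Fin n) (k : ℕ) (ω : Ω) : Vec du × Vec dv :=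
  localIter F γu γv (Y ω) i (fun l => z i l ω) k

/-- The noise of the stochastic gradient `∇_u F` in step `k` of client `i`. -/
noncomputable def noiseU (F : Vec du → Vec dv → Ξ → ℝ) (D : Fin n → Measure Ξ) (γu γv : ℝ)
    (Y : Ω → State n du dv) (z : Fin n → ℕ → Ω → Ξ) (i : Fin n) (k : ℕ) (ω : Ω) : Vec du :=
  stochGradU F (localPoint F γu γv Y z i k ω).1 (localPoint F γu γv Y z i k ω).2 (z i k ω) -
    gradU (clientLoss F D i) (localPoint F γu γv Y z i k ω).1 (localPoint F γu γv Y z i k ω).2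

/-- The noise of the stochastic gradient `∇_v F` in step `k` of client `i`. -/
noncomputable def noiseV (F : Vec du → Vec dv → Ξ → ℝ) (D : Fin n → Measure Ξ) (γu γv : ℝ)
    (Y : Ω → State n du dv) (z : Fin n → ℕ → Ω → Ξ) (i : Fin n) (k : ℕ) (ω : Ω) : Vec dv :=
  stochGradV F (localPoint F γu γv Y z i k ω).1 (localPoint F γu γv Y z i k ω).2 (z i k ω) -
    gradV (clientLoss F D i) (localPoint F γu γv Y z i k ω).1 (localPoint F γu γv Y z i k ω).2

variable {P : Measure Ω} [IsProbabilityMeasure P] {D : Fin n → Measure Ξ}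
  {F : Vec du → Vec dv → Ξ → ℝ} {K : ℕ}
  {Lu Luv Lv Lvu : ℝ≥0} {L σu σv γu γv : ℝ} {Y : Ω → State n du dv} {z : Fin n → ℕ → Ω → Ξ}

/-- A Lipschitz map grows at most linearly. -/
theorem memLp_of_norm_sub_le {E₁ E₂ E₃ : Type*} [NormedAddCommGroup E₁] [NormedAddCommGroup E₂]
    [NormedAddCommGroup E₃] {g : E₁ → E₂ → E₃} {L : ℝ}
    (hg : ∀ u u' v v', ‖g u v - g u' v'‖ ≤ L * (‖u - u'‖ + ‖v - v'‖)) {U : Ω → E₁} {V : Ω → E₂}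
    (hU : MemLp U 2 P) (hV : MemLp V 2 P) : MemLp (fun ω => g (U ω) (V ω)) 2 P := by
  have hb : MemLp (fun ω => ‖g 0 0‖ + |L| * (‖U ω‖ + ‖V ω‖)) 2 P :=
    (memLp_const ‖g 0 0‖).add ((hU.norm.add hV.norm).const_mul |L|)
  refine hb.mono' ?_ (.of_forall fun ω => ?_)
  · exact (continuous_of_norm_sub_le hg).comp_aestronglyMeasurable (hU.1.prodMk hV.1)
  · have h1 := hg (U ω) 0 (V ω) 0
    rw [sub_zero, sub_zero] at h1
    have h2 : L * (‖U ω‖ + ‖V ω‖) ≤ |L| * (‖U ω‖ + ‖V ω‖) := by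
      gcongr
      exact le_abs_self L
    have h3 := norm_sub_norm_le (g (U ω) (V ω)) (g 0 0)
    linarith

theorem measurable_gradU (hf : Smooth (clientLoss F D) Lu Luv Lv Lvu) (i : Fin n) :
    Measurable fun p : Vec du × Vec dv => gradU (clientLoss F D i) p.1 p.2 :=
  (continuous_of_norm_sub_le fun u u' v v' => norm_gradU_sub_le hf rfl i u u' v v').measurable

theorem measurable_gradV (hf : Smooth (clientLoss F D) Lu Luv Lv Lvu) (i : Fin n) :
    Measurable fun p : Vec du × Vec dv => gradV (clientLoss F D i) p.1 p.2 :=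
  (continuous_of_norm_sub_le fun u u' v v' => norm_gradV_sub_le hf rfl i u u' v v').measurable

theorem memLp_gradU (hf : Smooth (clientLoss F D) Lu Luv Lv Lvu) (i : Fin n) {U : Ω → Vec du}
    {V : Ω → Vec dv} (hU : MemLp U 2 P) (hV : MemLp V 2 P) :
    MemLp (fun ω => gradU (clientLoss F D i) (U ω) (V ω)) 2 P :=
  memLp_of_norm_sub_le (fun u u' v v' => norm_gradU_sub_le hf rfl i u u' v v') hU hV

theorem memLp_gradV (hf : Smooth (clientLoss F D) Lu Luv Lv Lvu) (i : Fin n) {U : Ω → Vec du}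
    {V : Ω → Vec dv} (hU : MemLp U 2 P) (hV : MemLp V 2 P) :
    MemLp (fun ω => gradV (clientLoss F D i) (U ω) (V ω)) 2 P :=
  memLp_of_norm_sub_le (fun u u' v v' => norm_gradV_sub_le hf rfl i u u' v v') hU hV

namespace RoundSetting

variable [∀ i, IsProbabilityMeasure (D i)] (h : RoundSetting 𝓟 𝓛 𝓔 P D K Y z)

include h

omit [IsProbabilityMeasure P] [∀ i, IsProbabilityMeasure (D i)] in
theorem past_le_except (i : Fin n) (k : ℕ) : 𝓟 ≤ 𝓔 i k :=
  (h.past_le i 0).trans (h.le_except i i 0 k (Or.inr (Nat.zero_le k)))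

omit [IsProbabilityMeasure P] [∀ i, IsProbabilityMeasure (D i)] in
theorem local_le_top (i : Fin n) (k : ℕ) : 𝓛 i k ≤ mΩ :=
  (h.le_except i i k k (Or.inr le_rfl)).trans (h.except_le i k)

omit [IsProbabilityMeasure P] [∀ i, IsProbabilityMeasure (D i)] in
theorem measurable_localPoint (hF : StochasticGradient F D σu σv) (i : Fin n) {k : ℕ}
    (hk : k ≤ K) : Measurable[𝓛 i k] (localPoint F γu γv Y z i k) :=
  measurable_localIter hF.measurableU hF.measurableV (h.measurable_state.mono (h.past_le i k))
    fun l hl => (h.measurable_sample i l (by omega)).mono (h.mono i hl) le_rfl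

omit [IsProbabilityMeasure P] [∀ i, IsProbabilityMeasure (D i)] in
theorem measurable_noiseU (hF : StochasticGradient F D σu σv)
    (hf : Smooth (clientLoss F D) Lu Luv Lv Lvu) (i : Fin n) {k : ℕ} (hk : k < K) :
    Measurable[𝓛 i (k + 1)] (noiseU F D γu γv Y z i k) := by
  have hp := (h.measurable_localPoint (γu := γu) (γv := γv) hF i hk.le).mono
    (h.mono i (Nat.le_succ k)) le_rfl
  exact (hF.measurableU.comp (hp.fst.prodMk (hp.snd.prodMk (h.measurable_sample i k hk)))).sub
    ((measurable_gradU hf i).comp hp)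

omit [IsProbabilityMeasure P] [∀ i, IsProbabilityMeasure (D i)] in
theorem measurable_noiseV (hF : StochasticGradient F D σu σv)
    (hf : Smooth (clientLoss F D) Lu Luv Lv Lvu) (i : Fin n) {k : ℕ} (hk : k < K) :
    Measurable[𝓛 i (k + 1)] (noiseV F D γu γv Y z i k) := by
  have hp := (h.measurable_localPoint (γu := γu) (γv := γv) hF i hk.le).mono
    (h.mono i (Nat.le_succ k)) le_rfl
  exact (hF.measurableV.comp (hp.fst.prodMk (hp.snd.prodMk (h.measurable_sample i k hk)))).sub
    ((measurable_gradV hf i).comp hp)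

theorem memLp_noiseU (hF : StochasticGradient F D σu σv)
    (hf : Smooth (clientLoss F D) Lu Luv Lv Lvu) (i : Fin n) {k : ℕ} (hk : k < K) :
    MemLp (noiseU F D γu γv Y z i k) 2 P ∧
      ∫ ω, ‖noiseU F D γu γv Y z i k ω‖ ^ 2 ∂P ≤ σu ^ 2 :=
  memLp_noise (G := fun p : Vec du × Vec dv => stochGradU F p.1 p.2)
    (g := fun p => gradU (clientLoss F D i) p.1 p.2) (h.except_le i k)
    ((h.measurable_localPoint hF i hk.le).mono (h.le_except i i k k (Or.inr le_rfl)) le_rfl)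
    ((h.measurable_sample i k hk).mono (h.local_le_top i _) le_rfl) (h.indep i k hk) (h.law i k hk)
    (hF.measurableU.comp (by fun_prop : Measurable fun q : (Vec du × Vec dv) × Ξ =>
      (q.1.1, q.1.2, q.2))) (measurable_gradU hf i) (fun p => hF.memLpU i p.1 p.2)
    (fun p => hF.varianceU i p.1 p.2)

theorem memLp_noiseV (hF : StochasticGradient F D σu σv)
    (hf : Smooth (clientLoss F D) Lu Luv Lv Lvu) (i : Fin n) {k : ℕ} (hk : k < K) :
    MemLp (noiseV F D γu γv Y z i k) 2 P ∧
      ∫ ω, ‖noiseV F D γu γv Y z i k ω‖ ^ 2 ∂P ≤ σv ^ 2 :=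
  memLp_noise (G := fun p : Vec du × Vec dv => stochGradV F p.1 p.2)
    (g := fun p => gradV (clientLoss F D i) p.1 p.2) (h.except_le i k)
    ((h.measurable_localPoint hF i hk.le).mono (h.le_except i i k k (Or.inr le_rfl)) le_rfl)
    ((h.measurable_sample i k hk).mono (h.local_le_top i _) le_rfl) (h.indep i k hk) (h.law i k hk)
    (hF.measurableV.comp (by fun_prop : Measurable fun q : (Vec du × Vec dv) × Ξ =>
      (q.1.1, q.1.2, q.2))) (measurable_gradV hf i) (fun p => hF.memLpV i p.1 p.2)
    (fun p => hF.varianceV i p.1 p.2)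

theorem integral_inner_noiseU (hF : StochasticGradient F D σu σv)
    (hf : Smooth (clientLoss F D) Lu Luv Lv Lvu) (i : Fin n) {k : ℕ} (hk : k < K)
    {W : Ω → Vec du} (hW : Measurable[𝓔 i k] W) (hW2 : MemLp W 2 P) :
    ∫ ω, ⟪W ω, noiseU F D γu γv Y z i k ω⟫ ∂P = 0 :=
  integral_inner_noise (G := fun p : Vec du × Vec dv => stochGradU F p.1 p.2)
    (g := fun p => gradU (clientLoss F D i) p.1 p.2) (h.except_le i k)
    ((h.measurable_localPoint hF i hk.le).mono (h.le_except i i k k (Or.inr le_rfl)) le_rfl)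
    ((h.measurable_sample i k hk).mono (h.local_le_top i _) le_rfl) (h.indep i k hk) (h.law i k hk)
    (hF.measurableU.comp (by fun_prop : Measurable fun q : (Vec du × Vec dv) × Ξ =>
      (q.1.1, q.1.2, q.2))) (measurable_gradU hf i) (fun p => hF.memLpU i p.1 p.2)
    (fun p => hF.varianceU i p.1 p.2) (fun p => hF.unbiasedU i p.1 p.2) hW hW2

theorem integral_inner_noiseV (hF : StochasticGradient F D σu σv)
    (hf : Smooth (clientLoss F D) Lu Luv Lv Lvu) (i : Fin n) {k : ℕ} (hk : k < K)
    {W : Ω → Vec dv} (hW : Measurable[𝓔 i k] W) (hW2 : MemLp W 2 P) :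
    ∫ ω, ⟪W ω, noiseV F D γu γv Y z i k ω⟫ ∂P = 0 :=
  integral_inner_noise (G := fun p : Vec du × Vec dv => stochGradV F p.1 p.2)
    (g := fun p => gradV (clientLoss F D i) p.1 p.2) (h.except_le i k)
    ((h.measurable_localPoint hF i hk.le).mono (h.le_except i i k k (Or.inr le_rfl)) le_rfl)
    ((h.measurable_sample i k hk).mono (h.local_le_top i _) le_rfl) (h.indep i k hk) (h.law i k hk)
    (hF.measurableV.comp (by fun_prop : Measurable fun q : (Vec du × Vec dv) × Ξ =>
      (q.1.1, q.1.2, q.2))) (measurable_gradV hf i) (fun p => hF.memLpV i p.1 p.2)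
    (fun p => hF.varianceV i p.1 p.2) (fun p => hF.unbiasedV i p.1 p.2) hW hW2

/-- Induction on the step. The noise is square-integrable at any admissible random point, so only
the true gradients need the integrability of the previous iterate. -/
theorem memLp_localPoint (hF : StochasticGradient F D σu σv)
    (hf : Smooth (clientLoss F D) Lu Luv Lv Lvu) (i : Fin n) {k : ℕ} (hk : k ≤ K) :
    MemLp (fun ω => (localPoint F γu γv Y z i k ω).1) 2 P ∧
      MemLp (fun ω => (localPoint F γu γv Y z i k ω).2) 2 P := by
  induction k with
  | zero => exact ⟨h.memLp_state.u, h.memLp_state.v i⟩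
  | succ k ih =>
    obtain ⟨h1, h2⟩ := ih (by omega)
    have hN := (h.memLp_noiseU (γu := γu) (γv := γv) hF hf i hk).1
    have hNv := (h.memLp_noiseV (γu := γu) (γv := γv) hF hf i hk).1
    have hg := hN.add (memLp_gradU hf i h1 h2)
    have hgv := hNv.add (memLp_gradV hf i h1 h2)
    have e1 : (fun ω => (localPoint F γu γv Y z i (k + 1) ω).1) = fun ω =>
        (localPoint F γu γv Y z i k ω).1 - γu • ((noiseU F D γu γv Y z i k ω +
          gradU (clientLoss F D i) (localPoint F γu γv Y z i k ω).1
            (localPoint F γu γv Y z i k ω).2) - (Y ω).c i + (Y ω).cbar) := by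
      funext ω
      rw [noiseU, sub_add_cancel]
      rfl
    have e2 : (fun ω => (localPoint F γu γv Y z i (k + 1) ω).2) = fun ω =>
        (localPoint F γu γv Y z i k ω).2 - γv • (noiseV F D γu γv Y z i k ω +
          gradV (clientLoss F D i) (localPoint F γu γv Y z i k ω).1
            (localPoint F γu γv Y z i k ω).2) := by
      funext ω
      rw [noiseV, sub_add_cancel]
      rfl
    rw [e1, e2]
    exact ⟨h1.sub (((hg.sub (h.memLp_state.c i)).add h.memLp_state.cbar).const_smul γu),
      h2.sub (hgv.const_smul γv)⟩

/-- Of two distinct noises, one is always known without the sample of the other: for different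
clients either one, for the same client the earlier one. -/
theorem orthogonal_noiseU (hF : StochasticGradient F D σu σv)
    (hf : Smooth (clientLoss F D) Lu Luv Lv Lvu) (i j : Fin n) {k l : ℕ} (hk : k < K) (hl : l < K)
    (hne : (i, k) ≠ (j, l)) :
    ⟪SqInt.of P (noiseU F D γu γv Y z i k), SqInt.of P (noiseU F D γu γv Y z j l)⟫ = 0 := by
  have aux : ∀ (i j : Fin n) {k l : ℕ}, k < K → l < K → (i ≠ j ∨ k < l) →
      ⟪SqInt.of P (noiseU F D γu γv Y z i k), SqInt.of P (noiseU F D γu γv Y z j l)⟫ = 0 := by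
    intro i j k l hk hl hc
    rw [SqInt.inner_of (h.memLp_noiseU hF hf i hk).1 (h.memLp_noiseU hF hf j hl).1]
    exact h.integral_inner_noiseU hF hf j hl ((h.measurable_noiseU hF hf i hk).mono
      (h.le_except i j (k + 1) l hc) le_rfl) (h.memLp_noiseU hF hf i hk).1
  by_cases hij : i = j
  · subst hij
    rcases lt_or_gt_of_ne (fun e => hne (by rw [e]) : k ≠ l) with hkl | hkl
    · exact aux i i hk hl (Or.inr hkl)
    · rw [real_inner_comm]
      exact aux i i hl hk (Or.inr hkl)
  · exact aux i j hk hl (Or.inl hij)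

theorem orthogonal_noiseV (hF : StochasticGradient F D σu σv)
    (hf : Smooth (clientLoss F D) Lu Luv Lv Lvu) (i : Fin n) {k l : ℕ} (hk : k < K) (hl : l < K)
    (hne : k ≠ l) :
    ⟪SqInt.of P (noiseV F D γu γv Y z i k), SqInt.of P (noiseV F D γu γv Y z i l)⟫ = 0 := by
  have aux : ∀ {k l : ℕ}, k < K → l < K → k < l →
      ⟪SqInt.of P (noiseV F D γu γv Y z i k), SqInt.of P (noiseV F D γu γv Y z i l)⟫ = 0 := by
    intro k l hk hl hc
    rw [SqInt.inner_of (h.memLp_noiseV hF hf i hk).1 (h.memLp_noiseV hF hf i hl).1]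
    exact h.integral_inner_noiseV hF hf i hl ((h.measurable_noiseV hF hf i hk).mono
      (h.le_except i i (k + 1) l (Or.inr hc)) le_rfl) (h.memLp_noiseV hF hf i hk).1
  rcases lt_or_gt_of_ne hne with hkl | hkl
  · exact aux hk hl hkl
  · rw [real_inner_comm]
    exact aux hl hk hkl

theorem orthogonal_past_noiseU (hF : StochasticGradient F D σu σv)
    (hf : Smooth (clientLoss F D) Lu Luv Lv Lvu) {W : Ω → Vec du} (hW : Measurable[𝓟] W)
    (hW2 : MemLp W 2 P) (i : Fin n) {k : ℕ} (hk : k < K) :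
    ⟪SqInt.of P W, SqInt.of P (noiseU F D γu γv Y z i k)⟫ = 0 := by
  rw [SqInt.inner_of hW2 (h.memLp_noiseU hF hf i hk).1]
  exact h.integral_inner_noiseU hF hf i hk (hW.mono (h.past_le_except i k) le_rfl) hW2

theorem orthogonal_past_noiseV (hF : StochasticGradient F D σu σv)
    (hf : Smooth (clientLoss F D) Lu Luv Lv Lvu) {W : Ω → Vec dv} (hW : Measurable[𝓟] W)
    (hW2 : MemLp W 2 P) (i : Fin n) {k : ℕ} (hk : k < K) :
    ⟪SqInt.of P W, SqInt.of P (noiseV F D γu γv Y z i k)⟫ = 0 := by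
  rw [SqInt.inner_of hW2 (h.memLp_noiseV hF hf i hk).1]
  exact h.integral_inner_noiseV hF hf i hk (hW.mono (h.past_le_except i k) le_rfl) hW2

end RoundSetting

end RoundSetting

/-! ### The random vectors of a round as a `LocalModel`. -/

section RoundModel

open scoped RealInnerProductSpace

variable {n du dv : ℕ} {Ξ Ω : Type*} {𝓟 𝓜 : MeasurableSpace Ω}
  {𝓛 𝓔 : Fin n → ℕ → MeasurableSpace Ω} [MeasurableSpace Ξ] [mΩ : MeasurableSpace Ω]

/-- `∇_u f_i` at the beginning of the round. -/
noncomputable def startGradU (P : Measure Ω) (F : Vec du → Vec dv → Ξ → ℝ) (D : Fin n → Measure Ξ)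
    (Y : Ω → State n du dv) (i : Fin n) : SqInt P (Vec du) :=
  .of P fun ω => gradU (clientLoss F D i) (Y ω).u ((Y ω).v i)

/-- `∇_v f_i` at the beginning of the round. -/
noncomputable def startGradV (P : Measure Ω) (F : Vec du → Vec dv → Ξ → ℝ) (D : Fin n → Measure Ξ)
    (Y : Ω → State n du dv) (i : Fin n) : SqInt P (Vec dv) :=
  .of P fun ω => gradV (clientLoss F D i) (Y ω).u ((Y ω).v i)

/-- The control variable of client `i` at the beginning of the round. -/
noncomputable def startControl (P : Measure Ω) (Y : Ω → State n du dv) (i : Fin n) :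
    SqInt P (Vec du) :=
  .of P fun ω => (Y ω).c i

/-- `∇_u f_i` at the local iterates. -/
noncomputable def localGradU (P : Measure Ω) (F : Vec du → Vec dv → Ξ → ℝ) (D : Fin n → Measure Ξ)
    (γu γv : ℝ) (Y : Ω → State n du dv) (z : Fin n → ℕ → Ω → Ξ) (i : Fin n) (k : ℕ) :
    SqInt P (Vec du) :=
  .of P fun ω => gradU (clientLoss F D i) (localPoint F γu γv Y z i k ω).1
    (localPoint F γu γv Y z i k ω).2

/-- `∇_v f_i` at the local iterates. -/
noncomputable def localGradV (P : Measure Ω) (F : Vec du → Vec dv → Ξ → ℝ) (D : Fin n → Measure Ξ)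
    (γu γv : ℝ) (Y : Ω → State n du dv) (z : Fin n → ℕ → Ω → Ξ) (i : Fin n) (k : ℕ) :
    SqInt P (Vec dv) :=
  .of P fun ω => gradV (clientLoss F D i) (localPoint F γu γv Y z i k ω).1
    (localPoint F γu γv Y z i k ω).2

/-- The displacement of the local iterates of the shared variable. -/
noncomputable def shiftU (P : Measure Ω) (F : Vec du → Vec dv → Ξ → ℝ) (γu γv : ℝ)
    (Y : Ω → State n du dv) (z : Fin n → ℕ → Ω → Ξ) (i : Fin n) (k : ℕ) : SqInt P (Vec du) :=
  .of P fun ω => (localPoint F γu γv Y z i k ω).1 - (Y ω).u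

/-- The displacement of the local iterates of the personal variable. -/
noncomputable def shiftV (P : Measure Ω) (F : Vec du → Vec dv → Ξ → ℝ) (γu γv : ℝ)
    (Y : Ω → State n du dv) (z : Fin n → ℕ → Ω → Ξ) (i : Fin n) (k : ℕ) : SqInt P (Vec dv) :=
  .of P fun ω => (localPoint F γu γv Y z i k ω).2 - (Y ω).v i

variable {P : Measure Ω} [IsProbabilityMeasure P] {D : Fin n → Measure Ξ}
  [∀ i, IsProbabilityMeasure (D i)] {F : Vec du → Vec dv → Ξ → ℝ} {m K : ℕ}
  {Lu Luv Lv Lvu : ℝ≥0} {L σu σv γu γv ηu ηv γ : ℝ} {Y : Ω → State n du dv}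
  {z : Fin n → ℕ → Ω → Ξ}

omit [IsProbabilityMeasure P] in
theorem SqInt.integrable_norm_sq {E : Type*} [NormedAddCommGroup E] [InnerProductSpace ℝ E]
    (X : SqInt P E) : Integrable (fun ω => ‖X.1 ω‖ ^ 2) P :=
  integrable_norm_sq_of_memLp X.2

omit [IsProbabilityMeasure P] in
theorem SqInt.integrable_inner {E : Type*} [NormedAddCommGroup E] [InnerProductSpace ℝ E]
    (X Y : SqInt P E) : Integrable (fun ω => ⟪X.1 ω, Y.1 ω⟫) P :=
  integrable_inner_of_memLp X.2 Y.2

omit [IsProbabilityMeasure P] in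
theorem SqInt.norm_sq_le_of_forall {E E₁ E₂ : Type*} [NormedAddCommGroup E]
    [InnerProductSpace ℝ E] [NormedAddCommGroup E₁] [InnerProductSpace ℝ E₁]
    [NormedAddCommGroup E₂] [InnerProductSpace ℝ E₂] {X : SqInt P E} {X₁ : SqInt P E₁}
    {X₂ : SqInt P E₂} {c : ℝ} (h : ∀ ω, ‖X.1 ω‖ ≤ c * (‖X₁.1 ω‖ + ‖X₂.1 ω‖)) :
    ‖X‖ ^ 2 ≤ 2 * c ^ 2 * (‖X₁‖ ^ 2 + ‖X₂‖ ^ 2) := by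
  rw [SqInt.norm_sq_eq, SqInt.norm_sq_eq, SqInt.norm_sq_eq,
    ← integral_add X₁.integrable_norm_sq X₂.integrable_norm_sq, ← integral_const_mul]
  refine integral_mono X.integrable_norm_sq
    ((X₁.integrable_norm_sq.add X₂.integrable_norm_sq).const_mul _) fun ω => ?_
  calc ‖X.1 ω‖ ^ 2 ≤ (c * (‖X₁.1 ω‖ + ‖X₂.1 ω‖)) ^ 2 := by gcongr; exact h ω
    _ = c ^ 2 * (‖X₁.1 ω‖ + ‖X₂.1 ω‖) ^ 2 := by ring
    _ ≤ c ^ 2 * (2 * (‖X₁.1 ω‖ ^ 2 + ‖X₂.1 ω‖ ^ 2)) := by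
        gcongr
        exact add_sq_le
    _ = _ := by ring

omit [IsProbabilityMeasure P] in
theorem SqInt.norm_sq_le_mul_of_forall {E E₁ : Type*} [NormedAddCommGroup E]
    [InnerProductSpace ℝ E] [NormedAddCommGroup E₁] [InnerProductSpace ℝ E₁]
    {X : SqInt P E} {X₁ : SqInt P E₁} {c : ℝ} (h : ∀ ω, ‖X.1 ω‖ ≤ c * ‖X₁.1 ω‖) :
    ‖X‖ ^ 2 ≤ c ^ 2 * ‖X₁‖ ^ 2 := by
  rw [SqInt.norm_sq_eq, SqInt.norm_sq_eq, ← integral_const_mul]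
  refine integral_mono X.integrable_norm_sq (X₁.integrable_norm_sq.const_mul _) fun ω => ?_
  calc ‖X.1 ω‖ ^ 2 ≤ (c * ‖X₁.1 ω‖) ^ 2 := by gcongr; exact h ω
    _ = _ := by ring

namespace RoundSetting

variable (h : RoundSetting 𝓟 𝓛 𝓔 P D K Y z)

include h

omit [∀ i, IsProbabilityMeasure (D i)] in
theorem startGradU_apply (hf : Smooth (clientLoss F D) Lu Luv Lv Lvu) (i : Fin n) (ω : Ω) :
    (startGradU P F D Y i).1 ω = gradU (clientLoss F D i) (Y ω).u ((Y ω).v i) :=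
  SqInt.of_apply (memLp_gradU hf i h.memLp_state.u (h.memLp_state.v i)) ω

omit [∀ i, IsProbabilityMeasure (D i)] in
theorem startGradV_apply (hf : Smooth (clientLoss F D) Lu Luv Lv Lvu) (i : Fin n) (ω : Ω) :
    (startGradV P F D Y i).1 ω = gradV (clientLoss F D i) (Y ω).u ((Y ω).v i) :=
  SqInt.of_apply (memLp_gradV hf i h.memLp_state.u (h.memLp_state.v i)) ω

omit [IsProbabilityMeasure P] [∀ i, IsProbabilityMeasure (D i)] in
theorem startControl_apply (i : Fin n) (ω : Ω) : (startControl P Y i).1 ω = (Y ω).c i :=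
  SqInt.of_apply (h.memLp_state.c i) ω

variable (hF : StochasticGradient F D σu σv) (hf : Smooth (clientLoss F D) Lu Luv Lv Lvu)

include hF hf

theorem localGradU_apply (i : Fin n) {k : ℕ} (hk : k < K) (ω : Ω) :
    (localGradU P F D γu γv Y z i k).1 ω = gradU (clientLoss F D i)
      (localPoint F γu γv Y z i k ω).1 (localPoint F γu γv Y z i k ω).2 := by
  obtain ⟨h1, h2⟩ := h.memLp_localPoint (γu := γu) (γv := γv) hF hf i hk.le
  exact SqInt.of_apply (memLp_gradU hf i h1 h2) ω

theorem localGradV_apply (i : Fin n) {k : ℕ} (hk : k < K) (ω : Ω) :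
    (localGradV P F D γu γv Y z i k).1 ω = gradV (clientLoss F D i)
      (localPoint F γu γv Y z i k ω).1 (localPoint F γu γv Y z i k ω).2 := by
  obtain ⟨h1, h2⟩ := h.memLp_localPoint (γu := γu) (γv := γv) hF hf i hk.le
  exact SqInt.of_apply (memLp_gradV hf i h1 h2) ω

theorem noiseU_apply (i : Fin n) {k : ℕ} (hk : k < K) (ω : Ω) :
    (SqInt.of P (noiseU F D γu γv Y z i k)).1 ω = noiseU F D γu γv Y z i k ω :=
  SqInt.of_apply (h.memLp_noiseU hF hf i hk).1 ω

theorem noiseV_apply (i : Fin n) {k : ℕ} (hk : k < K) (ω : Ω) :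
    (SqInt.of P (noiseV F D γu γv Y z i k)).1 ω = noiseV F D γu γv Y z i k ω :=
  SqInt.of_apply (h.memLp_noiseV hF hf i hk).1 ω

theorem shiftU_apply (i : Fin n) {k : ℕ} (hk : k ≤ K) (ω : Ω) :
    (shiftU P F γu γv Y z i k).1 ω = (localPoint F γu γv Y z i k ω).1 - (Y ω).u :=
  SqInt.of_apply ((h.memLp_localPoint hF hf i hk).1.sub h.memLp_state.u) ω

theorem shiftV_apply (i : Fin n) {k : ℕ} (hk : k ≤ K) (ω : Ω) :
    (shiftV P F γu γv Y z i k).1 ω = (localPoint F γu γv Y z i k ω).2 - (Y ω).v i :=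
  SqInt.of_apply ((h.memLp_localPoint hF hf i hk).2.sub (h.memLp_state.v i)) ω

/-- The bridge from the algorithm to the abstract model: pointwise, the mean of the stochastic
gradients is the mean of true local gradients plus noise. -/
theorem stochMeanU_eq (i : Fin n) (ω : Ω) :
    stochMeanU F K γu γv (Y ω) i (fun k => z i k ω) =
      (stepMean K fun k => localGradU P F D γu γv Y z i k +
        SqInt.of P (noiseU F D γu γv Y z i k)).1 ω := by
  rw [SqInt.stepMean_apply, stochMeanU, stepMean]
  congr 1
  refine Finset.sum_congr rfl fun k hk => ?_
  rw [SqInt.add_apply, h.localGradU_apply hF hf i (Finset.mem_range.1 hk),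
    h.noiseU_apply hF hf i (Finset.mem_range.1 hk), noiseU, add_sub_cancel]
  rfl

theorem stochMeanV_eq (i : Fin n) (ω : Ω) :
    stochMeanV F K γu γv (Y ω) i (fun k => z i k ω) =
      (stepMean K fun k => localGradV P F D γu γv Y z i k +
        SqInt.of P (noiseV F D γu γv Y z i k)).1 ω := by
  rw [SqInt.stepMean_apply, stochMeanV, stepMean]
  congr 1
  refine Finset.sum_congr rfl fun k hk => ?_
  rw [SqInt.add_apply, h.localGradV_apply hF hf i (Finset.mem_range.1 hk),
    h.noiseV_apply hF hf i (Finset.mem_range.1 hk), noiseV, add_sub_cancel]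
  rfl

/-- The random vectors of a round of Scaffold-P satisfy the relations of `LocalModel`. -/
theorem localModel (hL : L = (max (max Lu Lv) (max Luv Lvu) : ℝ≥0))
    (hcbar : ∀ ω, (Y ω).cbar = (1 / (n : ℝ)) • ∑ i, (Y ω).c i) :
    LocalModel K L σu σv γu γv (startGradU P F D Y) (startControl P Y) (startGradV P F D Y)
      (localGradU P F D γu γv Y z) (fun i k => SqInt.of P (noiseU F D γu γv Y z i k))
      (shiftU P F γu γv Y z) (localGradV P F D γu γv Y z)
      (fun i k => SqInt.of P (noiseV F D γu γv Y z i k)) (shiftV P F γu γv Y z) where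
  w_eq i k hk := by
    refine SqInt.ext fun ω => ?_
    rw [h.shiftU_apply hF hf i hk.le, SqInt.smul_apply, SqInt.sum_apply, localPoint, localIter_fst,
      sub_sub_cancel_left, neg_smul]
    congr 2
    refine Finset.sum_congr rfl fun j hj => ?_
    have hjK : j < K := (Finset.mem_range.1 hj).trans hk
    rw [SqInt.add_apply, SqInt.add_apply, SqInt.sub_apply, SqInt.smul_apply, SqInt.sum_apply,
      h.localGradU_apply hF hf i hjK, h.noiseU_apply hF hf i hjK, h.startControl_apply]
    simp only [h.startControl_apply]
    rw [noiseU, hcbar ω]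
    simp only [localPoint]
    abel
  wv_eq i k hk := by
    refine SqInt.ext fun ω => ?_
    rw [h.shiftV_apply hF hf i hk.le, SqInt.smul_apply, SqInt.sum_apply, localPoint, localIter_snd,
      sub_sub_cancel_left, neg_smul]
    congr 2
    refine Finset.sum_congr rfl fun j hj => ?_
    have hjK : j < K := (Finset.mem_range.1 hj).trans hk
    rw [SqInt.add_apply, h.localGradV_apply hF hf i hjK, h.noiseV_apply hF hf i hjK, noiseV]
    simp only [localPoint]
    abel
  lipU i k hk := SqInt.norm_sq_le_of_forall fun ω => by
    rw [SqInt.sub_apply, h.localGradU_apply hF hf i hk, h.startGradU_apply hf,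
      h.shiftU_apply hF hf i hk.le, h.shiftV_apply hF hf i hk.le]
    exact norm_gradU_sub_le hf hL i _ _ _ _
  lipV i k hk := SqInt.norm_sq_le_of_forall fun ω => by
    rw [SqInt.sub_apply, h.localGradV_apply hF hf i hk, h.startGradV_apply hf,
      h.shiftU_apply hF hf i hk.le, h.shiftV_apply hF hf i hk.le]
    exact norm_gradV_sub_le hf hL i _ _ _ _
  orthU i j k hk l hl hne := h.orthogonal_noiseU hF hf i j hk hl hne
  orthV i k hk l hl hne := h.orthogonal_noiseV hF hf i hk hl hne
  varU i k hk := by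
    rw [SqInt.norm_sq_of (h.memLp_noiseU hF hf i hk).1]
    exact (h.memLp_noiseU hF hf i hk).2
  varV i k hk := by
    rw [SqInt.norm_sq_of (h.memLp_noiseV hF hf i hk).1]
    exact (h.memLp_noiseV hF hf i hk).2
  orth_a i j k hk := h.orthogonal_past_noiseU hF hf
    ((measurable_gradU hf i).comp (h.measurable_state.u.prodMk (h.measurable_state.v i)))
    (memLp_gradU hf i h.memLp_state.u (h.memLp_state.v i)) j hk
  orth_q i k hk := h.orthogonal_past_noiseV hF hf
    ((measurable_gradV hf i).comp (h.measurable_state.u.prodMk (h.measurable_state.v i)))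
    (memLp_gradV hf i h.memLp_state.u (h.memLp_state.v i)) i hk

end RoundSetting

end RoundModel

/-! ### Bookkeeping for integrable variables with known mean. -/

section HasMean

open scoped RealInnerProductSpace

variable {Ω : Type*} [mΩ : MeasurableSpace Ω] {P : Measure Ω}

/-- The real random variable `f` is integrable with mean `x`. -/
def HasMean (P : Measure Ω) (f : Ω → ℝ) (x : ℝ) : Prop := Integrable f P ∧ ∫ ω, f ω ∂P = x

namespace HasMean

theorem add {f g : Ω → ℝ} {x y : ℝ} (hf : HasMean P f x) (hg : HasMean P g y) :
    HasMean P (fun ω => f ω + g ω) (x + y) :=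
  ⟨hf.1.add hg.1, by rw [integral_add hf.1 hg.1, hf.2, hg.2]⟩

theorem sub {f g : Ω → ℝ} {x y : ℝ} (hf : HasMean P f x) (hg : HasMean P g y) :
    HasMean P (fun ω => f ω - g ω) (x - y) :=
  ⟨hf.1.sub hg.1, by rw [integral_sub hf.1 hg.1, hf.2, hg.2]⟩

theorem const_mul {f : Ω → ℝ} {x : ℝ} (c : ℝ) (hf : HasMean P f x) :
    HasMean P (fun ω => c * f ω) (c * x) :=
  ⟨hf.1.const_mul c, by rw [integral_const_mul, hf.2]⟩

theorem clientMean {n : ℕ} {f : Fin n → Ω → ℝ} {x : Fin n → ℝ} (hf : ∀ i, HasMean P (f i) (x i)) :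
    HasMean P (fun ω => ScaffoldP.clientMean fun i => f i ω) (ScaffoldP.clientMean x) := by
  simp only [ScaffoldP.clientMean, smul_eq_mul]
  refine const_mul _ ⟨integrable_finsetSum _ fun i _ => (hf i).1, ?_⟩
  rw [integral_finsetSum _ fun i _ => (hf i).1]
  exact Finset.sum_congr rfl fun i _ => (hf i).2

theorem norm_sq {E : Type*} [NormedAddCommGroup E] [InnerProductSpace ℝ E] (X : SqInt P E) :
    HasMean P (fun ω => ‖X.1 ω‖ ^ 2) (‖X‖ ^ 2) :=
  ⟨X.integrable_norm_sq, X.norm_sq_eq.symm⟩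

theorem inner {E : Type*} [NormedAddCommGroup E] [InnerProductSpace ℝ E] (X Y : SqInt P E) :
    HasMean P (fun ω => ⟪X.1 ω, Y.1 ω⟫) ⟪X, Y⟫ :=
  ⟨X.integrable_inner Y, rfl⟩

end HasMean

/-- Transfers to expectations the inequalities that hold for every fixed outcome of the samples
after averaging over the set of clients. -/
theorem integral_le_of_subsetAvg_le {n m : ℕ} {Ω : Type*} {𝓜 : MeasurableSpace Ω}
    [mΩ : MeasurableSpace Ω] {P : Measure Ω} [IsProbabilityMeasure P] {s : Ω → Finset (Fin n)}
    (hmn : m ≤ n) (hs : ∀ a : Finset (Fin n), MeasurableSet (s ⁻¹' {a}))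
    (hlaw : ∀ a : Finset (Fin n), a.card = m → P (s ⁻¹' {a}) = ((n.choose m : ℕ) : ENNReal)⁻¹)
    (hind : Indep 𝓜 (MeasurableSpace.comap s ⊤) P) {ψ : Finset (Fin n) → Ω → ℝ}
    (hψ : ∀ a, Measurable[𝓜] (ψ a)) (hint : ∀ a, Integrable (ψ a) P) {R : Ω → ℝ} {x : ℝ}
    (hR : HasMean P R x) (hle : ∀ ω, subsetAvg n m (fun a => ψ a ω) ≤ R ω) :
    ∫ ω, ψ (s ω) ω ∂P ≤ x := by
  rw [(integral_subsetAvg hmn hs hlaw hind hψ hint).2, ← hR.2]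
  exact integral_mono ((integrable_finsetSum _ fun a _ => hint a).const_mul _) hR.1 hle

end HasMean

/-! ### One round in expectation. -/

section Expectation

open scoped RealInnerProductSpace

variable {n du dv : ℕ} {Ξ Ω : Type*} {𝓟 𝓜 : MeasurableSpace Ω}
  {𝓛 𝓔 : Fin n → ℕ → MeasurableSpace Ω} [MeasurableSpace Ξ] [mΩ : MeasurableSpace Ω]

/-- The expected loss of a random state. -/
noncomputable def expLoss (P : Measure Ω) (F : Vec du → Vec dv → Ξ → ℝ) (D : Fin n → Measure Ξ)
    (Y : Ω → State n du dv) : ℝ :=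
  ∫ ω, loss F D (Y ω).u (Y ω).v ∂P

/-- The expected mean squared distance of the shared variable to the anchors `y`. -/
noncomputable def expAnchor (P : Measure Ω) (Y : Ω → State n du dv) (y : Ω → Fin n → Vec du) : ℝ :=
  ∫ ω, clientMean (fun i => ‖(Y ω).u - y ω i‖ ^ 2) ∂P

/-- The expected mean squared error of the control variables at the anchors `y`. -/
noncomputable def expControl (P : Measure Ω) (F : Vec du → Vec dv → Ξ → ℝ) (D : Fin n → Measure Ξ)
    (Y : Ω → State n du dv) (y : Ω → Fin n → Vec du) : ℝ :=
  ∫ ω, clientMean (fun i => ‖gradU (clientLoss F D i) (y ω i) ((Y ω).v i) - (Y ω).c i‖ ^ 2) ∂P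

variable {P : Measure Ω} [IsProbabilityMeasure P] {D : Fin n → Measure Ξ}
  {F : Vec du → Vec dv → Ξ → ℝ} {m K : ℕ}
  {Lu Luv Lv Lvu : ℝ≥0} {L σu σv γu γv ηu ηv γ : ℝ} {Y : Ω → State n du dv}
  {z : Fin n → ℕ → Ω → Ξ} {y : Ω → Fin n → Vec du}

theorem measurable_loss (hf : Smooth (clientLoss F D) Lu Luv Lv Lvu) :
    Measurable fun p : Vec du × (Fin n → Vec dv) => loss F D p.1 p.2 := by
  refine (Finset.measurable_fun_sum _ fun i _ => ?_).const_mul _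
  -- Differentiability is assumed in each argument separately, so measurability in the pair is
  -- obtained from continuity in `u` and measurability in `v`.
  have h : Measurable fun q : Vec du × Vec dv => clientLoss F D i q.1 q.2 :=
    measurable_uncurry_of_continuous_of_measurable (u := fun u v => clientLoss F D i u v)
      (fun v => (hf.diffU i v).continuous) (fun u => (hf.diffV i u).continuous.measurable)
  exact h.comp (by fun_prop : Measurable fun p : Vec du × (Fin n → Vec dv) => (p.1, p.2 i))

/-- The second-order expansion around the origin bounds the loss by a quadratic polynomial in the
norms of the square-integrable state. -/
theorem integrable_loss (hf : Smooth (clientLoss F D) Lu Luv Lv Lvu) (hY : MemLpState P Y) :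
    Integrable (fun ω => loss F D (Y ω).u (Y ω).v) P := by
  refine (integrable_finsetSum _ fun i _ => ?_).const_mul _
  have h : Measurable fun q : Vec du × Vec dv => clientLoss F D i q.1 q.2 :=
    measurable_uncurry_of_continuous_of_measurable (u := fun u v => clientLoss F D i u v)
      (fun v => (hf.diffU i v).continuous) (fun u => (hf.diffV i u).continuous.measurable)
  have hm : AEStronglyMeasurable (fun ω => clientLoss F D i (Y ω).u ((Y ω).v i)) P :=
    (h.comp_aemeasurable (hY.u.1.aemeasurable.prodMk (hY.v i).1.aemeasurable)).aestronglyMeasurable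
  set M : ℝ := ((max (max Lu Lv) (max Luv Lvu) : ℝ≥0) : ℝ) with hM
  have hb : Integrable (fun ω => |clientLoss F D i 0 0| +
      ‖gradU (clientLoss F D i) 0 0‖ * ‖(Y ω).u‖ +
      ‖gradV (clientLoss F D i) 0 0‖ * ‖(Y ω).v i‖ + (M * ‖(Y ω).u‖ ^ 2 + M * ‖(Y ω).v i‖ ^ 2)) P :=
    (((integrable_const _).add ((hY.u.integrable one_le_two).norm.const_mul _)).add
      (((hY.v i).integrable one_le_two).norm.const_mul _)).add
      (((integrable_norm_sq_of_memLp hY.u).const_mul _).add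
        ((integrable_norm_sq_of_memLp (hY.v i)).const_mul _))
  refine hb.mono' hm (.of_forall fun ω => ?_)
  have h1 := abs_sub_inner_gradU_gradV_le hf hM i 0 (Y ω).u 0 ((Y ω).v i)
  rw [zero_add, zero_add] at h1
  have h2 := abs_real_inner_le_norm (gradU (clientLoss F D i) 0 0) (Y ω).u
  have h3 := abs_real_inner_le_norm (gradV (clientLoss F D i) 0 0) ((Y ω).v i)
  rw [Real.norm_eq_abs]
  rw [abs_le] at h1 h2 h3 ⊢
  have h4 := neg_abs_le (clientLoss F D i 0 0)
  have h5 := le_abs_self (clientLoss F D i 0 0)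
  constructor <;> linarith [h1.1, h1.2, h2.1, h2.2, h3.1, h3.2]

/-- The average of the stochastic gradients `∇_u F` used by client `i`, as a square-integrable
vector. -/
noncomputable def roundMeanU (P : Measure Ω) (F : Vec du → Vec dv → Ξ → ℝ) (D : Fin n → Measure Ξ)
    (K : ℕ) (γu γv : ℝ) (Y : Ω → State n du dv) (z : Fin n → ℕ → Ω → Ξ) (i : Fin n) :
    SqInt P (Vec du) :=
  stepMean K fun k => localGradU P F D γu γv Y z i k + SqInt.of P (noiseU F D γu γv Y z i k)

/-- The average of the stochastic gradients `∇_v F` used by client `i`, as a square-integrable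
vector. -/
noncomputable def roundMeanV (P : Measure Ω) (F : Vec du → Vec dv → Ξ → ℝ) (D : Fin n → Measure Ξ)
    (K : ℕ) (γu γv : ℝ) (Y : Ω → State n du dv) (z : Fin n → ℕ → Ω → Ξ) (i : Fin n) :
    SqInt P (Vec dv) :=
  stepMean K fun k => localGradV P F D γu γv Y z i k + SqInt.of P (noiseV F D γu γv Y z i k)

/-- The mean square of the update of the server, up to the step size. -/
noncomputable def meanUpdateSq (P : Measure Ω) (F : Vec du → Vec dv → Ξ → ℝ)
    (D : Fin n → Measure Ξ) (m K : ℕ) (γu γv : ℝ) (Y : Ω → State n du dv)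
    (z : Fin n → ℕ → Ω → Ξ) : ℝ :=
  ‖clientMean (roundMeanU P F D K γu γv Y z)‖ ^ 2 +
    1 / (m : ℝ) * clientMean fun i => ‖roundMeanU P F D K γu γv Y z i - startControl P Y i‖ ^ 2

namespace RoundSetting

variable [∀ i, IsProbabilityMeasure (D i)] (h : RoundSetting 𝓟 𝓛 𝓔 P D K Y z)
  (hF : StochasticGradient F D σu σv) (hf : Smooth (clientLoss F D) Lu Luv Lv Lvu)

include h hF hf

theorem updateSq_eq (ω : Ω) : updateSq F m K γu γv (Y ω) (fun i k => z i k ω) =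
    ‖(clientMean (roundMeanU P F D K γu γv Y z)).1 ω‖ ^ 2 + 1 / (m : ℝ) * clientMean fun i =>
      ‖(roundMeanU P F D K γu γv Y z i - startControl P Y i).1 ω‖ ^ 2 := by
  simp only [updateSq, h.stochMeanU_eq hF hf, SqInt.clientMean_apply, SqInt.sub_apply,
    h.startControl_apply]
  simp only [clientMean, smul_eq_mul, roundMeanU]
  ring

theorem hasMean_updateSq : HasMean P (fun ω => updateSq F m K γu γv (Y ω) (fun i k => z i k ω))
    (meanUpdateSq P F D m K γu γv Y z) := by
  simp only [h.updateSq_eq hF hf]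
  exact (HasMean.norm_sq _).add ((HasMean.clientMean fun i => HasMean.norm_sq _).const_mul _)

omit [IsProbabilityMeasure P] [∀ i, IsProbabilityMeasure (D i)] hf in
theorem measurableState_round (hle : ∀ i k, 𝓛 i k ≤ 𝓜) (h𝓟 : 𝓟 ≤ 𝓜) (s : Finset (Fin n)) :
    MeasurableState 𝓜 fun ω => round F m K γu γv ηu ηv s (fun i k => z i k ω) (Y ω) :=
  measurable_round hF.measurableU hF.measurableV (h.measurable_state.mono h𝓟)
    (fun i k hk => (h.measurable_sample i k hk).mono (hle i _) le_rfl) s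

theorem memLpState_round (s : Finset (Fin n)) :
    MemLpState P fun ω => round F m K γu γv ηu ηv s (fun i k => z i k ω) (Y ω) :=
  memLp_round h.memLp_state (fun i => (h.memLp_localPoint hF hf i le_rfl).1)
    (fun i => (h.memLp_localPoint hF hf i le_rfl).2) s

variable {s : Ω → Finset (Fin n)} (hm : 1 ≤ m) (hmn : m ≤ n) (hK : 1 ≤ K)
  (hs : ∀ a : Finset (Fin n), MeasurableSet (s ⁻¹' {a}))
  (hlaw : ∀ a : Finset (Fin n), a.card = m → P (s ⁻¹' {a}) = ((n.choose m : ℕ) : ENNReal)⁻¹)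
  (hind : Indep 𝓜 (MeasurableSpace.comap s ⊤) P) (hle : ∀ i k, 𝓛 i k ≤ 𝓜) (h𝓟 : 𝓟 ≤ 𝓜)
  (hcbar : ∀ ω, (Y ω).cbar = (1 / (n : ℝ)) • ∑ i, (Y ω).c i)

include hm hmn hK hs hlaw hind hle h𝓟 hcbar

theorem expLoss_round_le (hL : L = (max (max Lu Lv) (max Luv Lvu) : ℝ≥0))
    (hγu : γu * ηu = γ) (hγv : γv * ηv = γ) :
    expLoss P F D (fun ω => round F m K γu γv ηu ηv (s ω) (fun i k => z i k ω) (Y ω)) ≤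
      expLoss P F D Y -
        γ * K * ⟪clientMean (startGradU P F D Y), clientMean (roundMeanU P F D K γu γv Y z)⟫ -
        γ * K * ((m : ℝ) / n * clientMean fun i =>
          ⟪startGradV P F D Y i, roundMeanV P F D K γu γv Y z i⟫) +
        L * ((γ * K) ^ 2 * meanUpdateSq P F D m K γu γv Y z) +
        L * ((γ * K) ^ 2 * ((m : ℝ) / n * clientMean fun i =>
          ‖roundMeanV P F D K γu γv Y z i‖ ^ 2)) := by
  have hmeas := h.measurableState_round (m := m) (γu := γu) (γv := γv) (ηu := ηu) (ηv := ηv)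
    hF hle h𝓟
  have hmem := h.memLpState_round (m := m) (γu := γu) (γv := γv) (ηu := ηu) (ηv := ηv) hF hf
  have hf0 : HasMean P (fun ω => loss F D (Y ω).u (Y ω).v) (expLoss P F D Y) :=
    ⟨integrable_loss hf h.memLp_state, rfl⟩
  refine integral_le_of_subsetAvg_le hmn hs hlaw hind
    (ψ := fun a ω => loss F D (round F m K γu γv ηu ηv a (fun i k => z i k ω) (Y ω)).u
      (round F m K γu γv ηu ηv a (fun i k => z i k ω) (Y ω)).v)
    (fun a => ?_) (fun a => integrable_loss hf (hmem a))
    ((((hf0.sub ((HasMean.inner (clientMean (startGradU P F D Y))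
        (clientMean (roundMeanU P F D K γu γv Y z))).const_mul (γ * K))).sub
      (((HasMean.clientMean fun i => HasMean.inner (startGradV P F D Y i)
        (roundMeanV P F D K γu γv Y z i)).const_mul ((m : ℝ) / n)).const_mul (γ * K))).add
      (((h.hasMean_updateSq hF hf).const_mul ((γ * K) ^ 2)).const_mul L)).add
      ((((HasMean.clientMean fun i => HasMean.norm_sq (roundMeanV P F D K γu γv Y z i)).const_mul
        ((m : ℝ) / n)).const_mul ((γ * K) ^ 2)).const_mul L)) fun ω => ?_
  · have hv : Measurable[𝓜] fun ω =>
        (round F m K γu γv ηu ηv a (fun i k => z i k ω) (Y ω)).v :=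
      @measurable_pi_lambda _ _ _ 𝓜 _ _ (hmeas a).v
    exact (measurable_loss hf).comp ((hmeas a).u.prodMk hv)
  · refine (subsetAvg_loss_round_le hm hmn hK hf hL hγu hγv (Y ω) (hcbar ω)
      (fun i k => z i k ω)).trans (le_of_eq ?_)
    simp only [gradient_loss hf, h.stochMeanU_eq hF hf, h.stochMeanV_eq hF hf,
      SqInt.clientMean_apply, h.startGradU_apply hf, h.startGradV_apply hf]
    simp only [clientMean, smul_eq_mul, roundMeanU, roundMeanV]

variable (hy : ∀ i, Measurable[𝓟] fun ω => y ω i) (hy2 : ∀ i, MemLp (fun ω => y ω i) 2 P)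

include hy hy2

theorem expAnchor_round_le (hγu : γu * ηu = γ) :
    expAnchor P (fun ω => round F m K γu γv ηu ηv (s ω) (fun i k => z i k ω) (Y ω))
        (fun ω i => if i ∈ s ω then (Y ω).u else y ω i) ≤
      (1 - (m : ℝ) / n / 2) * expAnchor P Y y +
        3 * ((γ * K) ^ 2 * meanUpdateSq P F D m K γu γv Y z) -
        2 * (γ * K * ⟪clientMean fun i => SqInt.of P fun ω => (Y ω).u - y ω i,
          clientMean (roundMeanU P F D K γu γv Y z)⟫) := by
  have hmeas := h.measurableState_round (m := m) (γu := γu) (γv := γv) (ηu := ηu) (ηv := ηv)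
    hF hle h𝓟
  have hmem := h.memLpState_round (m := m) (γu := γu) (γv := γv) (ηu := ηu) (ηv := ηv) hF hf
  have he : ∀ i, MemLp (fun ω => (Y ω).u - y ω i) 2 P := fun i => h.memLp_state.u.sub (hy2 i)
  have hA : HasMean P (fun ω => clientMean fun i => ‖(Y ω).u - y ω i‖ ^ 2) (expAnchor P Y y) :=
    ⟨((integrable_finsetSum _ fun i _ => integrable_norm_sq_of_memLp (he i)).const_mul _), rfl⟩
  have hy' : ∀ (a : Finset (Fin n)) i, Measurable[𝓜] fun ω => if i ∈ a then (Y ω).u else y ω i := by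
    intro a i
    split_ifs
    · exact h.measurable_state.u.mono h𝓟 le_rfl
    · exact (hy i).mono h𝓟 le_rfl
  have hy2' : ∀ (a : Finset (Fin n)) i,
      MemLp (fun ω => if i ∈ a then (Y ω).u else y ω i) 2 P := by
    intro a i
    split_ifs
    · exact h.memLp_state.u
    · exact hy2 i
  refine integral_le_of_subsetAvg_le hmn hs hlaw hind
    (ψ := fun a ω => clientMean fun i =>
      ‖(round F m K γu γv ηu ηv a (fun i k => z i k ω) (Y ω)).u -
        (if i ∈ a then (Y ω).u else y ω i)‖ ^ 2)
    (fun a => ?_) (fun a => ?_)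
    (((hA.const_mul (1 - (m : ℝ) / n / 2)).add
      (((h.hasMean_updateSq hF hf).const_mul ((γ * K) ^ 2)).const_mul 3)).sub
      (((HasMean.inner (clientMean fun i => SqInt.of P fun ω => (Y ω).u - y ω i)
        (clientMean (roundMeanU P F D K γu γv Y z))).const_mul (γ * K)).const_mul 2)) fun ω => ?_
  · exact (Finset.measurable_fun_sum _ fun i _ =>
      (measurable_norm.comp ((hmeas a).u.sub (hy' a i))).pow_const 2).const_mul _
  · exact (integrable_finsetSum _ fun i _ =>
      integrable_norm_sq_of_memLp ((hmem a).u.sub (hy2' a i))).const_mul _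
  · refine (subsetAvg_anchor_round_le hm hmn hK hγu (Y ω) (hcbar ω)
      (fun i k => z i k ω) (y ω)).trans (le_of_eq ?_)
    simp only [h.stochMeanU_eq hF hf, SqInt.clientMean_apply, SqInt.of_apply (he _)]
    simp only [clientMean, smul_eq_mul, roundMeanU]

omit hcbar in
theorem expControl_round_le (hγu : γu ≠ 0) (hγv : γv * ηv = γ) :
    expControl P F D (fun ω => round F m K γu γv ηu ηv (s ω) (fun i k => z i k ω) (Y ω))
        (fun ω i => if i ∈ s ω then (Y ω).u else y ω i) ≤
      (m : ℝ) / n * (clientMean fun i => ‖SqInt.of P (fun ω => gradU (clientLoss F D i) (Y ω).u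
        ((Y ω).v i + (-(γ * K)) • (roundMeanV P F D K γu γv Y z i).1 ω)) -
          roundMeanU P F D K γu γv Y z i‖ ^ 2) +
      (1 - (m : ℝ) / n) * expControl P F D Y y := by
  have hmeas := h.measurableState_round (m := m) (γu := γu) (γv := γv) (ηu := ηu) (ηv := ηv)
    hF hle h𝓟
  have hmem := h.memLpState_round (m := m) (γu := γu) (γv := γv) (ηu := ηu) (ηv := ηv) hF hf
  have he : ∀ i, MemLp (fun ω => gradU (clientLoss F D i) (y ω i) ((Y ω).v i) - (Y ω).c i) 2 P :=
    fun i => (memLp_gradU hf i (hy2 i) (h.memLp_state.v i)).sub (h.memLp_state.c i)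
  have hB : HasMean P (fun ω => clientMean fun i =>
      ‖gradU (clientLoss F D i) (y ω i) ((Y ω).v i) - (Y ω).c i‖ ^ 2) (expControl P F D Y y) :=
    ⟨((integrable_finsetSum _ fun i _ => integrable_norm_sq_of_memLp (he i)).const_mul _), rfl⟩
  have hx : ∀ i, MemLp (fun ω => gradU (clientLoss F D i) (Y ω).u
      ((Y ω).v i + (-(γ * K)) • (roundMeanV P F D K γu γv Y z i).1 ω)) 2 P := fun i =>
    memLp_gradU hf i h.memLp_state.u
      ((h.memLp_state.v i).add (MemLp.const_smul (roundMeanV P F D K γu γv Y z i).2 (-(γ * K))))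
  have hy' : ∀ (a : Finset (Fin n)) i, Measurable[𝓜] fun ω => if i ∈ a then (Y ω).u else y ω i := by
    intro a i
    split_ifs
    · exact h.measurable_state.u.mono h𝓟 le_rfl
    · exact (hy i).mono h𝓟 le_rfl
  have hy2' : ∀ (a : Finset (Fin n)) i,
      MemLp (fun ω => if i ∈ a then (Y ω).u else y ω i) 2 P := by
    intro a i
    split_ifs
    · exact h.memLp_state.u
    · exact hy2 i
  refine integral_le_of_subsetAvg_le hmn hs hlaw hind
    (ψ := fun a ω => clientMean fun i => ‖gradU (clientLoss F D i)
        (if i ∈ a then (Y ω).u else y ω i)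
        ((round F m K γu γv ηu ηv a (fun i k => z i k ω) (Y ω)).v i) -
      (round F m K γu γv ηu ηv a (fun i k => z i k ω) (Y ω)).c i‖ ^ 2)
    (fun a => ?_) (fun a => ?_)
    (((HasMean.clientMean fun i => HasMean.norm_sq (SqInt.of P (fun ω =>
        gradU (clientLoss F D i) (Y ω).u
          ((Y ω).v i + (-(γ * K)) • (roundMeanV P F D K γu γv Y z i).1 ω)) -
          roundMeanU P F D K γu γv Y z i)).const_mul ((m : ℝ) / n)).add
      (hB.const_mul (1 - (m : ℝ) / n))) fun ω => ?_
  · exact (Finset.measurable_fun_sum _ fun i _ => (measurable_norm.comp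
      (((measurable_gradU hf i).comp ((hy' a i).prodMk ((hmeas a).v i))).sub
        ((hmeas a).c i))).pow_const 2).const_mul _
  · exact (integrable_finsetSum _ fun i _ => integrable_norm_sq_of_memLp
      ((memLp_gradU hf i (hy2' a i) ((hmem a).v i)).sub ((hmem a).c i))).const_mul _
  · refine (subsetAvg_control_round (D := D) hm hmn hK hγu hγv (Y ω)
      (fun i k => z i k ω) (y ω)).le.trans (le_of_eq ?_)
    simp only [h.stochMeanU_eq hF hf, h.stochMeanV_eq hF hf, clientMean,
      smul_eq_mul, roundMeanU, SqInt.sub_apply, SqInt.of_apply (hx _)]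
    simp only [roundMeanV]

end RoundSetting

end Expectation

/-! ### The system of recursions for one round. -/

section Recursion

open scoped RealInnerProductSpace

variable {n du dv : ℕ} {Ξ Ω : Type*} {𝓟 𝓜 : MeasurableSpace Ω}
  {𝓛 𝓔 : Fin n → ℕ → MeasurableSpace Ω} [MeasurableSpace Ξ] [mΩ : MeasurableSpace Ω]
  {P : Measure Ω} [IsProbabilityMeasure P] {D : Fin n → Measure Ξ}
  {F : Vec du → Vec dv → Ξ → ℝ} {m K : ℕ}
  {Lu Luv Lv Lvu : ℝ≥0} {L σu σv γu γv ηu ηv γ : ℝ} {Y : Ω → State n du dv}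
  {z : Fin n → ℕ → Ω → Ξ} {y : Ω → Fin n → Vec du} {s : Ω → Finset (Fin n)}

omit [IsProbabilityMeasure P] in
theorem memLp_clientMean {E : Type*} [NormedAddCommGroup E] [InnerProductSpace ℝ E]
    {f : Fin n → Ω → E} (hf : ∀ i, MemLp (f i) 2 P) :
    MemLp (fun ω => clientMean fun i => f i ω) 2 P := by
  have h : MemLp (fun ω => ∑ i, f i ω) 2 P := memLp_finsetSum _ fun i _ => hf i
  exact h.const_smul (1 / (n : ℝ))

theorem integrable_sqGradU (hf : Smooth (clientLoss F D) Lu Luv Lv Lvu) (hY : MemLpState P Y) :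
    Integrable (fun ω => sqGradU F D (Y ω)) P := by
  simp only [sqGradU, gradient_loss hf]
  exact integrable_norm_sq_of_memLp (memLp_clientMean fun i => memLp_gradU hf i hY.u (hY.v i))

theorem integrable_sqGradV (hf : Smooth (clientLoss F D) Lu Luv Lv Lvu) (hY : MemLpState P Y)
    (i : Fin n) : Integrable (fun ω => sqGradV F D i (Y ω)) P :=
  integrable_norm_sq_of_memLp (memLp_gradV hf i hY.u (hY.v i))

omit [IsProbabilityMeasure P] in
theorem expGradU_nonneg : 0 ≤ expGradU F D P Y :=
  integral_nonneg fun _ => sq_nonneg _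

omit [IsProbabilityMeasure P] in
theorem expGradV_nonneg : 0 ≤ expGradV F D P m Y :=
  mul_nonneg (by positivity) (Finset.sum_nonneg fun _ _ => integral_nonneg fun _ => sq_nonneg _)

omit [IsProbabilityMeasure P] in
theorem expAnchor_nonneg : 0 ≤ expAnchor P Y y :=
  integral_nonneg fun _ => clientMean_nonneg fun _ => sq_nonneg _

omit [IsProbabilityMeasure P] in
theorem expAnchor_eq (hY : MemLpState P Y) (hy2 : ∀ i, MemLp (fun ω => y ω i) 2 P) :
    expAnchor P Y y = clientMean fun i => ‖SqInt.of P fun ω => (Y ω).u - y ω i‖ ^ 2 := by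
  have h := HasMean.clientMean fun i => HasMean.norm_sq (SqInt.of P fun ω => (Y ω).u - y ω i)
  have he : ∀ i, MemLp (fun ω => (Y ω).u - y ω i) 2 P := fun i => hY.u.sub (hy2 i)
  rw [← h.2]
  simp only [SqInt.of_apply (he _)]
  rfl

/-- `∇_u f_i` at the anchors. -/
noncomputable def anchorGradU (P : Measure Ω) (F : Vec du → Vec dv → Ξ → ℝ) (D : Fin n → Measure Ξ)
    (Y : Ω → State n du dv) (y : Ω → Fin n → Vec du) (i : Fin n) : SqInt P (Vec du) :=
  .of P fun ω => gradU (clientLoss F D i) (y ω i) ((Y ω).v i)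

theorem expControl_eq (hf : Smooth (clientLoss F D) Lu Luv Lv Lvu) (hY : MemLpState P Y)
    (hy2 : ∀ i, MemLp (fun ω => y ω i) 2 P) : expControl P F D Y y =
      clientMean fun i => ‖anchorGradU P F D Y y i - startControl P Y i‖ ^ 2 := by
  have h := HasMean.clientMean fun i =>
    HasMean.norm_sq (anchorGradU P F D Y y i - startControl P Y i)
  rw [← h.2]
  simp only [SqInt.sub_apply, startControl, anchorGradU, SqInt.of_apply (hY.c _),
    SqInt.of_apply (memLp_gradU hf _ (hy2 _) (hY.v _))]
  rfl

namespace RoundSetting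

variable (h : RoundSetting 𝓟 𝓛 𝓔 P D K Y z) (hf : Smooth (clientLoss F D) Lu Luv Lv Lvu)

include h hf

theorem expGradU_eq : expGradU F D P Y = ‖clientMean (startGradU P F D Y)‖ ^ 2 := by
  rw [← (HasMean.norm_sq (clientMean (startGradU P F D Y))).2, expGradU]
  simp only [sqGradU, gradient_loss hf, SqInt.clientMean_apply, h.startGradU_apply hf]
  rfl

theorem expGradV_eq :
    expGradV F D P m Y = (m : ℝ) / n * clientMean fun i => ‖startGradV P F D Y i‖ ^ 2 := by
  have h1 : ∀ i, ∫ ω, sqGradV F D i (Y ω) ∂P = ‖startGradV P F D Y i‖ ^ 2 := by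
    intro i
    rw [← (HasMean.norm_sq (startGradV P F D Y i)).2]
    simp only [sqGradV, h.startGradV_apply hf]
  simp only [expGradV, h1, clientMean, smul_eq_mul]
  rcases eq_or_ne (n : ℝ) 0 with hn | hn
  · simp [hn]
  · field_simp

/-- Passing through the gradients at the anchors separates staleness, which costs `L²` times the
distance to the anchor, from the error made when the control variable was set. -/
theorem controlError_le (hL : L = (max (max Lu Lv) (max Luv Lvu) : ℝ≥0))
    (hy2 : ∀ i, MemLp (fun ω => y ω i) 2 P) :
    (clientMean fun i => ‖startGradU P F D Y i - startControl P Y i‖ ^ 2) ≤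
      2 * (L ^ 2 * expAnchor P Y y + expControl P F D Y y) := by
  have h1 : ∀ i, ‖startGradU P F D Y i - startControl P Y i‖ ^ 2 ≤
      2 * L ^ 2 * ‖SqInt.of P fun ω => (Y ω).u - y ω i‖ ^ 2 +
        2 * ‖anchorGradU P F D Y y i - startControl P Y i‖ ^ 2 := by
    intro i
    have e : startGradU P F D Y i - startControl P Y i =
        (startGradU P F D Y i - anchorGradU P F D Y y i) +
          (anchorGradU P F D Y y i - startControl P Y i) := by abel
    have h2 : ‖startGradU P F D Y i - anchorGradU P F D Y y i‖ ^ 2 ≤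
        L ^ 2 * ‖SqInt.of P fun ω => (Y ω).u - y ω i‖ ^ 2 := by
      refine SqInt.norm_sq_le_mul_of_forall fun ω => ?_
      have he : MemLp (fun ω => (Y ω).u - y ω i) 2 P := h.memLp_state.u.sub (hy2 i)
      rw [SqInt.sub_apply, h.startGradU_apply hf, anchorGradU,
        SqInt.of_apply (memLp_gradU hf _ (hy2 _) (h.memLp_state.v _)), SqInt.of_apply he]
      simpa using norm_gradU_sub_le hf hL i (Y ω).u (y ω i) ((Y ω).v i) ((Y ω).v i)
    rw [e]
    refine (norm_add_sq_le_two _ _).trans ?_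
    linarith
  have h2 := clientMean_mono h1
  rw [clientMean_add, clientMean_mul, clientMean_mul, ← expAnchor_eq h.memLp_state hy2,
    ← expControl_eq hf h.memLp_state hy2] at h2
  linarith

variable [∀ i, IsProbabilityMeasure (D i)] (hF : StochasticGradient F D σu σv)

include hF

/-- The recursions for the expected loss, the anchors and the control variables in one round. -/
theorem exists_recursion (hm : 1 ≤ m) (hmn : m ≤ n) (hK : 1 ≤ K)
    (hs : ∀ a : Finset (Fin n), MeasurableSet (s ⁻¹' {a}))
    (hlaw : ∀ a : Finset (Fin n), a.card = m → P (s ⁻¹' {a}) = ((n.choose m : ℕ) : ENNReal)⁻¹)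
    (hind : Indep 𝓜 (MeasurableSpace.comap s ⊤) P) (hle : ∀ i k, 𝓛 i k ≤ 𝓜) (h𝓟 : 𝓟 ≤ 𝓜)
    (hcbar : ∀ ω, (Y ω).cbar = (1 / (n : ℝ)) • ∑ i, (Y ω).c i)
    (hy : ∀ i, Measurable[𝓟] fun ω => y ω i) (hy2 : ∀ i, MemLp (fun ω => y ω i) 2 P)
    (hL : L = (max (max Lu Lv) (max Luv Lvu) : ℝ≥0)) (hγu : γu * ηu = γ) (hγv : γv * ηv = γ)
    (hγ : 0 < γ) (hηu : √(m : ℝ) ≤ ηu) (hηv : √((n : ℝ) / m) ≤ ηv) (hθ : γ * K * L ≤ 1 / 72)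
    {g θ ς : ℝ} (hg : g = γ * K) (hθ_eq : θ = g * L)
    (hς : ς = σu ^ 2 / K / m + (m : ℝ) / n * (σv ^ 2 / K))
    {Y' : Ω → State n du dv} {y' : Ω → Fin n → Vec du}
    (hY' : ∀ ω, Y' ω = round F m K γu γv ηu ηv (s ω) (fun i k => z i k ω) (Y ω))
    (hy' : ∀ ω i, y' ω i = if i ∈ s ω then (Y ω).u else y ω i) :
    ∃ M Q w Z Δ e : ℝ, 0 ≤ M ∧ 0 ≤ Q ∧ 0 ≤ w ∧ 0 ≤ Z ∧ 0 ≤ Δ ∧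
      expLoss P F D Y' / g ≤ expLoss P F D Y / g -
        1 / 2 * (expGradU F D P Y + expGradV F D P m Y + M + Q) + 2 * Δ + θ * w + θ * Z ∧
      Z ≤ 2 * Q + 2 * ς ∧ w ≤ 2 * M + 5 * ς + 6 * Δ + 3 * e ∧
      Δ ≤ θ ^ 2 * (3 * ς + 5 * (expGradU F D P Y + expGradV F D P m Y) + 5 * e) ∧
      e ≤ 2 * ((L ^ 2 * expAnchor P Y y + expControl P F D Y y) / m) ∧
      L ^ 2 * expAnchor P Y' y' ≤ (1 - (m : ℝ) / n / 4) * (L ^ 2 * expAnchor P Y y) +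
        3 * θ ^ 2 * w + 4 * ((n : ℝ) / m) * θ ^ 2 * M ∧
      expControl P F D Y' y' ≤ (1 - (m : ℝ) / n) * expControl P F D Y y +
        (m : ℝ) / n * (3 * (m * ς)) + 3 * θ ^ 2 * Z + 6 * ((m : ℝ) / n) * Δ := by
  have hn : 1 ≤ n := hm.trans hmn
  have hm0 : (0 : ℝ) < m := by positivity
  have hn0 : (0 : ℝ) < n := by positivity
  have hK0 : (0 : ℝ) < K := by positivity
  have hL0 : 0 ≤ L := by rw [hL]; positivity
  have hg0 : 0 < g := by rw [hg]; positivity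
  obtain rfl : Y' = fun ω => round F m K γu γv ηu ηv (s ω) (fun i k => z i k ω) (Y ω) := funext hY'
  obtain rfl : y' = fun ω i => if i ∈ s ω then (Y ω).u else y ω i :=
    funext fun ω => funext fun i => hy' ω i
  have hηu0 : 0 < ηu := (Real.sqrt_pos.2 hm0).trans_le hηu
  have hηv0 : 0 < ηv := (Real.sqrt_pos.2 (by positivity)).trans_le hηv
  have hγu0 : γu ≠ 0 := by rintro rfl; rw [zero_mul] at hγu; exact hγ.ne hγu
  -- The lower bounds on `ηu` and `ηv` enter only here: with `γ` fixed they make the local step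
  -- sizes small.
  have hγu_sq : (γu * K) ^ 2 ≤ g ^ 2 / m := by
    rw [le_div_iff₀ hm0, hg, ← hγu]
    calc (γu * K) ^ 2 * m = (γu * K) ^ 2 * √(m : ℝ) ^ 2 := by rw [Real.sq_sqrt hm0.le]
      _ ≤ (γu * K) ^ 2 * ηu ^ 2 := by gcongr
      _ = _ := by ring
  have hγv_sq : (γv * K) ^ 2 ≤ g ^ 2 * ((m : ℝ) / n) := by
    have h1 : (γv * K) ^ 2 * ((n : ℝ) / m) ≤ g ^ 2 := by
      rw [hg, ← hγv]
      calc (γv * K) ^ 2 * ((n : ℝ) / m) = (γv * K) ^ 2 * √((n : ℝ) / m) ^ 2 := by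
            rw [Real.sq_sqrt (by positivity)]
        _ ≤ (γv * K) ^ 2 * ηv ^ 2 := by gcongr
        _ = _ := by ring
    calc (γv * K) ^ 2 = (γv * K) ^ 2 * ((n : ℝ) / m) * ((m : ℝ) / n) := by field_simp
      _ ≤ _ := by gcongr
  have hM := h.localModel (γu := γu) (γv := γv) hF hf hL hcbar
  have hloss := h.expLoss_round_le (ηu := ηu) (ηv := ηv) hF hf hm hmn hK hs hlaw hind hle h𝓟
    hcbar hL hγu hγv
  have hanchor := h.expAnchor_round_le (γv := γv) (ηv := ηv) hF hf hm hmn hK hs hlaw hind hle h𝓟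
    hcbar hy hy2 hγu
  have hcontrol := h.expControl_round_le (ηu := ηu) (ηv := ηv) hF hf hm hmn hK hs hlaw hind hle h𝓟
    hy hy2 hγu0 hγv
  have hdU := hM.descentU hK hg0.le
  have hdV := hM.descentV hK hg0.le hmn hn
  have hupU := hM.updateU_le hK hm hmn
  have hupV := hM.updateV_le (m := m) hK hn
  have hdrift := hM.drift_le hK hm hmn hg0.le hL0 (by rw [hg]; exact hθ) hγu_sq hγv_sq
  have hce := h.controlError_le hf hL hy2
  have hinner := neg_inner_anchor_le (g := g) (ga := localGradU P F D γu γv Y z)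
    (N := fun i k => SqInt.of P (noiseU F D γu γv Y z i k)) hm hn (K := K)
    (e := fun i => SqInt.of P fun ω => (Y ω).u - y ω i) fun i j k hk =>
      h.orthogonal_past_noiseU hF hf (h.measurable_state.u.sub (hy i))
        (h.memLp_state.u.sub (hy2 i)) j hk
  have hcl := hM.control_le (m := m) (g := g) hK hn (x := fun i => SqInt.of P fun ω =>
    gradU (clientLoss F D i) (Y ω).u
      ((Y ω).v i + (-(γ * K)) • (roundMeanV P F D K γu γv Y z i).1 ω)) fun i =>
      SqInt.norm_sq_le_mul_of_forall fun ω => by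
        have hx : MemLp (fun ω => gradU (clientLoss F D i) (Y ω).u
            ((Y ω).v i + (-(γ * K)) • (roundMeanV P F D K γu γv Y z i).1 ω)) 2 P :=
          memLp_gradU hf i h.memLp_state.u ((h.memLp_state.v i).add
            (MemLp.const_smul (roundMeanV P F D K γu γv Y z i).2 (-(γ * K))))
        rw [SqInt.sub_apply, SqInt.of_apply hx, h.startGradU_apply hf]
        refine (norm_gradU_sub_le hf hL i _ _ _ _).trans (le_of_eq ?_)
        rw [sub_self, norm_zero, add_sub_cancel_left, zero_add, norm_smul, norm_neg,
          ← hg, Real.norm_of_nonneg hg0.le, roundMeanV]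
        ring
  rw [← expAnchor_eq h.memLp_state hy2] at hinner
  rw [← h.expGradU_eq hf] at hdU hdrift
  rw [← h.expGradV_eq hf] at hdV hdrift
  rw [← hg] at hloss hanchor
  -- A refreshed control variable carries the noise of a single client, not divided by `m`; this is
  -- the source of the level `3mς`.
  have hmς : σu ^ 2 / K ≤ m * ς := by
    have : m * ς = σu ^ 2 / K + m * ((m : ℝ) / n * (σv ^ 2 / K)) := by rw [hς]; field_simp
    rw [this]
    exact le_add_of_nonneg_right (by positivity)
  have hςu : σu ^ 2 / K / m ≤ ς := by rw [hς]; exact le_add_of_nonneg_right (by positivity)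
  have hςv : (m : ℝ) / n * (σv ^ 2 / K) ≤ ς := by
    rw [hς]; exact le_add_of_nonneg_left (by positivity)
  set Δ := L ^ 2 * LocalModel.drift K (shiftU P F γu γv Y z) (shiftV P F γu γv Y z) with hΔ
  set M := ‖clientMean fun i => stepMean K (localGradU P F D γu γv Y z i)‖ ^ 2
  set Q := (m : ℝ) / n * clientMean fun i => ‖stepMean K (localGradV P F D γu γv Y z i)‖ ^ 2
  set w := meanUpdateSq P F D m K γu γv Y z
  set Z := (m : ℝ) / n * clientMean fun i => ‖roundMeanV P F D K γu γv Y z i‖ ^ 2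
  set Ec := clientMean fun i => ‖startGradU P F D Y i - startControl P Y i‖ ^ 2
  change w ≤ _ at hupU
  change Z ≤ _ at hupV
  -- `M` and `Q` belong to the true gradients at the local iterates, `w` and `Z` to the noisy
  -- updates.
  refine ⟨M, Q, w, Z, Δ, Ec / m, by positivity,
    mul_nonneg (by positivity) (clientMean_nonneg fun _ => by positivity),
    add_nonneg (by positivity) (mul_nonneg (by positivity)
      (clientMean_nonneg fun _ => by positivity)),
    mul_nonneg (by positivity) (clientMean_nonneg fun _ => by positivity),
    mul_nonneg (sq_nonneg L) LocalModel.drift_nonneg, ?_, ?_, ?_, ?_, ?_, ?_, ?_⟩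
  · rw [div_le_iff₀ hg0]
    have e : (expLoss P F D Y / g - 1 / 2 * (expGradU F D P Y + expGradV F D P m Y + M + Q) +
        2 * Δ + θ * w + θ * Z) * g = expLoss P F D Y -
        g / 2 * (expGradU F D P Y + expGradV F D P m Y + M + Q) + 2 * (g * Δ) +
        L * (g ^ 2 * w) + L * (g ^ 2 * Z) := by
      rw [hθ_eq]; field_simp
    rw [e]
    change -(g * ⟪clientMean (startGradU P F D Y), clientMean (roundMeanU P F D K γu γv Y z)⟫) ≤ _
      at hdU
    change -(g * ((m : ℝ) / n * clientMean fun i =>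
          ⟪startGradV P F D Y i, roundMeanV P F D K γu γv Y z i⟫)) ≤ _ at hdV
    linarith
  · linarith
  · linarith
  · rw [hθ_eq, hς]
    exact hdrift
  · rw [← mul_div_assoc]
    gcongr
  · change -(2 * (g * ⟪clientMean fun i => SqInt.of P fun ω => (Y ω).u - y ω i,
      clientMean (roundMeanU P F D K γu γv Y z)⟫)) ≤ _ at hinner
    -- The contraction factor `1 - m/(2n)` loses `m/(4n)` to Young's inequality.
    have h1 := mul_le_mul_of_nonneg_left (hanchor.trans (by linarith [hinner] :
      _ ≤ (1 - (m : ℝ) / n / 4) * expAnchor P Y y + 3 * (g ^ 2 * w) +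
        4 * ((n : ℝ) / m) * g ^ 2 * M)) (sq_nonneg L)
    refine h1.trans (le_of_eq ?_)
    rw [hθ_eq]
    ring
  · refine hcontrol.trans ?_
    rw [hθ_eq]
    have h1 : (m : ℝ) / n * (3 * (σu ^ 2 / K)) ≤ (m : ℝ) / n * (3 * (m * ς)) := by gcongr
    refine (add_le_add hcl le_rfl).trans ?_
    change _ + 3 * (g * L) ^ 2 * Z + _ + _ ≤ _
    linarith

end RoundSetting

end Recursion

/-! ### Independent sources of randomness and the information they carry. -/

section Sources

variable {n m K T : ℕ} {Ξ Ω : Type*} [MeasurableSpace Ξ] [mΩ : MeasurableSpace Ω]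

/-- The sources of randomness: the data samples and the sets of clients. -/
abbrev Source (n K T : ℕ) := (Fin (T + 1) × Fin n × Fin K) ⊕ Fin T

/-- The information contained in the sources `J`. -/
abbrev info (ξ : ℕ → Fin n → ℕ → Ω → Ξ) (S : ℕ → Ω → Finset (Fin n)) (J : Set (Source n K T)) :
    MeasurableSpace Ω :=
  ⨆ q ∈ J, Sum.elim
    (fun q : Fin (T + 1) × Fin n × Fin K =>
      MeasurableSpace.comap (ξ q.1 q.2.1 q.2.2) inferInstance)
    (fun t : Fin T => MeasurableSpace.comap (S t) (⊤ : MeasurableSpace (Finset (Fin n)))) q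

/-- The sources used before the samples with time index `τ`. -/
def pastSources (n K T τ : ℕ) : Set (Source n K T) :=
  {q | Sum.elim (fun p => p.1.1 < τ) (fun t => t.1 + 1 < τ) q}

/-- The sources used by client `i` in its first `k` local steps with time index `τ`. -/
def localSources (n K T τ : ℕ) (i : Fin n) (k : ℕ) : Set (Source n K T) :=
  {q | Sum.elim (fun p => p.1.1 < τ ∨ p.1.1 = τ ∧ p.2.1 = i ∧ p.2.2.1 < k)
    (fun t => t.1 + 1 < τ) q}

/-- The sources up to the samples with time index `τ`, except for the samples of client `i` from
step `k` on. -/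
def exceptSources (n K T τ : ℕ) (i : Fin n) (k : ℕ) : Set (Source n K T) :=
  {q | Sum.elim (fun p => p.1.1 < τ ∨ p.1.1 = τ ∧ (p.2.1 ≠ i ∨ p.2.2.1 < k))
    (fun t => t.1 + 1 < τ) q}

/-- The sources up to the samples with time index `τ`. -/
def roundSources (n K T τ : ℕ) : Set (Source n K T) :=
  {q | Sum.elim (fun p => p.1.1 ≤ τ) (fun t => t.1 + 1 < τ) q}

variable {ξ : ℕ → Fin n → ℕ → Ω → Ξ} {S : ℕ → Ω → Finset (Fin n)}

omit mΩ in
theorem info_mono {J J' : Set (Source n K T)} (h : J ⊆ J') : info ξ S J ≤ info ξ S J' :=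
  biSup_mono h

omit mΩ in
theorem measurable_info_sample {J : Set (Source n K T)} {τ : ℕ} (hτ : τ < T + 1) (i : Fin n)
    {k : ℕ} (hk : k < K) (h : Sum.inl (⟨τ, hτ⟩, i, ⟨k, hk⟩) ∈ J) :
    Measurable[info ξ S J] (ξ τ i k) :=
  Measurable.mono (comap_measurable (ξ τ i k)) (le_biSup (Sum.elim
    (fun q : Fin (T + 1) × Fin n × Fin K =>
      MeasurableSpace.comap (ξ q.1 q.2.1 q.2.2) inferInstance)
    (fun t : Fin T => MeasurableSpace.comap (S t) (⊤ : MeasurableSpace (Finset (Fin n))))) h) le_rfl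

omit mΩ in
theorem measurableSet_info_clients {J : Set (Source n K T)} {t : ℕ} (ht : t < T)
    (h : Sum.inr ⟨t, ht⟩ ∈ J) (a : Finset (Fin n)) : MeasurableSet[info ξ S J] (S t ⁻¹' {a}) := by
  have h1 := le_biSup (Sum.elim
    (fun q : Fin (T + 1) × Fin n × Fin K =>
      MeasurableSpace.comap (ξ q.1 q.2.1 q.2.2) inferInstance)
    (fun t : Fin T => MeasurableSpace.comap (S t) (⊤ : MeasurableSpace (Finset (Fin n))))) h
  exact h1 _ ⟨{a}, trivial, rfl⟩

namespace Sampling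

variable {P : Measure Ω} {D : Fin n → Measure Ξ} (h : Sampling P D m K T ξ S)

include h

theorem source_le (q : Source n K T) : Sum.elim
    (fun q : Fin (T + 1) × Fin n × Fin K =>
      MeasurableSpace.comap (ξ q.1 q.2.1 q.2.2) inferInstance)
    (fun t : Fin T => MeasurableSpace.comap (S t) (⊤ : MeasurableSpace (Finset (Fin n)))) q ≤
      mΩ := by
  rcases q with ⟨τ, i, k⟩ | t
  · exact (h.measurable_sample τ (by omega) i k k.2).comap_le
  · rintro _ ⟨A, -, rfl⟩
    have : S t ⁻¹' A = ⋃ a ∈ A, S t ⁻¹' {a} := by ext; simp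
    rw [this]
    exact MeasurableSet.biUnion A.to_countable fun a _ => h.measurable_clients t t.2 a

theorem info_le (J : Set (Source n K T)) : info ξ S J ≤ mΩ :=
  iSup₂_le fun q _ => h.source_le q

/-- Each independence needed in a round is of this kind: a block of sources against one source
outside it. -/
theorem indep_info_source {J : Set (Source n K T)} {q : Source n K T} (hq : q ∉ J) :
    Indep (info ξ S J) (Sum.elim
      (fun q : Fin (T + 1) × Fin n × Fin K =>
        MeasurableSpace.comap (ξ q.1 q.2.1 q.2.2) inferInstance)
      (fun t : Fin T => MeasurableSpace.comap (S t) (⊤ : MeasurableSpace (Finset (Fin n)))) q)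
      P := by
  have h1 := indep_iSup_of_disjoint h.source_le h.independent
    (Set.disjoint_singleton_right.2 hq : Disjoint J {q})
  simpa only [Set.mem_singleton_iff, iSup_iSup_eq_left] using h1

theorem indep_clients {t : ℕ} (ht : t < T) : Indep (info ξ S (roundSources n K T (t + 1)))
    (MeasurableSpace.comap (S t) (⊤ : MeasurableSpace (Finset (Fin n)))) P :=
  h.indep_info_source (q := Sum.inr ⟨t, ht⟩) (by simp [roundSources])

variable {du dv : ℕ}

theorem roundSetting {τ : ℕ} (hτ : τ ≤ T) {Y : Ω → State n du dv}
    (hY : MeasurableState (info ξ S (pastSources n K T τ)) Y) (hY2 : MemLpState P Y) :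
    RoundSetting (info ξ S (pastSources n K T τ)) (fun i k => info ξ S (localSources n K T τ i k))
      (fun i k => info ξ S (exceptSources n K T τ i k)) P D K Y (ξ τ) where
  past_le i k := info_mono (by rintro (p | t) <;> simp +contextual [pastSources, localSources])
  mono i k l hkl := info_mono (by
    rintro (p | t)
    · simp only [localSources, Set.mem_ofPred_eq, Sum.elim_inl]
      rintro (hp | ⟨h1, h2, h3⟩)
      · exact Or.inl hp
      · exact Or.inr ⟨h1, h2, h3.trans_le hkl⟩
    · simp [localSources])
  le_except i j k l hij := info_mono (by
    rintro (p | t)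
    · simp only [localSources, exceptSources, Set.mem_ofPred_eq, Sum.elim_inl]
      rintro (hp | ⟨h1, h2, h3⟩)
      · exact Or.inl hp
      · exact Or.inr ⟨h1, hij.imp (fun e => h2 ▸ e) fun e => h3.trans_le e⟩
    · simp [localSources, exceptSources])
  except_le i k := h.info_le _
  measurable_sample i k hk := measurable_info_sample (by omega) i hk (by simp [localSources])
  law i k hk := h.law_sample τ hτ i k hk
  indep i k hk := h.indep_info_source (q := Sum.inl (⟨τ, by omega⟩, i, ⟨k, hk⟩))
    (by simp [exceptSources])
  measurable_state := hY
  memLp_state := hY2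

end Sampling

end Sources

/-! ### Regularity of the run and the initial control error. -/

section Run

variable {n du dv : ℕ} {Ξ Ω : Type*} [MeasurableSpace Ξ] [mΩ : MeasurableSpace Ω]
  {P : Measure Ω} [IsProbabilityMeasure P] {D : Fin n → Measure Ξ}
  [∀ i, IsProbabilityMeasure (D i)] {F : Vec du → Vec dv → Ξ → ℝ} {m K T : ℕ}
  {Lu Luv Lv Lvu : ℝ≥0} {L σu σv γu γv ηu ηv γ : ℝ}
  {ξ : ℕ → Fin n → ℕ → Ω → Ξ} {S : ℕ → Ω → Finset (Fin n)}
  {u₀ : Vec du} {v₀ : Fin n → Vec dv}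

/-- The value of the shared variable when client `i` participated for the last time before round
`t`. -/
noncomputable def anchor (F : Vec du → Vec dv → Ξ → ℝ) (m K : ℕ) (γu γv ηu ηv : ℝ) (u₀ : Vec du)
    (v₀ : Fin n → Vec dv) (ξ : ℕ → Fin n → ℕ → Ω → Ξ) (S : ℕ → Ω → Finset (Fin n)) (ω : Ω) :
    ℕ → Fin n → Vec du
  | 0 => fun _ => u₀
  | t + 1 => fun i => if i ∈ S t ω then (run F m K γu γv ηu ηv u₀ v₀ ξ S ω t).u else
      anchor F m K γu γv ηu ηv u₀ v₀ ξ S ω t i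

omit [MeasurableSpace Ξ] in
theorem localIter_zero_step (x : State n du dv) (i : Fin n) (z : ℕ → Ξ) (k : ℕ) :
    localIter F 0 0 x i z k = (x.u, x.v i) := by
  induction k with
  | zero => rfl
  | succ k ih => simp [localIter, ih]

/-- The initial state before the initialization of the control variables. -/
noncomputable def startState (u₀ : Vec du) (v₀ : Fin n → Vec dv) : State n du dv :=
  ⟨u₀, v₀, fun _ => 0, 0⟩

omit [MeasurableSpace Ξ] in
-- Initialization is treated as a round with zero local step sizes, so the estimates of a round also
-- cover the initial control variables.
theorem initState_c (z : Fin n → ℕ → Ξ) (i : Fin n) : (initState F K u₀ v₀ z).c i =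
    stochMeanU F K 0 0 (startState u₀ v₀) i (z i) := by
  simp only [initState, stochMeanU, localIter_zero_step, startState]

omit mΩ in
theorem measurableState_const (𝓕 : MeasurableSpace Ω) (x : State n du dv) :
    MeasurableState 𝓕 fun _ => x :=
  ⟨measurable_const, fun _ => measurable_const, fun _ => measurable_const, measurable_const⟩

theorem memLpState_const (x : State n du dv) : MemLpState P fun _ => x :=
  ⟨memLp_const _, fun _ => memLp_const _, fun _ => memLp_const _, memLp_const _⟩

namespace Sampling

variable (h : Sampling P D m K T ξ S) (hF : StochasticGradient F D σu σv)
  (hf : Smooth (clientLoss F D) Lu Luv Lv Lvu)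

include h hF hf

theorem memLp_initState :
    MemLpState P fun ω => initState F K u₀ v₀ (fun i k => ξ 0 i k ω) := by
  have h0 := h.roundSetting (Nat.zero_le T)
    (measurableState_const _ (startState u₀ v₀)) (memLpState_const _)
  have hc : ∀ i, MemLp (fun ω => (initState F K u₀ v₀ (fun i k => ξ 0 i k ω)).c i) 2 P := by
    intro i
    simp only [initState_c]
    simp only [h0.stochMeanU_eq hF hf]
    have hX (X : SqInt P (Vec du)) : MemLp (fun ω => X.1 ω) 2 P := X.2
    exact hX _
  exact ⟨memLp_const _, fun _ => memLp_const _, hc, memLp_clientMean hc⟩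

omit mΩ [IsProbabilityMeasure P] [∀ i, IsProbabilityMeasure (D i)] h hf in
theorem measurable_initState : MeasurableState (info ξ S (pastSources n K T 1))
    fun ω => initState F K u₀ v₀ (fun i k => ξ 0 i k ω) := by
  have hc : ∀ i, Measurable[info ξ S (pastSources n K T 1)]
      fun ω => (initState F K u₀ v₀ (fun i k => ξ 0 i k ω)).c i := by
    intro i
    have h1 : Measurable[info ξ S (pastSources n K T 1)]
        fun ω => ∑ k ∈ Finset.range K, stochGradU F u₀ (v₀ i) (ξ 0 i k ω) :=
      Finset.measurable_fun_sum _ fun k hk => hF.measurableU.comp (measurable_const.prodMk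
        (measurable_const.prodMk (measurable_info_sample (Nat.succ_pos T) i
          (Finset.mem_range.1 hk) (by simp [pastSources]))))
    exact h1.const_smul (1 / (K : ℝ))
  have h1 : Measurable[info ξ S (pastSources n K T 1)]
      fun ω => ∑ i, (initState F K u₀ v₀ (fun i k => ξ 0 i k ω)).c i :=
    Finset.measurable_fun_sum _ fun i _ => hc i
  exact ⟨measurable_const, fun _ => measurable_const, hc, h1.const_smul (1 / (n : ℝ))⟩

theorem expControl_initState_le (hn : 1 ≤ n) (hK : 1 ≤ K) :
    expControl P F D (fun ω => initState F K u₀ v₀ (fun i k => ξ 0 i k ω)) (fun _ _ => u₀) ≤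
      3 * (σu ^ 2 / K) := by
  have h0 := h.roundSetting (Nat.zero_le T)
    (measurableState_const _ (startState u₀ v₀)) (memLpState_const _)
  have hM := h0.localModel (γu := 0) (γv := 0) hF hf rfl fun _ => by simp [startState]
  have hn0 : (0 : ℝ) < n := by positivity
  -- Taking `m = n` turns the prefactor `m/n` into `1`, and `g = 0` removes the drift and the move
  -- of `v`; only the noise is left.
  have hd := hM.drift_le (m := n) (g := 0) hK hn le_rfl le_rfl (by positivity) (by norm_num)
    (by simp) (by simp)
  have hc := hM.control_le (m := n) (g := 0) hK hn 
    (x := startGradU P F D fun _ => startState u₀ v₀) fun i => by simp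
  rw [div_self hn0.ne'] at hc
  simp only [one_mul, zero_mul, ne_eq, OfNat.ofNat_ne_zero, not_false_eq_true, zero_pow, mul_zero,
    add_zero] at hc hd
  refine le_trans (le_of_eq ?_) (hc.trans (by linarith))
  have e := HasMean.clientMean fun i => HasMean.norm_sq (startGradU P F D
    (fun _ => startState u₀ v₀) i - stepMean K fun k =>
      localGradU P F D 0 0 (fun _ => startState u₀ v₀) (ξ 0) i k +
        SqInt.of P (noiseU F D 0 0 (fun _ => startState u₀ v₀) (ξ 0) i k))
  rw [← e.2]
  simp only [expControl, SqInt.sub_apply, h0.startGradU_apply hf, ← h0.stochMeanU_eq hF hf,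
    initState_c]
  rfl

/-- The state at the start of round `t` depends on the samples with time index at most `t` and on
the client sets of the rounds before `t`; because of the shifted index these are the sources before
`t + 1`. -/
theorem run_regular {t : ℕ} (ht : t ≤ T) :
    (MeasurableState (info ξ S (pastSources n K T (t + 1)))
        (fun ω => run F m K γu γv ηu ηv u₀ v₀ ξ S ω t) ∧
      MemLpState P fun ω => run F m K γu γv ηu ηv u₀ v₀ ξ S ω t) ∧
    ∀ i, Measurable[info ξ S (pastSources n K T (t + 1))]
        (fun ω => anchor F m K γu γv ηu ηv u₀ v₀ ξ S ω t i) ∧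
      MemLp (fun ω => anchor F m K γu γv ηu ηv u₀ v₀ ξ S ω t i) 2 P := by
  induction t with
  | zero => exact ⟨⟨measurable_initState hF, h.memLp_initState hF hf⟩,
      fun i => ⟨measurable_const, memLp_const _⟩⟩
  | succ t ih =>
    obtain ⟨⟨h1, h2⟩, h3⟩ := ih (by omega)
    -- Round `t` uses the samples with time index `t + 1`.
    have hr := h.roundSetting ht h1 h2
    have hlocal : ∀ i k, info ξ S (localSources n K T (t + 1) i k) ≤
        info ξ S (pastSources n K T (t + 1 + 1)) := fun i k => info_mono (by
      rintro (p | t) <;> simp only [localSources, pastSources, Set.mem_ofPred_eq, Sum.elim_inl,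
        Sum.elim_inr] <;> omega)
    have hpast : info ξ S (pastSources n K T (t + 1)) ≤ info ξ S (pastSources n K T (t + 1 + 1)) :=
      info_mono (by
        rintro (p | t) <;> simp only [pastSources, Set.mem_ofPred_eq, Sum.elim_inl,
          Sum.elim_inr] <;> omega)
    have hS : ∀ a : Finset (Fin n),
        MeasurableSet[info ξ S (pastSources n K T (t + 1 + 1))] (S t ⁻¹' {a}) :=
      measurableSet_info_clients (by omega : t < T) (by simp [pastSources])
    have hS' : ∀ a : Finset (Fin n), MeasurableSet (S t ⁻¹' {a}) := fun a =>
      h.measurable_clients t (by omega) a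
    have hmeas := hr.measurableState_round (m := m) (γu := γu) (γv := γv) (ηu := ηu) (ηv := ηv)
      hF hlocal hpast
    have hmem := hr.memLpState_round (m := m) (γu := γu) (γv := γv) (ηu := ηu) (ηv := ηv) hF hf
    refine ⟨⟨⟨?_, fun i => ?_, fun i => ?_, ?_⟩, ⟨?_, fun i => ?_, fun i => ?_, ?_⟩⟩, fun i =>
      ⟨?_, ?_⟩⟩
    · exact measurable_comp_clients hS fun a => (hmeas a).u
    · exact measurable_comp_clients hS fun a => (hmeas a).v i
    · exact measurable_comp_clients hS fun a => (hmeas a).c i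
    · exact measurable_comp_clients hS fun a => (hmeas a).cbar
    · exact memLp_comp_clients hS' fun a => (hmem a).u
    · exact memLp_comp_clients hS' fun a => (hmem a).v i
    · exact memLp_comp_clients hS' fun a => (hmem a).c i
    · exact memLp_comp_clients hS' fun a => (hmem a).cbar
    · refine measurable_comp_clients (ψ := fun a ω => if i ∈ a then
        (run F m K γu γv ηu ηv u₀ v₀ ξ S ω t).u else anchor F m K γu γv ηu ηv u₀ v₀ ξ S ω t i)
        hS fun a => ?_
      split_ifs
      · exact h1.u.mono hpast le_rfl
      · exact (h3 i).1.mono hpast le_rfl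
    · refine memLp_comp_clients (ψ := fun a ω => if i ∈ a then
        (run F m K γu γv ηu ηv u₀ v₀ ξ S ω t).u else anchor F m K γu γv ηu ηv u₀ v₀ ξ S ω t i)
        hS' fun a => ?_
      split_ifs
      · exact h2.u
      · exact (h3 i).2

end Sampling

end Run

/-! ### Summation over all rounds. -/

section Descent

variable {n du dv : ℕ} {Ξ Ω : Type*} [MeasurableSpace Ξ] [mΩ : MeasurableSpace Ω]
  {P : Measure Ω} [IsProbabilityMeasure P] {D : Fin n → Measure Ξ}
  [∀ i, IsProbabilityMeasure (D i)] {F : Vec du → Vec dv → Ξ → ℝ} {m K T : ℕ}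
  {Lu Luv Lv Lvu : ℝ≥0} {L σu σv γu γv ηu ηv γ : ℝ}
  {ξ : ℕ → Fin n → ℕ → Ω → Ξ} {S : ℕ → Ω → Finset (Fin n)}
  {u₀ : Vec du} {v₀ : Fin n → Vec dv}

omit [∀ i, IsProbabilityMeasure (D i)] in
theorem ciInf_loss_le_expLoss (hf : Smooth (clientLoss F D) Lu Luv Lv Lvu)
    (hbdd : BddBelow (Set.range fun p : Vec du × (Fin n → Vec dv) => loss F D p.1 p.2))
    {Y : Ω → State n du dv} (hY : MemLpState P Y) :
    ⨅ p : Vec du × (Fin n → Vec dv), loss F D p.1 p.2 ≤ expLoss P F D Y := by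
  have h := integral_mono (integrable_const (μ := P)
    (⨅ p : Vec du × (Fin n → Vec dv), loss F D p.1 p.2)) (integrable_loss hf hY)
    fun ω => ciInf_loss_le hbdd (Y ω).u (Y ω).v
  rwa [integral_const, probReal_univ, one_smul] at h

theorem Sampling.sum_expGrad_le (h : Sampling P D m K T ξ S)
    (hF : StochasticGradient F D σu σv) (hf : Smooth (clientLoss F D) Lu Luv Lv Lvu)
    (hm : 1 ≤ m) (hmn : m ≤ n) (hK : 1 ≤ K)
    (hbdd : BddBelow (Set.range fun p : Vec du × (Fin n → Vec dv) => loss F D p.1 p.2))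
    (hL : L = (max (max Lu Lv) (max Luv Lvu) : ℝ≥0)) (hγu : γu * ηu = γ) (hγv : γv * ηv = γ)
    (hγ : 0 < γ) (hηu : √(m : ℝ) ≤ ηu) (hηv : √((n : ℝ) / m) ≤ ηv)
    (hθ : 72 * max ((n : ℝ) ^ (2 / 3 : ℝ) / m) 1 * (γ * K * L) ≤ 1) :
    γ * K * (∑ t ∈ Finset.range T,
      (expGradU F D P (fun ω => run F m K γu γv ηu ηv u₀ v₀ ξ S ω t) +
        expGradV F D P m fun ω => run F m K γu γv ηu ηv u₀ v₀ ξ S ω t)) / 4 ≤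
      initialGap F D u₀ v₀ +
        37 * (L * (γ * K) ^ 2 * ((σu ^ 2 / m + m * σv ^ 2 / n) / K)) * T := by
  have hn : 1 ≤ n := hm.trans hmn
  have hm1 : (1 : ℝ) ≤ m := by exact_mod_cast hm
  have hmn' : (m : ℝ) ≤ n := by exact_mod_cast hmn
  have hm0 : (0 : ℝ) < m := by positivity
  have hn0 : (0 : ℝ) < n := by positivity
  have hK0 : (0 : ℝ) < K := by positivity
  have hL0 : 0 ≤ L := by rw [hL]; positivity
  have hg0 : 0 < γ * K := by positivity
  obtain ⟨hθ1, hθ2, hθ3⟩ := step_size_bounds hm1 hmn' (by positivity) hθ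
  set X : ℕ → Ω → State n du dv := fun t ω => run F m K γu γv ηu ηv u₀ v₀ ξ S ω t with hX
  set y : ℕ → Ω → Fin n → Vec du := fun t ω => anchor F m K γu γv ηu ηv u₀ v₀ ξ S ω t with hy
  have hreg : ∀ t ≤ T, (MeasurableState (info ξ S (pastSources n K T (t + 1))) (X t) ∧
      MemLpState P (X t)) ∧ ∀ i, Measurable[info ξ S (pastSources n K T (t + 1))]
        (fun ω => y t ω i) ∧ MemLp (fun ω => y t ω i) 2 P := fun t ht => h.run_regular hF hf ht
  obtain ⟨ς, hς⟩ : ∃ ς, ς = σu ^ 2 / K / m + (m : ℝ) / n * (σv ^ 2 / K) := ⟨_, rfl⟩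
  have hς0 : 0 ≤ ς := by rw [hς]; positivity
  have hex := fun (t : ℕ) (ht : t < T) =>
    (h.roundSetting ht (hreg t ht.le).1.1 (hreg t ht.le).1.2).exists_recursion hf hF hm hmn hK
      (h.measurable_clients t ht) (h.law_clients t ht) (h.indep_clients ht)
      (fun i k => info_mono (by
        rintro (p | q) <;> simp only [localSources, roundSources, Set.mem_ofPred_eq, Sum.elim_inl,
          Sum.elim_inr] <;> omega))
      (info_mono (by
        rintro (p | q) <;> simp only [pastSources, roundSources, Set.mem_ofPred_eq, Sum.elim_inl,
          Sum.elim_inr] <;> omega))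
      (fun ω => run_cbar u₀ v₀ ξ S ω t) (fun i => ((hreg t ht.le).2 i).1)
      (fun i => ((hreg t ht.le).2 i).2) hL hγu hγv hγ hηu hηv hθ1 rfl rfl hς
      (Y' := X (t + 1)) (y' := y (t + 1)) (fun ω => rfl) (fun ω i => rfl)
  choose! M Q w Z Δ e hM hQ hw hZ hΔ h1 h2 h3 h4 h5 h6 h7 using hex
  have hbound := sum_le_of_recursions (T := T) (θ := γ * K * L) (s := ς)
    (c := (⨅ p : Vec du × (Fin n → Vec dv), loss F D p.1 p.2) / (γ * K))
    (φ := fun t => expLoss P F D (X t) / (γ * K))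
    (G := fun t => expGradU F D P (X t) + expGradV F D P m (X t))
    (A := fun t => L ^ 2 * expAnchor P (X t) (y t)) (B := fun t => expControl P F D (X t) (y t))
    (M := M) (Q := Q) (w := w) (z := Z) (Δ := Δ) (e := e) hm1 hmn' (by positivity) hθ1 hθ2 hθ3
    (fun t => add_nonneg expGradU_nonneg expGradV_nonneg) hM hQ
    (fun t => mul_nonneg (sq_nonneg L) expAnchor_nonneg) hς0 hw hZ hΔ h1 h2 h3 h4 h5 h6 h7
    ?_ ?_ ?_
  · have h0 : expLoss P F D (X 0) = loss F D u₀ v₀ := by simp [expLoss, hX, run, initState]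
    simp only [h0] at hbound
    rw [← sub_div] at hbound
    -- The recursions are in units of `E f/g`; multiplying by `g = γK` restores the gap of the
    -- objective.
    have h8 := mul_le_mul_of_nonneg_left hbound hg0.le
    rw [mul_add, mul_div_cancel₀ _ hg0.ne', ← mul_div_assoc] at h8
    refine h8.trans (le_of_eq ?_)
    rw [initialGap, hς]
    field_simp
  · simp [expAnchor, hX, hy, run, initState, anchor, clientMean]
  · refine (h.expControl_initState_le hF hf hn hK).trans ?_
    rw [hς, mul_add]
    have e1 : (m : ℝ) * (σu ^ 2 / K / m) = σu ^ 2 / K := by field_simp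
    rw [e1]
    have : 0 ≤ (m : ℝ) * ((m : ℝ) / n * (σv ^ 2 / K)) := by positivity
    linarith
  · exact div_le_div_of_nonneg_right (ciInf_loss_le_expLoss hf hbdd (hreg T le_rfl).1.2) hg0.le

end Descent

end ScaffoldP

/-! ### The convergence rate. -/

theorem mainTheorem5 {n du dv : ℕ} {Ξ Ω : Type*} [MeasurableSpace Ξ] [MeasurableSpace Ω]
    (P : Measure Ω) [IsProbabilityMeasure P]
    (F : ScaffoldP.Vec du → ScaffoldP.Vec dv → Ξ → ℝ)
    (D : Fin n → Measure Ξ) [∀ i, IsProbabilityMeasure (D i)]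
    (m K T : ℕ) (hm : 1 ≤ m) (hmn : m ≤ n) (hK : 1 ≤ K) (hT : 1 ≤ T)
    (Lu Luv Lv Lvu : ℝ≥0) (L : ℝ) (hL : L = (max (max Lu Lv) (max Luv Lvu) : ℝ≥0))
    (hsmooth : ScaffoldP.Smooth (ScaffoldP.clientLoss F D) Lu Luv Lv Lvu)
    (σu σv : ℝ) (hstoch : ScaffoldP.StochasticGradient F D σu σv)
    (ξ : ℕ → Fin n → ℕ → Ω → Ξ) (S : ℕ → Ω → Finset (Fin n))
    (hsampling : ScaffoldP.Sampling P D m K T ξ S)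
    (u₀ : ScaffoldP.Vec du) (v₀ : Fin n → ScaffoldP.Vec dv)
    (hbdd : BddBelow (Set.range fun p : ScaffoldP.Vec du × (Fin n → ScaffoldP.Vec dv) =>
      ScaffoldP.loss F D p.1 p.2))
    (F₀ : ℝ) (hF₀ : F₀ = ScaffoldP.initialGap F D u₀ v₀) (hF₀_pos : 0 < F₀)
    (γ γu γv ηu ηv : ℝ)
    (hγ : γ = (72 * L * K * max ((n : ℝ) ^ (2 / 3 : ℝ) / m) 1 +
      √(37 * L * K * T / F₀ * (σu ^ 2 / m + m * σv ^ 2 / n)))⁻¹)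
    (hγu : γu * ηu = γ) (hγv : γv * ηv = γ)
    (hηu : √(m : ℝ) ≤ ηu) (hηv : √((n : ℝ) / m) ≤ ηv)
    (X : ℕ → Ω → ScaffoldP.State n du dv)
    (hX : X = fun t ω => ScaffoldP.run F m K γu γv ηu ηv u₀ v₀ ξ S ω t) :
    -- all expectations involved are finite
    (∀ t < T, Integrable (fun ω => ScaffoldP.sqGradU F D (X t ω)) P ∧
      ∀ i, Integrable (fun ω => ScaffoldP.sqGradV F D i (X t ω)) P) ∧
    -- the convergence rate
    (1 / (T : ℝ)) * ∑ t ∈ Finset.range T,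
        (ScaffoldP.expGradU F D P (X t) + ScaffoldP.expGradV F D P m (X t)) ≤
      8 * √(37 * L * F₀ / (K * T) * (σu ^ 2 / m + m * σv ^ 2 / n)) +
        288 * L * F₀ / T * max 1 ((n : ℝ) ^ (2 / 3 : ℝ) / m) ∧
    -- the rate without personal variables
    (dv = 0 → σv = 0 →
      (1 / (T : ℝ)) * ∑ t ∈ Finset.range T, ScaffoldP.expGradU F D P (X t) ≤
        8 * √(37 * L * F₀ / (K * T) * (σu ^ 2 / m)) +
          288 * L * F₀ / T * max 1 ((n : ℝ) ^ (2 / 3 : ℝ) / m)) ∧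
    -- its last factor compared with the factor `(n / m) ^ (2 / 3)` of the known rate
    max 1 ((n : ℝ) ^ (2 / 3 : ℝ) / m) ≤ ((n : ℝ) / m) ^ (2 / 3 : ℝ) ∧
    (1 < m → m < n →
      max 1 ((n : ℝ) ^ (2 / 3 : ℝ) / m) < ((n : ℝ) / m) ^ (2 / 3 : ℝ)) := by
  have hn : 1 ≤ n := hm.trans hmn
  have hm1 : (1 : ℝ) ≤ m := by exact_mod_cast hm
  have hm0 : (0 : ℝ) < m := by positivity
  have hn0 : (0 : ℝ) < n := by positivity
  have hK0 : (0 : ℝ) < K := by positivity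
  have hT0 : (0 : ℝ) < T := by positivity
  have hL0 : 0 ≤ L := by rw [hL]; positivity
  subst hX
  have hrate : (1 / (T : ℝ)) * ∑ t ∈ Finset.range T,
      (ScaffoldP.expGradU F D P
          (fun ω => ScaffoldP.run F m K γu γv ηu ηv u₀ v₀ ξ S ω t) +
        ScaffoldP.expGradV F D P m
          (fun ω => ScaffoldP.run F m K γu γv ηu ηv u₀ v₀ ξ S ω t)) ≤
      8 * √(37 * L * F₀ / (K * T) * (σu ^ 2 / m + m * σv ^ 2 / n)) +
        288 * L * F₀ / T * max 1 ((n : ℝ) ^ (2 / 3 : ℝ) / m) := by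
    -- For `L = 0` the denominator in `γ` vanishes, so `γ = 0` by convention and there is no descent
    -- to exploit. All gradients are then zero.
    rcases hL0.eq_or_lt with hL0 | hL0
    · rw [← hL0] at hL
      have hzero := ScaffoldP.gradients_eq_zero_of_lipschitz_zero hn hsmooth hL hbdd
      simp [ScaffoldP.expGradU, ScaffoldP.expGradV, ScaffoldP.sqGradU, ScaffoldP.sqGradV,
        fun u v => (hzero u v).1, fun u v i => (hzero u v).2 i, ← hL0]
    · set N := max ((n : ℝ) ^ (2 / 3 : ℝ) / m) 1 with hN
      have hN0 : 0 < N := one_pos.trans_le (le_max_right _ _)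
      have hγ0 : 0 < γ := by rw [hγ]; positivity
      have hθ : 72 * N * (γ * K * L) ≤ 1 := by
        have h1 : 72 * N * (γ * K * L) = (72 * L * K * N) * γ := by ring
        rw [h1, hγ]
        exact mul_inv_le_one_of_le₀ (le_add_of_nonneg_right (Real.sqrt_nonneg _)) (by positivity)
      rw [max_comm, ← hN]
      refine ScaffoldP.rate_of_descent hL0 hK0 hT0 hF₀_pos hN0 (by positivity) hγ ?_
      rw [hF₀]
      exact hsampling.sum_expGrad_le hstoch hsmooth hm hmn hK hbdd hL hγu hγv hγ0 hηu hηv hθ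
  refine ⟨fun t ht => ?_, hrate, fun _ hσv => ?_, ScaffoldP.max_one_rpow_div_le hm hmn,
    ScaffoldP.max_one_rpow_div_lt⟩
  · have hreg := (hsampling.run_regular (γu := γu) (γv := γv) (ηu := ηu) (ηv := ηv) (u₀ := u₀)
      (v₀ := v₀) hstoch hsmooth ht.le).1.2
    exact ⟨ScaffoldP.integrable_sqGradU hsmooth hreg, ScaffoldP.integrable_sqGradV hsmooth hreg⟩
  · rw [hσv] at hrate
    simp only [ne_eq, OfNat.ofNat_ne_zero, not_false_eq_true, zero_pow, mul_zero, zero_div,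
      add_zero] at hrate
    refine le_trans ?_ hrate
    gcongr
    exact le_add_of_nonneg_right ScaffoldP.expGradV_nonneg
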